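/- **Setting.** Let $C\subset\mathbb P^2$ be a real rational quartic with real normalization $\nu:\mathbb P^1\to C$ (given by three real binary forms of degree 4), all of whose singular points are nodes. A real node is *hyperbolic* if its two branches are real and *elliptic* if they are complex conjugate. Let $\Sigma$ be the set of nodes, and let $D^-$ be a real effective divisor consisting of two distinct (real or conjugate) points of $\mathbb P^1$, disjoint from $\nu^{-1}(\Sigma)$. For a real effective divisor $D^+$ of degree 6 on $\mathbb P^1$ disjoint from $D^-$, let $q$ and $F$ be real binary forms with zero divisors $D^-$ and $D^+$, and let $K'\subset\mathbb P^3$ be the sextic parametrized by $[q\nu_0:q\nu_1:q\nu_2:F]$. Projection from $p=[0:0:0:1]$ maps $K'$ to $C$, $D^-$ is the preimage of $p$ on the normalization, and $D^+$ is the section by the plane $x_3=0$. Put $D=D^+-D^-$. The pair $(C,D)$ is a *nodal diagram* if $K'$ has an ordinary double point at $p$ and is nonsingular elsewhere. It is *3D-explicit* if, over each hyperbolic node $u$, the plane $x_3=0$ separates the two points of $K'$ over $u$ in the affine real line $\overline{pu}\smallsetminus\{p\}$. A *virtual nodal diagram* $(C;D^-,\tau,\sigma)$ consists of $C$ and $D^-$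 as above, of upper/lower data $\tau$ (at each hyperbolic node one of the two branches is called upper and the other lower; at each real point of $D^-$ one of the two adjacent half-arcs is called upper and the other lower), and of a sign $\sigma(u)=\pm1$ for each elliptic node $u$. Here upper and lower refer to the sign of the height coordinate $F/q$ in the real line over the point $\nu(x)$, oriented by the vector $(\nu_0,\nu_1,\nu_2)(x)$. A nodal diagram together with the sign of $F$ *realizes* the virtual diagram if the signs of $F/q$ give $\tau$ and the solitary crossing signs of $K'$ over the elliptic nodes give $\sigma$. A *diagram arc* is a connected component of $\mathbb R\mathbb P^1\smallsetminus(\nu^{-1}(\Sigma)\cup D^-)$. It is *odd* if the half-arcs at its two ends are of opposite kinds according to $\tau$, which for a realizing diagram means that it contains an odd number of points of $D^+$, counted with multiplicity. **Proposition.** Let $(C;D^-,\tau,\sigma)$ be a virtual nodal diagram on a real rational nodal quartic $C$ all of whose real nodes are hyperbolic. 1. The diagram is realizable by a 3D-explicit nodal diagram $(C,D)$ if and only if it has at most 6 odd arcs. 2. In this case, for each sign $c=\pm1$, there is an embedded real rational sextic $K\subset\mathbb P^3$ obtained from the curve $K'$ of a realizing 3D-explicit nodal diagram by a deformation of sign $c$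 (a deformation through embedded real rational sextics, starting transversely to the set of curves with a double point, that resolves the double point $p$ of $K'$ into a crossing of sign $c$, a solitary crossing if the two branches at $p$ are complex conjugate). Any two such curves $K$ (for the same virtual diagram and the same $c$) are rigidly isotopic, that is, connected by a continuous path of embedded real rational sextics in $\mathbb P^3$. -/

import Mathlib

open Filter Topology

noncomputable section

namespace RealSextic

/-! ### Rational curves given by binary forms

A real rational curve in projective space is the image of `P¹` under a tuple of real binary forms of
the same degree; points of `P¹(ℂ)` are nonzero vectors `z : Fin 2 → ℂ` up to scaling, and the real
structure is coordinatewise complex conjugation `star`. -/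

/-- Real polynomials in two variables. -/
abbrev Form := MvPolynomial (Fin 2) ℝ

/-- A real vector regarded as a complex vector. -/
def cx {ι : Type} (r : ι → ℝ) : ι → ℂ := fun i => (r i : ℂ)

/-- The `2 × 2` determinant. Two vectors `z`, `w` with `cross z w ≠ 0` are nonzero and represent two
distinct points of `P¹`; nonzero `z`, `w` with `cross z w = 0` represent the same point. -/
def cross {R : Type} [CommRing R] (z w : Fin 2 → R) : R := z 0 * w 1 - z 1 * w 0

/-- The value of a tuple of forms at a complex point. -/
def val {ι : Type} (G : ι → Form) (z : Fin 2 → ℂ) : ι → ℂ :=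
  fun i => MvPolynomial.aeval z (G i)

/-- The value of a tuple of forms at a real point. -/
def rval {ι : Type} (G : ι → Form) (x : Fin 2 → ℝ) : ι → ℝ :=
  fun i => MvPolynomial.eval x (G i)

/-- The value at `z` of the `j`-th partial derivative of a tuple of forms. -/
def dval {ι : Type} (G : ι → Form) (j : Fin 2) (z : Fin 2 → ℂ) : ι → ℂ :=
  fun i => MvPolynomial.aeval z (MvPolynomial.pderiv j (G i))

/-- A complex vector representing a real point of projective space. -/
def IsRealVec {ι : Type} (v : ι → ℂ) : Prop :=
  ∃ a : ℂ, a ≠ 0 ∧ ∃ r : ι → ℝ, v = a • cx r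

/-- The tuple `G` consists of forms of degree `d` and defines an immersion of `P¹(ℂ)` into projective
space. (By Euler's identity, independence of the two partial derivatives at `z` says that
`G z ≠ 0` and that the differential of `z ↦ [G z]` at `z` is injective.) -/
structure IsImmersed {ι : Type} (d : ℕ) (G : ι → Form) : Prop where
  homogeneous : ∀ i, (G i).IsHomogeneous d
  immersion : ∀ z : Fin 2 → ℂ, z ≠ 0 → LinearIndependent ℂ ![dval G 0 z, dval G 1 z]

/-- Two distinct points `z`, `w` of `P¹(ℂ)` have the same image under `[G]`. -/
def IsDoublePair {ι : Type} (G : ι → Form) (z w : Fin 2 → ℂ) : Prop :=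
  cross z w ≠ 0 ∧ ¬ LinearIndependent ℂ ![val G z, val G w]

/-- The (complex) curve in projective space parametrized by `G`. -/
def curve {ι : Type} (G : ι → Form) : Set (Projectivization ℂ (ι → ℂ)) :=
  {P | ∃ (z : Fin 2 → ℂ) (h : val G z ≠ 0), P = Projectivization.mk ℂ (val G z) h}

/-- `G` parametrizes a nonsingular (embedded) real rational curve of degree `d`. -/
structure IsEmbedded {ι : Type} (d : ℕ) (G : ι → Form) : Prop extends IsImmersed d G where
  injective : ∀ z w : Fin 2 → ℂ, ¬ IsDoublePair G z w

/-- All coefficients of the forms in the family `G t` depend continuously on `t ∈ [0, 1]`. -/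
def ContinuousFamily {ι : Type} (G : ℝ → ι → Form) : Prop :=
  ∀ (i : ι) (m : Fin 2 →₀ ℕ), ContinuousOn (fun t => (G t i).coeff m) (Set.Icc 0 1)

/-- Rigid isotopy of real rational curves in `P³`: a deformation in the class of nonsingular real
rational curves of degree `d`. -/
def RigidlyIsotopic (d : ℕ) (K₁ K₂ : Set (Projectivization ℂ (Fin 4 → ℂ))) : Prop :=
  ∃ G : ℝ → Fin 4 → Form, ContinuousFamily G ∧
    (∀ t ∈ Set.Icc (0 : ℝ) 1, IsEmbedded d (G t)) ∧ curve (G 0) = K₁ ∧ curve (G 1) = K₂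

/-! ### Nodal plane curves -/

/-- `ν : P¹ → P²` is the normalization of a real rational plane curve of degree `d` all of whose
singular points are nodes (ordinary double points). -/
structure IsNodalCurve (d : ℕ) (ν : Fin 3 → Form) : Prop extends IsImmersed d ν where
  transverse : ∀ z w : Fin 2 → ℂ, IsDoublePair ν z w →
    Submodule.span ℂ {dval ν 0 z, dval ν 1 z, dval ν 0 w, dval ν 1 w} = ⊤
  no_triple : ∀ z₁ z₂ z₃ : Fin 2 → ℂ, IsDoublePair ν z₁ z₂ → IsDoublePair ν z₂ z₃ →
    ¬ IsDoublePair ν z₁ z₃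

/-- Every real node is hyperbolic: its two branches are real. -/
def AllRealNodesHyperbolic (ν : Fin 3 → Form) : Prop :=
  ∀ z w : Fin 2 → ℂ, IsDoublePair ν z w → IsRealVec (val ν z) → IsRealVec z ∧ IsRealVec w

/-- A point of `P²(ℝ)` is an elliptic (solitary) node: its two branches are complex conjugate. -/
def IsEllipticNode (ν : Fin 3 → Form) (u : Projectivization ℝ (Fin 3 → ℝ)) : Prop :=
  ∃ z : Fin 2 → ℂ, IsDoublePair ν z (star z) ∧ ∃ a : ℂ, val ν z = a • cx u.rep

/-! ### The spatial curve defined by a diagram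

A real effective divisor of degree `n` on `P¹` is given by a nonzero real binary form of degree `n`,
up to scaling. Let `D⁻` be given by `q` (degree 2) and `D⁺` by `F` (degree `d`), and let `ν` be a
plane curve of degree `d - 2`. The curve `K'` is parametrized by `[q ν₀ : q ν₁ : q ν₂ : F]`. The
projection from `p = [0:0:0:1]` maps it to the plane curve, `D⁻` is the preimage of `p`, and `D⁺` is
the section by the plane `x₃ = 0`. -/

/-- The lift of the plane curve `ν` defined by `q` and `F`. -/
def lift (ν : Fin 3 → Form) (q F : Form) : Fin 4 → Form :=
  ![q * ν 0, q * ν 1, q * ν 2, F]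

/-- `G` is an immersed curve of degree `d` in `P³`, its only singular point is the common
image of `x ≠ y`, and this is an ordinary double point (the two tangent lines are distinct, so that
they span a plane). -/
structure IsOneNodal (d : ℕ) (G : Fin 4 → Form) (x y : Fin 2 → ℂ) : Prop
    extends IsImmersed d G where
  double : IsDoublePair G x y
  transverse : Module.finrank ℂ
    (Submodule.span ℂ {dval G 0 x, dval G 1 x, dval G 0 y, dval G 1 y}) = 3
  only : ∀ z w : Fin 2 → ℂ, IsDoublePair G z w →
    (cross z x = 0 ∧ cross w y = 0) ∨ (cross z y = 0 ∧ cross w x = 0)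

/-- The linking number type expression `det (∂₀G(x), ∂₁G(x), ∂₀G(y), ∂₁G(y))` of the two tangent
lines. It is real if `x`, `y` are real or complex conjugate, and then its sign depends only on the
points of `P¹` represented by `x`, `y` and on the orientation of `P³(ℝ)`. If a line through a real
point meets the curve exactly at `x` and `y`, it is the sign of the corresponding crossing (for
complex conjugate `x`, `y`: the sign of the corresponding solitary crossing). -/
def crossingDet (G : Fin 4 → Form) (x y : Fin 2 → ℂ) : ℂ :=
  Matrix.det (Matrix.of ![dval G 0 x, dval G 1 x, dval G 0 y, dval G 1 y])

/-- `(C, D)` with `D = D⁺ - D⁻` is a nodal diagram of a curve of degree 6: the divisors `D⁺` and `D⁻`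
have no common points, and the curve `K'` has an ordinary double point at `p` coming from the two
points of `D⁻` and no other singularities. -/
structure IsNodalDiagram (ν : Fin 3 → Form) (q F : Form) : Prop where
  homogeneous : F.IsHomogeneous 6
  disjoint : ∀ z : Fin 2 → ℂ, z ≠ 0 → MvPolynomial.aeval z q = 0 → MvPolynomial.aeval z F ≠ 0
  oneNodal : ∃ x y : Fin 2 → ℂ, MvPolynomial.aeval x q = 0 ∧ MvPolynomial.aeval y q = 0 ∧
    IsOneNodal 6 (lift ν q F) x y

/-- The height `h` of the point `[ν(x) : h]` of `K'` over the plane `x₃ = 0`, in the fibre over `ν(x)`,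
which is oriented by the vector `ν(x) ∈ ℝ³` (this orientation depends only on the point of `P¹(ℝ)`
represented by `x` when `ν` has even degree). -/
def height (q F : Form) (x : Fin 2 → ℝ) : ℝ :=
  MvPolynomial.eval x F / MvPolynomial.eval x q

/-- The divisor is 3D-explicit: over each hyperbolic node the plane cutting `D⁺` separates, in the
real line through `p` with `p` removed, the two points of `K'`. If `ν(x) = s ν(y)`, then the heights
of these points in the frame `ν(y)` are `height x / s` and `height y`. -/
def Is3DExplicit (ν : Fin 3 → Form) (q F : Form) : Prop :=
  ∀ (x y : Fin 2 → ℝ) (s : ℝ), IsDoublePair ν (cx x) (cx y) → rval ν x = s • rval ν y →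
    s * height q F x * height q F y < 0

/-! ### Virtual nodal diagrams -/

/-- A point of `P¹(ℝ)` which belongs to `D⁻` or is mapped to a hyperbolic node. -/
def IsMarked (ν : Fin 3 → Form) (q : Form) (x : Projectivization ℝ (Fin 2 → ℝ)) : Prop :=
  MvPolynomial.eval x.rep q = 0 ∨
    ∃ y : Projectivization ℝ (Fin 2 → ℝ), IsDoublePair ν (cx x.rep) (cx y.rep)

/-- A virtual nodal diagram `(C; D⁻, τ, σ)` on a real rational nodal quartic `C`.

* `ν` is the normalization of `C`, and the zeros of `q` form the divisor `D⁻`, which consists of two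
  distinct (real or complex conjugate) points and avoids the preimages of the nodes.
* `τ` is the upper/lower information: `τ x = 1` if the half-arc that follows the marked
  point `x` in the positive direction of `P¹(ℝ)` is upper, and `τ x = -1` if it is lower (heights as
  in `height`). At a preimage of a node the half-arc that precedes `x` is of the same kind; at
  a point of `D⁻` it is of the opposite kind. At a node, one branch is over and the other is under.
* `σ` attaches a sign to each elliptic node. -/
structure VirtualNodalDiagram where
  ν : Fin 3 → Form
  nodal : IsNodalCurve 4 ν
  q : Form
  q_homogeneous : q.IsHomogeneous 2
  q_reduced : ∀ z : Fin 2 → ℂ, z ≠ 0 → MvPolynomial.aeval z q = 0 →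
    ∃ j, MvPolynomial.aeval z (MvPolynomial.pderiv j q) ≠ 0
  q_avoids_nodes : ∀ z w : Fin 2 → ℂ, IsDoublePair ν z w → MvPolynomial.aeval z q ≠ 0
  τ : {x // IsMarked ν q x} → ℤˣ
  τ_over_under : ∀ (x y : {x // IsMarked ν q x}) (s : ℝ),
    IsDoublePair ν (cx x.1.rep) (cx y.1.rep) → rval ν x.1.rep = s • rval ν y.1.rep →
      s * ((τ x : ℤ) : ℝ) * ((τ y : ℤ) : ℝ) < 0
  σ : {u // IsEllipticNode ν u} → ℤˣ

namespace VirtualNodalDiagram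

/-- The marked points, that is, the ends of the diagram arcs. -/
abbrev Marked (V : VirtualNodalDiagram) := {x // IsMarked V.ν V.q x}

/-- The point `z` lies on the open arc of `P¹(ℝ)` that goes from `a` to `b` in the positive
(counterclockwise) direction. -/
def Between (a z b : Projectivization ℝ (Fin 2 → ℝ)) : Prop :=
  0 < cross a.rep z.rep * cross z.rep b.rep * cross a.rep b.rep

/-- The diagram arcs, that is, the connected components of the real curve without its nodes and the
points of `D⁻`. An arc is represented by its initial and its terminal end, which are two consecutive
marked points. -/
def arcs (V : VirtualNodalDiagram) : Set (V.Marked × V.Marked) :=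
  {A | A.1 ≠ A.2 ∧ ∀ z : V.Marked, ¬ Between A.1.1 z.1 A.2.1}

open Classical in
/-- The kind (upper or lower) of the half-arc that precedes a marked point. -/
def τBefore (V : VirtualNodalDiagram) (x : V.Marked) : ℤˣ :=
  if MvPolynomial.eval x.1.rep V.q = 0 then - V.τ x else V.τ x

/-- An arc is odd if the number of points of `D⁺` on it, that is, the number of zeros of the height
function, has to be odd: its half-arcs at the two ends are of opposite kinds. -/
def oddArcs (V : VirtualNodalDiagram) : Set (V.Marked × V.Marked) :=
  {A ∈ V.arcs | V.τ A.1 ≠ V.τBefore A.2}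

/-- `(C; D⁻, τ, σ)` is realized by the 3D-explicit nodal diagram `(C, D)`, where `D⁺` is given by `F`
(the sign of `F` only chooses between the two mirror images of `K'` that have the diagram `(C, D)`). -/
structure IsRealizedBy (V : VirtualNodalDiagram) (F : Form) : Prop where
  diagram : IsNodalDiagram V.ν V.q F
  explicit : Is3DExplicit V.ν V.q F
  tau : ∀ x : V.Marked, ∀ᶠ ε in 𝓝[>] (0 : ℝ),
    0 < ((V.τ x : ℤ) : ℝ) *
      height V.q F (x.1.rep + ε • ![- x.1.rep 1, x.1.rep 0])
  sigma : ∀ (u : {u // IsEllipticNode V.ν u}) (z : Fin 2 → ℂ), IsDoublePair V.ν z (star z) →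
    (∃ a : ℂ, val V.ν z = a • cx u.1.rep) →
      0 < ((V.σ u : ℤ) : ℝ) * (crossingDet (lift V.ν V.q F) z (star z)).re

end VirtualNodalDiagram

/-! ### Resolving the double point -/

/-- The embedded curve `K` of degree `d` is obtained from the one-nodal curve parametrized by `G₀` by a
deformation of sign `c`: there is a path starting at `G₀`, otherwise consisting of embedded
curves, whose initial velocity is transverse to the set of curves with a double point and
resolves the double point (the common image of the real or complex conjugate points `x`, `y`) into a
crossing of sign `c`. -/
def IsResolution (d : ℕ) (c : ℤˣ) (G₀ : Fin 4 → Form)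
    (K : Set (Projectivization ℂ (Fin 4 → ℂ))) : Prop :=
  ∃ G : ℝ → Fin 4 → Form, ContinuousFamily G ∧ G 0 = G₀ ∧
    (∀ t ∈ Set.Ioc (0 : ℝ) 1, IsEmbedded d (G t)) ∧ curve (G 1) = K ∧
    (∀ (i : Fin 4) (m : Fin 2 →₀ ℕ),
      DifferentiableWithinAt ℝ (fun t => (G t i).coeff m) (Set.Ici 0) 0) ∧
    ∃ x y : Fin 2 → ℂ, IsDoublePair G₀ x y ∧ ((star x = x ∧ star y = y) ∨ y = star x) ∧
      ∃ w : ℝ, 0 < ((c : ℤ) : ℝ) * w ∧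
        HasDerivWithinAt (fun t => (crossingDet (G t) x y).re) w (Set.Ici 0) 0

/-- The sextic `K` results from the virtual diagram `V` and the sign of deformation `c`: it is obtained
by a deformation of sign `c` from the curve `K'` of a 3D-explicit nodal diagram realizing `V`. -/
def VirtualNodalDiagram.Yields (V : VirtualNodalDiagram) (c : ℤˣ)
    (K : Set (Projectivization ℂ (Fin 4 → ℂ))) : Prop :=
  ∃ F : Form, V.IsRealizedBy F ∧ IsResolution 6 c (lift V.ν V.q F) K

end RealSextic

end

noncomputable section

namespace RealSextic

/-! ### Values of forms -/

/-! Fix `ν` and `q`; only the height form `F` varies, in the 7-dimensional real space of binary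
sextics. At each marked point `τ` prescribes the sign of `F`: it is the sign of the height times
that of `q`, where at a zero of `q` the derivative replaces the value. These conditions cut out an
open convex cone, `signed`. They already settle the hyperbolic nodes and the real points of `D⁻`.
What remains is that the two points over each non-real node differ, and that `F` does not vanish on
`D⁻` if `D⁻` is a conjugate pair. Each of these says that a surjective real-linear map to ℂ does not
vanish, so it removes a subspace of real codimension two (`exists_realizers_eq`). All real nodes
being hyperbolic, there are no elliptic nodes and `σ` imposes nothing. Removing finitely many such
subspaces from an open convex set neither disconnects nor empties it
(`isPreconnected_compl_kernels`, `nonempty_compl_kernels`). Hence realizability means that the cone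
is nonempty, and the realizing forms make up a connected set.

The cone is nonempty exactly if there are at most 6 odd arcs (`signed_nonempty_iff`). A form in the
cone changes sign along each odd arc, and a sextic form has at most 6 real zeros. Conversely, one
linear factor for each required sign change, times a power of `X₀² + X₁²`, gives a form of degree 6;
the number of sign changes around the circle is even.

For the resolutions, consider curves `lift + t • H` with small `t > 0`. Eliminating the last
coordinate shows that a double pair of such a curve makes an explicit determinant, `transversal`,
vanish (`transversal_eq_zero`). If it is nonzero at the double point of the lift, all these curves
are embedded for small `t`, uniformly for nearby height forms and velocities
(`eventually_isEmbedded_lift`, by compactness of P¹ × P¹). Up to a nonzero real factor,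
`transversal` is also the derivative of the crossing determinant (`tendsto_crossingDet`), so its
sign records `c`. Over the connected set of realizing forms, the velocities of sign `c` form
nonempty open half-spaces. The rigid isotopy class is locally constant on the resulting pairs, hence
constant (`sameDeformation`). An arbitrary resolving path is `lift + t • H t`, with `H t` its
difference quotient, and so falls under the same statement (`Yields.exists_deforms`). -/

lemma aeval_star (F : Form) (z : Fin 2 → ℂ) :
    MvPolynomial.aeval (star z) F = star (MvPolynomial.aeval z F) :=
  (MvPolynomial.comp_aeval_apply z Complex.conjAe.toAlgHom F).symm

lemma aeval_cx (F : Form) (x : Fin 2 → ℝ) :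
    MvPolynomial.aeval (cx x) F = ((MvPolynomial.eval x F : ℝ) : ℂ) := by
  have h := MvPolynomial.aeval_algebraMap_apply (A := ℝ) ℂ x F
  rw [MvPolynomial.aeval_eq_eval] at h
  exact h

lemma continuous_aeval_form (F : Form) :
    Continuous fun z : Fin 2 → ℂ => MvPolynomial.aeval z F := by
  simp_rw [MvPolynomial.aeval_def, MvPolynomial.eval₂_eq']
  fun_prop

/-- The form `∑ aᵢ X₀ⁱ X₁ᵈ⁻ⁱ`. -/
def bform (d : ℕ) (a : Fin (d + 1) → ℝ) : Form :=
  ∑ i, MvPolynomial.C (a i) * (MvPolynomial.X 0 ^ (i : ℕ) * MvPolynomial.X 1 ^ (d - i))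

lemma isHomogeneous_bform (d : ℕ) (a : Fin (d + 1) → ℝ) : (bform d a).IsHomogeneous d := by
  refine MvPolynomial.IsHomogeneous.sum _ _ _ fun i _ => ?_
  have h := (MvPolynomial.isHomogeneous_C (Fin 2) (a i)).mul
    (((MvPolynomial.isHomogeneous_X ℝ (0 : Fin 2)).pow (i : ℕ)).mul
      ((MvPolynomial.isHomogeneous_X ℝ (1 : Fin 2)).pow (d - i)))
  convert h using 1
  have := i.2
  omega

/-- The coefficients of a form of degree `d`. -/
def coefs (d : ℕ) (F : Form) : Fin (d + 1) → ℝ :=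
  fun i => F.coeff (Finsupp.single 0 (i : ℕ) + Finsupp.single 1 (d - i))

lemma coeff_bform (d : ℕ) (a : Fin (d + 1) → ℝ) (m : Fin 2 →₀ ℕ) :
    (bform d a).coeff m =
      ∑ i : Fin (d + 1), if Finsupp.single 0 (i : ℕ) + Finsupp.single 1 (d - i) = m then a i else 0 := by
  rw [bform, MvPolynomial.coeff_sum]
  refine Finset.sum_congr rfl fun i _ => ?_
  rw [MvPolynomial.coeff_C_mul, MvPolynomial.X_pow_eq_monomial, MvPolynomial.X_pow_eq_monomial,
    MvPolynomial.monomial_mul, MvPolynomial.coeff_monomial]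
  simp

lemma bform_coefs {d : ℕ} {F : Form} (hF : F.IsHomogeneous d) : bform d (coefs d F) = F := by
  ext m
  rw [coeff_bform]
  by_cases hm : m 0 + m 1 = d
  · rw [Finset.sum_eq_single ⟨m 0, by omega⟩]
    · have : Finsupp.single 0 (m 0) + Finsupp.single 1 (d - m 0) = m := by
        ext i; fin_cases i <;> simp; omega
      simp only [coefs]
      rw [this, if_pos rfl]
    · intro j _ hj
      rw [if_neg]
      intro h
      have := DFunLike.congr_fun h 0
      simp at this
      exact hj (Fin.ext this)
    · simp
  · rw [Finset.sum_eq_zero]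
    · symm
      by_contra h
      refine h (hF.coeff_eq_zero fun h' => hm ?_)
      simpa [Finsupp.degree_eq_sum] using h'
    · intro j _
      rw [if_neg]
      rintro rfl
      apply hm
      have := j.2
      simp
      omega

lemma continuous_coeff_bform (d : ℕ) (m : Fin 2 →₀ ℕ) :
    Continuous fun a : Fin (d + 1) → ℝ => (bform d a).coeff m := by
  simp_rw [coeff_bform]
  refine continuous_finsetSum _ fun i _ => ?_
  split_ifs
  · exact continuous_apply i
  · exact continuous_const

lemma bform_add (d : ℕ) (a b : Fin (d + 1) → ℝ) : bform d (a + b) = bform d a + bform d b := by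
  simp [bform, add_mul, Finset.sum_add_distrib]

lemma bform_smul (d : ℕ) (c : ℝ) (a : Fin (d + 1) → ℝ) : bform d (c • a) = c • bform d a := by
  simp [bform, MvPolynomial.smul_eq_C_mul, Finset.mul_sum, mul_assoc]

lemma aeval_bform (d : ℕ) (a : Fin (d + 1) → ℝ) (z : Fin 2 → ℂ) :
    MvPolynomial.aeval z (bform d a) = ∑ i, (a i : ℂ) * (z 0 ^ (i : ℕ) * z 1 ^ (d - i)) := by
  simp [bform]

lemma aeval_smul {d : ℕ} {F : Form} (hF : F.IsHomogeneous d) (c : ℂ) (z : Fin 2 → ℂ) :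
    MvPolynomial.aeval (c • z) F = c ^ d * MvPolynomial.aeval z F := by
  rw [← bform_coefs hF, aeval_bform, aeval_bform, Finset.mul_sum]
  refine Finset.sum_congr rfl fun i _ => ?_
  have : c ^ d = c ^ (i : ℕ) * c ^ (d - i) := by
    rw [← pow_add]; congr 1; have := i.2; omega
  rw [this]
  simp only [Pi.smul_apply, smul_eq_mul, mul_pow]
  ring

lemma eval_smul {d : ℕ} {F : Form} (hF : F.IsHomogeneous d) (c : ℝ) (x : Fin 2 → ℝ) :
    MvPolynomial.eval (c • x) F = c ^ d * MvPolynomial.eval x F := by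
  have h := aeval_smul hF (c : ℂ) (cx x)
  have e : (c : ℂ) • cx x = cx (c • x) := by ext i; simp [cx]
  rw [e, aeval_cx, aeval_cx] at h
  exact_mod_cast h

lemma euler {d : ℕ} {F : Form} (hF : F.IsHomogeneous d) (z : Fin 2 → ℂ) :
    z 0 * MvPolynomial.aeval z (MvPolynomial.pderiv 0 F) +
      z 1 * MvPolynomial.aeval z (MvPolynomial.pderiv 1 F) = d * MvPolynomial.aeval z F := by
  have h := congrArg (MvPolynomial.aeval z) hF.sum_X_mul_pderiv
  simpa [Fin.sum_univ_two] using h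

/-! ### Tuples of forms -/

/-- The tuple of forms of degree `d` with given coefficients. -/
def bforms {ι : Type} (d : ℕ) (g : ι → Fin (d + 1) → ℝ) : ι → Form := fun i => bform d (g i)

lemma bforms_coefs {ι : Type} {d : ℕ} {G : ι → Form} (hG : ∀ i, (G i).IsHomogeneous d) :
    bforms d (fun i => coefs d (G i)) = G := funext fun i => bform_coefs (hG i)

lemma val_smul {ι : Type} {d : ℕ} {G : ι → Form} (hG : ∀ i, (G i).IsHomogeneous d) (c : ℂ)
    (z : Fin 2 → ℂ) : val G (c • z) = c ^ d • val G z :=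
  funext fun i => aeval_smul (hG i) c z

lemma rval_smul {ι : Type} {d : ℕ} {G : ι → Form} (hG : ∀ i, (G i).IsHomogeneous d) (c : ℝ)
    (z : Fin 2 → ℝ) : rval G (c • z) = c ^ d • rval G z :=
  funext fun i => eval_smul (hG i) c z

lemma dval_smul {ι : Type} {d : ℕ} {G : ι → Form} (hG : ∀ i, (G i).IsHomogeneous d) (j : Fin 2)
    (c : ℂ) (z : Fin 2 → ℂ) : dval G j (c • z) = c ^ (d - 1) • dval G j z :=
  funext fun i => aeval_smul (hG i).pderiv c z

lemma val_star {ι : Type} (G : ι → Form) (z : Fin 2 → ℂ) : val G (star z) = star (val G z) :=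
  funext fun i => aeval_star (G i) z

lemma val_cx {ι : Type} (G : ι → Form) (x : Fin 2 → ℝ) : val G (cx x) = cx (rval G x) :=
  funext fun i => aeval_cx (G i) x

lemma euler_val {ι : Type} {d : ℕ} {G : ι → Form} (hG : ∀ i, (G i).IsHomogeneous d)
    (z : Fin 2 → ℂ) : z 0 • dval G 0 z + z 1 • dval G 1 z = (d : ℂ) • val G z :=
  funext fun i => euler (hG i) z

lemma continuous_val {ι : Type} (G : ι → Form) : Continuous (val G) :=
  continuous_pi fun i => continuous_aeval_form (G i)

/-! ### Points of the projective line and the determinant `cross`. -/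

lemma cross_smul {R : Type} [CommRing R] (a b : R) (z w : Fin 2 → R) :
    cross (a • z) (b • w) = a * b * cross z w := by
  simp [cross]; ring

lemma cross_smul_left {R : Type} [CommRing R] (a : R) (z w : Fin 2 → R) :
    cross (a • z) w = a * cross z w := by
  simp [cross]; ring

lemma cross_smul_right {R : Type} [CommRing R] (a : R) (z w : Fin 2 → R) :
    cross z (a • w) = a * cross z w := by
  simp [cross]; ring

lemma cross_swap {R : Type} [CommRing R] (z w : Fin 2 → R) : cross w z = - cross z w := by
  simp [cross]; ring

lemma cross_self {R : Type} [CommRing R] (z : Fin 2 → R) : cross z z = 0 := by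
  simp [cross]; ring

lemma cross_star (z w : Fin 2 → ℂ) : cross (star z) (star w) = star (cross z w) := by
  simp [cross]

lemma cross_cx (z w : Fin 2 → ℝ) : cross (cx z) (cx w) = ((cross z w : ℝ) : ℂ) := by
  simp [cross, cx]

lemma ne_zero_of_cross_left {R : Type} [CommRing R] {z w : Fin 2 → R} (h : cross z w ≠ 0) :
    z ≠ 0 := by
  rintro rfl; simp [cross] at h

lemma ne_zero_of_cross_right {R : Type} [CommRing R] {z w : Fin 2 → R} (h : cross z w ≠ 0) :
    w ≠ 0 := by
  rintro rfl; simp [cross] at h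

lemma exists_smul_of_cross_eq_zero {R : Type} [Field R] {z w : Fin 2 → R} (hz : z ≠ 0) (hw : w ≠ 0)
    (h : cross z w = 0) : ∃ c : R, c ≠ 0 ∧ w = c • z := by
  simp only [cross] at h
  have key : ∃ c : R, w = c • z := by
    by_cases h0 : z 0 = 0
    · have h1 : z 1 ≠ 0 := fun h1 => hz (by ext i; fin_cases i <;> simp [h0, h1])
      refine ⟨w 1 / z 1, ?_⟩
      have h2 : w 0 = 0 := by
        rw [h0] at h
        have : z 1 * w 0 = 0 := by linear_combination -h
        exact (mul_eq_zero.mp this).resolve_left h1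
      ext i; fin_cases i
      · simp [h0, h2]
      · simp; field_simp
    · refine ⟨w 0 / z 0, ?_⟩
      ext i; fin_cases i
      · simp; field_simp
      · simp; field_simp; linear_combination h
  obtain ⟨c, rfl⟩ := key
  exact ⟨c, fun hc => hw (by simp [hc]), rfl⟩

lemma exists_cross_ne_zero {R : Type} [Field R] {z : Fin 2 → R} (hz : z ≠ 0) :
    ∃ e, cross z e ≠ 0 := by
  by_contra! h
  apply hz
  have h0 := h ![0, 1]
  have h1 := h ![1, 0]
  simp [cross] at h0 h1
  ext i; fin_cases i <;> simp [h0, h1]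

/-- Cramer's rule in the basis `z`, `e`. -/
lemma cross_expand {R : Type} [Field R] {z e : Fin 2 → R} (h : cross z e ≠ 0) (w : Fin 2 → R) :
    w = (cross w e / cross z e) • z + (cross z w / cross z e) • e := by
  ext i
  simp only [Pi.add_apply, Pi.smul_apply, smul_eq_mul]
  rw [div_mul_eq_mul_div, div_mul_eq_mul_div, ← add_div, eq_div_iff h]
  fin_cases i <;> simp [cross] <;> ring

/-! ### Linear dependence of two vectors, and double pairs. -/

lemma exists_nontrivial_relation {ι : Type} {u v : ι → ℂ} (h : ¬ LinearIndependent ℂ ![u, v]) :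
    ∃ s t : ℂ, s • u + t • v = 0 ∧ (s ≠ 0 ∨ t ≠ 0) := by
  rw [LinearIndependent.pair_iff] at h
  push Not at h
  obtain ⟨s, t, h1, h2⟩ := h
  exact ⟨s, t, h1, by tauto⟩

lemma exists_eq_smul_of_dependent {ι : Type} {u v : ι → ℂ} (hu : u ≠ 0) (hv : v ≠ 0)
    (h : ¬ LinearIndependent ℂ ![u, v]) : ∃ s : ℂ, s ≠ 0 ∧ u = s • v := by
  obtain ⟨s, t, h1, h2⟩ := exists_nontrivial_relation h
  have hs : s ≠ 0 := by
    rintro rfl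
    simp at h1 h2
    tauto
  have ht : t ≠ 0 := by
    rintro rfl
    simp at h1 h2
    tauto
  refine ⟨-(t / s), by simp [hs, ht], ?_⟩
  have : s • u = -(t • v) := eq_neg_of_add_eq_zero_left h1
  rw [← inv_smul_smul₀ hs u, this, neg_smul, smul_neg, smul_smul]
  congr 2
  field_simp

lemma minor_eq_zero {ι : Type} {u v : ι → ℂ} (h : ¬ LinearIndependent ℂ ![u, v]) (i j : ι) :
    u i * v j = u j * v i := by
  obtain ⟨s, t, h1, h2⟩ := exists_nontrivial_relation h
  have hi := congrFun h1 i
  have hj := congrFun h1 j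
  simp at hi hj
  rcases h2 with h2 | h2
  · apply mul_left_cancel₀ h2; linear_combination v j * hi - v i * hj
  · apply mul_left_cancel₀ h2; linear_combination u i * hj - u j * hi

lemma independent_smul {ι : Type} {u v : ι → ℂ} {a b : ℂ} (ha : a ≠ 0) (hb : b ≠ 0) :
    LinearIndependent ℂ ![a • u, b • v] ↔ LinearIndependent ℂ ![u, v] := by
  rw [LinearIndependent.pair_iff, LinearIndependent.pair_iff]
  constructor
  · intro h s t hst
    have := h (s / a) (t / b) (by
      rw [smul_smul, smul_smul, div_mul_cancel₀ _ ha, div_mul_cancel₀ _ hb, hst])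
    simpa [ha, hb] using this
  · intro h s t hst
    rw [smul_smul, smul_smul] at hst
    have := h _ _ hst
    simpa [ha, hb] using this

lemma independent_swap {ι : Type} {u v : ι → ℂ} :
    LinearIndependent ℂ ![u, v] ↔ LinearIndependent ℂ ![v, u] := LinearIndependent.pair_symm_iff

lemma IsDoublePair.symm {ι : Type} {G : ι → Form} {z w : Fin 2 → ℂ} (h : IsDoublePair G z w) :
    IsDoublePair G w z :=
  ⟨by rw [cross_swap]; exact neg_ne_zero.mpr h.1, fun h' => h.2 (independent_swap.mp h')⟩

lemma isDoublePair_smul {ι : Type} {d : ℕ} {G : ι → Form} (hG : ∀ i, (G i).IsHomogeneous d)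
    {z w : Fin 2 → ℂ} {a b : ℂ} (ha : a ≠ 0) (hb : b ≠ 0) :
    IsDoublePair G (a • z) (b • w) ↔ IsDoublePair G z w := by
  rw [IsDoublePair, IsDoublePair, val_smul hG, val_smul hG, cross_smul,
    independent_smul (pow_ne_zero d ha) (pow_ne_zero d hb)]
  simp [ha, hb]

/-- By Euler's identity a zero value would be a linear relation between the partial derivatives with
coefficients `z 0`, `z 1`. -/
lemma IsImmersed.val_ne_zero {ι : Type} {d : ℕ} {G : ι → Form} (hG : IsImmersed d G)
    {z : Fin 2 → ℂ} (hz : z ≠ 0) : val G z ≠ 0 := by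
  intro h
  have h1 := euler_val hG.homogeneous z
  rw [h, smul_zero] at h1
  have h2 := LinearIndependent.pair_iff.mp (hG.immersion z hz) _ _ h1
  exact hz (by ext i; fin_cases i <;> simp [h2])

/-! ### Divided differences -/

/-- Parameters of divided differences: a tuple of forms and two points. -/
abbrev PairParam (ι : Type) (d : ℕ) :=
  (ι → Fin (d + 1) → ℝ) × (Fin 2 → ℂ) × (Fin 2 → ℂ)

/-- The difference quotient of the forms of degree `d` in direction `e`: if `z = w + β • e`, then
`G z - G w = β • dquot G z w e`. -/
def dquot {ι : Type} (d : ℕ) (p : PairParam ι d) (e : Fin 2 → ℂ) : ι → ℂ := fun k =>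
  e 0 * ∑ i : Fin (d + 1), (p.1 k i : ℂ) *
      ((∑ j ∈ Finset.range i, p.2.1 0 ^ j * p.2.2 0 ^ (i - 1 - j)) * p.2.1 1 ^ (d - i)) +
    e 1 * ∑ i : Fin (d + 1), (p.1 k i : ℂ) *
      (p.2.2 0 ^ (i : ℕ) * ∑ j ∈ Finset.range (d - i), p.2.1 1 ^ j * p.2.2 1 ^ (d - i - 1 - j))

lemma continuous_dquot {ι : Type} (d : ℕ) (e : Fin 2 → ℂ) :
    Continuous fun p : PairParam ι d => dquot d p e := by
  unfold dquot
  fun_prop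

/-- Telescoping: the first coordinate changes while the second has its new value, then the second
changes; each change of a power is a geometric sum. Unlike a quotient by `β`, `dquot` stays
continuous at `β = 0`. -/
lemma val_sub_val {ι : Type} (d : ℕ) (g : ι → Fin (d + 1) → ℝ) (w e : Fin 2 → ℂ) (β : ℂ) :
    val (bforms d g) (w + β • e) = val (bforms d g) w + β • dquot d (g, w + β • e, w) e := by
  ext k
  simp only [val, bforms, aeval_bform, dquot, Pi.add_apply, Pi.smul_apply, smul_eq_mul]
  rw [mul_add, Finset.mul_sum, Finset.mul_sum, Finset.mul_sum, Finset.mul_sum,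
    ← Finset.sum_add_distrib, ← Finset.sum_add_distrib]
  refine Finset.sum_congr rfl fun i _ => ?_
  have h0 := geom_sum₂_mul (w 0 + β * e 0) (w 0) (i : ℕ)
  have h1 := geom_sum₂_mul (w 1 + β * e 1) (w 1) (d - i)
  rw [add_sub_cancel_left] at h0 h1
  linear_combination (-(g k i : ℂ) * (w 1 + β * e 1) ^ (d - (i : ℕ))) * h0 -
    ((g k i : ℂ) * w 0 ^ (i : ℕ)) * h1

lemma dquot_self {ι : Type} (d : ℕ) (g : ι → Fin (d + 1) → ℝ) (z e : Fin 2 → ℂ) :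
    dquot d (g, z, z) e = e 0 • dval (bforms d g) 0 z + e 1 • dval (bforms d g) 1 z := by
  ext k
  simp only [dquot, geom_sum₂_self, Pi.add_apply, Pi.smul_apply, smul_eq_mul, dval, bforms, bform,
    map_sum]
  congr 2
  · refine Finset.sum_congr rfl fun i _ => ?_
    simp [Derivation.leibniz, Derivation.leibniz_pow]
    exact Or.inl (by ring)
  · refine Finset.sum_congr rfl fun i _ => ?_
    simp [Derivation.leibniz, Derivation.leibniz_pow]

lemma continuous_val_bforms {ι : Type} (d : ℕ) :
    Continuous fun p : (ι → Fin (d + 1) → ℝ) × (Fin 2 → ℂ) => val (bforms d p.1) p.2 := by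
  unfold val bforms
  simp_rw [aeval_bform]
  fun_prop

lemma continuous_dval_bforms {ι : Type} (d : ℕ) (j : Fin 2) :
    Continuous fun p : (ι → Fin (d + 1) → ℝ) × (Fin 2 → ℂ) => dval (bforms d p.1) j p.2 := by
  have h : ∀ e : Fin 2 → ℂ, Continuous fun p : (ι → Fin (d + 1) → ℝ) × (Fin 2 → ℂ) =>
      dquot d (p.1, p.2, p.2) e := fun e => (continuous_dquot d e).comp (by fun_prop)
  fin_cases j
  · simpa [dquot_self] using h ![1, 0]
  · simpa [dquot_self] using h ![0, 1]

lemma eventually_independent {X ι κ : Type} [TopologicalSpace X] [Finite κ] [Fintype ι]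
    {f : X → κ → ι → ℂ} {x : X} (hf : ContinuousAt f x) (h : LinearIndependent ℂ (f x)) :
    ∀ᶠ y in 𝓝 x, LinearIndependent ℂ (f y) :=
  hf.eventually (isOpen_setOfPred_linearIndependent.mem_nhds h)

lemma continuousAt_pair {X Y : Type} [TopologicalSpace X] [TopologicalSpace Y] {u v : X → Y} {x : X}
    (hu : ContinuousAt u x) (hv : ContinuousAt v x) : ContinuousAt (fun y => ![u y, v y]) x := by
  refine continuousAt_pi.mpr fun i => ?_
  fin_cases i
  · exact hu
  · exact hv

lemma continuousAt_triple {X Y : Type} [TopologicalSpace X] [TopologicalSpace Y] {u v w : X → Y}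
    {x : X} (hu : ContinuousAt u x) (hv : ContinuousAt v x) (hw : ContinuousAt w x) :
    ContinuousAt (fun y => ![u y, v y, w y]) x := by
  refine continuousAt_pi.mpr fun i => ?_
  fin_cases i
  · exact hu
  · exact hv
  · exact hw

/-! ### Double pairs near a given pair of points -/

lemma eventually_not_isDoublePair_of_independent {ι : Type} [Fintype ι] {d : ℕ}
    {g : ι → Fin (d + 1) → ℝ} {z w : Fin 2 → ℂ}
    (h : LinearIndependent ℂ ![val (bforms d g) z, val (bforms d g) w]) :
    ∀ᶠ p : PairParam ι d in 𝓝 (g, z, w), ¬ IsDoublePair (bforms d p.1) p.2.1 p.2.2 := by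
  have h1 : Continuous fun p : PairParam ι d => val (bforms d p.1) p.2.1 :=
    (continuous_val_bforms d).comp (f := fun p : PairParam ι d => (p.1, p.2.1)) (by fun_prop)
  have h2 : Continuous fun p : PairParam ι d => val (bforms d p.1) p.2.2 :=
    (continuous_val_bforms d).comp (f := fun p : PairParam ι d => (p.1, p.2.2)) (by fun_prop)
  filter_upwards [eventually_independent (x := (g, z, w))
    (continuousAt_pair h1.continuousAt h2.continuousAt) h] with p hp h'
  exact h'.2 hp

/-- Up to the factor `d`, the value is the derivative in the radial direction `z`; together with the
derivative along `e` it arises from the two partial derivatives by a base change of determinant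
`cross z e`. -/
lemma independent_val_directional {ι : Type} {d : ℕ} (hd : d ≠ 0) {G : ι → Form}
    (hG : ∀ i, (G i).IsHomogeneous d) {z e : Fin 2 → ℂ} (he : cross z e ≠ 0)
    (h : LinearIndependent ℂ ![dval G 0 z, dval G 1 z]) :
    LinearIndependent ℂ ![val G z, e 0 • dval G 0 z + e 1 • dval G 1 z] := by
  have hd' : (d : ℂ) ≠ 0 := by exact_mod_cast hd
  rw [LinearIndependent.pair_iff] at h ⊢
  intro s t hst
  have hv : val G z = (d : ℂ)⁻¹ • (z 0 • dval G 0 z + z 1 • dval G 1 z) := by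
    rw [euler_val hG, inv_smul_smul₀ hd']
  rw [hv] at hst
  obtain ⟨h0, h1⟩ := h (s * (d : ℂ)⁻¹ * z 0 + t * e 0) (s * (d : ℂ)⁻¹ * z 1 + t * e 1) (by
    rw [← hst]; module)
  have hs : s * (d : ℂ)⁻¹ * cross z e = 0 := by
    simp only [cross]; linear_combination e 1 * h0 - e 0 * h1
  have ht : t * cross z e = 0 := by
    simp only [cross]; linear_combination z 0 * h1 - z 1 * h0
  simpa [he, hd] using And.intro hs ht

/-- A point near `z`, scaled so that it lies on the line through `z` in direction `e`. -/
lemma eventually_rescale {X : Type} [TopologicalSpace X] {f : X → Fin 2 → ℂ} {x : X}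
    (hf : ContinuousAt f x) {z e : Fin 2 → ℂ} {a : ℂ} (ha : a ≠ 0) (hfx : f x = a • z)
    {u : X → Fin 2 → ℂ} (hu : ContinuousAt u x) (hux : u x = z) (he : cross z e ≠ 0) :
    ∃ α β : X → ℂ, ContinuousAt β x ∧ β x = 0 ∧
      (∀ᶠ y in 𝓝 x, α y ≠ 0 ∧ f y = α y • (u y + β y • e) ∧
        (cross (u y) (f y) = 0 → β y = 0) ∧ (β y = 0 → cross (u y) (f y) = 0)) := by
  have hc : ∀ {v v' : X → Fin 2 → ℂ}, ContinuousAt v x → ContinuousAt v' x →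
      ContinuousAt (fun y => cross (v y) (v' y)) x := by
    intro v v' hv hv'
    have h1 := fun i => continuousAt_pi.mp hv i
    have h2 := fun i => continuousAt_pi.mp hv' i
    exact ((h1 0).mul (h2 1)).sub ((h1 1).mul (h2 0))
  have hue : ContinuousAt (fun y => cross (u y) e) x := hc hu continuousAt_const
  have hfe : ContinuousAt (fun y => cross (f y) e) x := hc hf continuousAt_const
  have hfe0 : cross (f x) e ≠ 0 := by
    rw [hfx, cross_smul_left]; exact mul_ne_zero ha he
  refine ⟨fun y => cross (f y) e / cross (u y) e, fun y => cross (u y) (f y) / cross (f y) e,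
    ?_, ?_, ?_⟩
  · exact (hc hu hf).div hfe hfe0
  · simp [hux, hfx, cross_smul_right, cross_self]
  · filter_upwards [hue.eventually_ne (by rw [hux]; exact he), hfe.eventually_ne hfe0] with y h1 h2
    refine ⟨div_ne_zero h2 h1, ?_, fun h => by simp [h], fun h => by simpa [h2] using h⟩
    have := cross_expand h1 (f y)
    rw [smul_add, smul_smul]
    convert this using 3
    field_simp

/-- Near the diagonal a pair can be rescaled to `z`, `z + β • e` with `β ≠ 0`. If it were a double
pair, the value at `z` and the difference quotient along `e` would be dependent; their limits are
independent for an immersion. The coefficients vary too, so that nearby curves are covered at once.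
-/
lemma eventually_not_isDoublePair_of_immersed {ι : Type} [Fintype ι] {d : ℕ} (hd : d ≠ 0)
    {g : ι → Fin (d + 1) → ℝ} {z w : Fin 2 → ℂ} (hz : z ≠ 0) (hw : w ≠ 0) (hzw : cross z w = 0)
    (h : LinearIndependent ℂ ![dval (bforms d g) 0 z, dval (bforms d g) 1 z]) :
    ∀ᶠ p : PairParam ι d in 𝓝 (g, z, w), ¬ IsDoublePair (bforms d p.1) p.2.1 p.2.2 := by
  obtain ⟨e, he⟩ := exists_cross_ne_zero hz
  obtain ⟨a, ha, rfl⟩ := exists_smul_of_cross_eq_zero hz hw hzw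
  have hhom : ∀ (g : ι → Fin (d + 1) → ℝ) i, (bforms d g i).IsHomogeneous d :=
    fun g i => isHomogeneous_bform d (g i)
  obtain ⟨α, β, hβ, hβ0, hev⟩ := eventually_rescale (X := PairParam ι d) (x := (g, z, a • z))
    (f := fun p => p.2.2) (u := fun p => p.2.1) (by fun_prop) ha rfl (by fun_prop) rfl he
  have h1 : Continuous fun p : PairParam ι d => val (bforms d p.1) p.2.1 :=
    (continuous_val_bforms d).comp (f := fun p : PairParam ι d => (p.1, p.2.1)) (by fun_prop)
  have h2 : ContinuousAt (fun p : PairParam ι d =>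
      dquot d (p.1, p.2.1 + β p • e, p.2.1) e) (g, z, a • z) := by
    refine (continuous_dquot d e).continuousAt.comp
      (f := fun p : PairParam ι d => (p.1, p.2.1 + β p • e, p.2.1)) ?_
    exact ContinuousAt.prodMk (by fun_prop) (ContinuousAt.prodMk (by fun_prop) (by fun_prop))
  have h3 : LinearIndependent ℂ ![val (bforms d g) z, dquot d (g, z + β (g, z, a • z) • e, z) e] := by
    rw [hβ0, zero_smul, add_zero, dquot_self]
    exact independent_val_directional hd (hhom g) he h
  filter_upwards [hev, eventually_independent (x := (g, z, a • z))
    (continuousAt_pair h1.continuousAt h2) h3] with p ⟨hα, hp, hp1, hp2⟩ hi hdp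
  have hβp : β p ≠ 0 := fun h => hdp.1 (hp2 h)
  rw [hp, ← one_smul ℂ p.2.1, isDoublePair_smul (hhom p.1) one_ne_zero hα] at hdp
  refine hdp.2 ?_
  rw [one_smul, val_sub_val]
  rw [LinearIndependent.pair_iff] at hi ⊢
  intro s t hst
  obtain ⟨h5, h6⟩ := hi (s + t) (t * β p) (by rw [← hst]; module)
  have ht : t = 0 := by simpa [hβp] using h6
  subst ht
  simpa using h5

/-- Nodes are isolated. A nearby double pair, rescaled to `z + β • e`, `w + δ • f`, gives a relation
between the value at `w` and the difference quotients of the two branches. Transversality makes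
these three vectors independent in the limit, so `β` and `δ` vanish. -/
lemma eventually_isDoublePair_unique {d : ℕ} (hd : d ≠ 0) {g : Fin 3 → Fin (d + 1) → ℝ}
    {z w : Fin 2 → ℂ} (hi : ∀ z : Fin 2 → ℂ, z ≠ 0 → val (bforms d g) z ≠ 0)
    (hzw : IsDoublePair (bforms d g) z w)
    (h : Submodule.span ℂ {dval (bforms d g) 0 z, dval (bforms d g) 1 z, dval (bforms d g) 0 w,
      dval (bforms d g) 1 w} = ⊤) :
    ∀ᶠ p : (Fin 2 → ℂ) × (Fin 2 → ℂ) in 𝓝 (z, w), IsDoublePair (bforms d g) p.1 p.2 →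
      cross z p.1 = 0 ∧ cross w p.2 = 0 := by
  have hd' : (d : ℂ) ≠ 0 := by exact_mod_cast hd
  have hz : z ≠ 0 := ne_zero_of_cross_left hzw.1
  have hw : w ≠ 0 := ne_zero_of_cross_right hzw.1
  have hhom : ∀ i, (bforms d g i).IsHomogeneous d := fun i => isHomogeneous_bform d (g i)
  obtain ⟨e, he⟩ := exists_cross_ne_zero hz
  obtain ⟨f, hf⟩ := exists_cross_ne_zero hw
  obtain ⟨s₀, hs₀, hs⟩ := exists_eq_smul_of_dependent (hi z hz) (hi w hw) hzw.2
  set G := bforms d g with hG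
  obtain ⟨α, β, hβ, hβ0, hev⟩ := eventually_rescale (X := (Fin 2 → ℂ) × (Fin 2 → ℂ)) (x := (z, w))
    (f := fun p => p.1) (z := z) (u := fun _ => z) (by fun_prop) one_ne_zero (one_smul _ _).symm
    (by fun_prop) rfl he
  obtain ⟨γ, δ, hδ, hδ0, hev'⟩ := eventually_rescale (X := (Fin 2 → ℂ) × (Fin 2 → ℂ)) (x := (z, w))
    (f := fun p => p.2) (z := w) (u := fun _ => w) (by fun_prop) one_ne_zero (one_smul _ _).symm
    (by fun_prop) rfl hf
  have h1 : ContinuousAt (fun p : (Fin 2 → ℂ) × (Fin 2 → ℂ) =>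
      dquot d (g, z + β p • e, z) e) (z, w) :=
    (continuous_dquot d e).continuousAt.comp
      (f := fun p : (Fin 2 → ℂ) × (Fin 2 → ℂ) => (g, z + β p • e, z))
      (ContinuousAt.prodMk (by fun_prop) (ContinuousAt.prodMk (by fun_prop) (by fun_prop)))
  have h2 : ContinuousAt (fun p : (Fin 2 → ℂ) × (Fin 2 → ℂ) =>
      dquot d (g, w + δ p • f, w) f) (z, w) :=
    (continuous_dquot d f).continuousAt.comp
      (f := fun p : (Fin 2 → ℂ) × (Fin 2 → ℂ) => (g, w + δ p • f, w))
      (ContinuousAt.prodMk (by fun_prop) (ContinuousAt.prodMk (by fun_prop) (by fun_prop)))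
  have h3 : LinearIndependent ℂ ![val G w, dquot d (g, z + β (z, w) • e, z) e,
      dquot d (g, w + δ (z, w) • f, w) f] := by
    rw [hβ0, hδ0, zero_smul, zero_smul, add_zero, add_zero, dquot_self, dquot_self, ← hG]
    refine linearIndependent_of_top_le_span_of_card_eq_finrank ?_ (by simp)
    rw [← h, Submodule.span_le]
    set S := Submodule.span ℂ (Set.range ![val G w, e 0 • dval G 0 z + e 1 • dval G 1 z,
      f 0 • dval G 0 w + f 1 • dval G 1 w])
    have m0 : val G w ∈ S := Submodule.subset_span ⟨0, rfl⟩
    have m1 : e 0 • dval G 0 z + e 1 • dval G 1 z ∈ S := Submodule.subset_span ⟨1, rfl⟩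
    have m2 : f 0 • dval G 0 w + f 1 • dval G 1 w ∈ S := Submodule.subset_span ⟨2, rfl⟩
    -- The value (through Euler) and the derivative along `e` determine both partial derivatives by
    -- Cramer's rule, so the three vectors span everything the four partial derivatives do.
    have key : ∀ {z e : Fin 2 → ℂ}, cross z e ≠ 0 → val G z ∈ S →
        e 0 • dval G 0 z + e 1 • dval G 1 z ∈ S → dval G 0 z ∈ S ∧ dval G 1 z ∈ S := by
      intro z e hc hv he
      have hv' : z 0 • dval G 0 z + z 1 • dval G 1 z ∈ S := by
        rw [euler_val hhom]; exact S.smul_mem _ hv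
      constructor
      · have : dval G 0 z = (cross z e)⁻¹ • (e 1 • (z 0 • dval G 0 z + z 1 • dval G 1 z) -
            z 1 • (e 0 • dval G 0 z + e 1 • dval G 1 z)) := by
          rw [eq_inv_smul_iff₀ hc, cross]; module
        rw [this]
        exact S.smul_mem _ (S.sub_mem (S.smul_mem _ hv') (S.smul_mem _ he))
      · have : dval G 1 z = (cross z e)⁻¹ • (z 0 • (e 0 • dval G 0 z + e 1 • dval G 1 z) -
            e 0 • (z 0 • dval G 0 z + z 1 • dval G 1 z)) := by
          rw [eq_inv_smul_iff₀ hc, cross]; module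
        rw [this]
        exact S.smul_mem _ (S.sub_mem (S.smul_mem _ he) (S.smul_mem _ hv'))
    obtain ⟨k1, k2⟩ := key he (by rw [hs]; exact S.smul_mem _ m0) m1
    obtain ⟨k3, k4⟩ := key hf m0 m2
    rintro v (rfl | rfl | rfl | rfl)
    exacts [k1, k2, k3, k4]
  filter_upwards [hev, hev', eventually_independent (x := (z, w))
    (continuousAt_triple continuousAt_const h1 h2) h3] with p ⟨hα, hp, _, hp2⟩ ⟨hγ, hq, _, hq2⟩ hind hdp
  have hp0 : p.1 ≠ 0 := ne_zero_of_cross_left hdp.1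
  have hq0 : p.2 ≠ 0 := ne_zero_of_cross_right hdp.1
  rw [hp, hq, isDoublePair_smul hhom hα hγ] at hdp
  obtain ⟨l, hl, hl'⟩ := exists_eq_smul_of_dependent
    (hi _ (ne_zero_of_cross_left hdp.1)) (hi _ (ne_zero_of_cross_right hdp.1)) hdp.2
  rw [hG, val_sub_val, val_sub_val, ← hG, hs] at hl'
  rw [Fintype.linearIndependent_iff] at hind
  -- Subtracting `val G z = s₀ • val G w` from the proportionality with factor `l` leaves exactly
  -- these coefficients.
  have := hind ![s₀ - l, β p, -(l * δ p)] (by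
    simp only [Fin.sum_univ_three, Matrix.cons_val]
    have e1 := sub_eq_zero.mpr hl'
    rw [← e1]; module)
  have hb := this 1
  have hd := this 2
  simp [hl] at hb hd
  exact ⟨hp2 hb, hq2 hd⟩

/-! ### Compactness of `P¹ × P¹` -/

lemma exists_smul_mem_sphere {z : Fin 2 → ℂ} (hz : z ≠ 0) :
    ∃ a : ℂ, a ≠ 0 ∧ a • z ∈ Metric.sphere (0 : Fin 2 → ℂ) 1 := by
  have h : ‖z‖ ≠ 0 := norm_ne_zero_iff.mpr hz
  refine ⟨((‖z‖⁻¹ : ℝ) : ℂ), by exact_mod_cast inv_ne_zero h, ?_⟩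
  rw [mem_sphere_zero_iff_norm, norm_smul, Complex.norm_real, norm_inv, norm_norm, inv_mul_cancel₀ h]

lemma ne_zero_of_mem_sphere {z : Fin 2 → ℂ} (hz : z ∈ Metric.sphere (0 : Fin 2 → ℂ) 1) : z ≠ 0 := by
  rintro rfl; simp at hz

/-- The nodes of a nodal rational plane curve are finite in number. -/
lemma IsNodalCurve.exists_finset {d : ℕ} (hd : d ≠ 0) {ν : Fin 3 → Form} (h : IsNodalCurve d ν) :
    ∃ P : Finset ((Fin 2 → ℂ) × (Fin 2 → ℂ)), (∀ p ∈ P, IsDoublePair ν p.1 p.2) ∧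
      ∀ z w, IsDoublePair ν z w → ∃ p ∈ P, cross p.1 z = 0 ∧ cross p.2 w = 0 := by
  classical
  have hν := bforms_coefs h.homogeneous
  set S := Metric.sphere (0 : Fin 2 → ℂ) 1
  have hS : IsCompact (S ×ˢ S) := (isCompact_sphere _ _).prod (isCompact_sphere _ _)
  have key : ∃ P : Finset ((Fin 2 → ℂ) × (Fin 2 → ℂ)), (∀ p ∈ P, IsDoublePair ν p.1 p.2) ∧
      ∀ q ∈ S ×ˢ S, IsDoublePair ν q.1 q.2 → ∃ p ∈ P, cross p.1 q.1 = 0 ∧ cross p.2 q.2 = 0 := by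
    refine hS.induction_on (p := fun T => ∃ P : Finset ((Fin 2 → ℂ) × (Fin 2 → ℂ)),
      (∀ p ∈ P, IsDoublePair ν p.1 p.2) ∧
      ∀ q ∈ T, IsDoublePair ν q.1 q.2 → ∃ p ∈ P, cross p.1 q.1 = 0 ∧ cross p.2 q.2 = 0)
      ⟨∅, by simp, by simp⟩ ?_ ?_ ?_
    · rintro s t hst ⟨P, hP, hP'⟩
      exact ⟨P, hP, fun q hq => hP' q (hst hq)⟩
    · rintro s t ⟨P, hP, hP'⟩ ⟨Q, hQ, hQ'⟩
      refine ⟨P ∪ Q, fun p hp => (Finset.mem_union.mp hp).elim (hP p) (hQ p), ?_⟩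
      rintro q (hq | hq) hq'
      · obtain ⟨p, hp, h⟩ := hP' q hq hq'
        exact ⟨p, Finset.mem_union_left _ hp, h⟩
      · obtain ⟨p, hp, h⟩ := hQ' q hq hq'
        exact ⟨p, Finset.mem_union_right _ hp, h⟩
    · rintro ⟨z, w⟩ ⟨hz, hw⟩
      -- Locally there are three cases: near the diagonal, and near a pair with independent values,
      -- there is no double pair; near a node the given pair is the only one up to scaling.
      have hz0 := ne_zero_of_mem_sphere hz
      have hw0 := ne_zero_of_mem_sphere hw
      have fixed : (∀ᶠ p : PairParam (Fin 3) d in 𝓝 ((fun i => coefs d (ν i)), z, w),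
          ¬ IsDoublePair (bforms d p.1) p.2.1 p.2.2) → ∃ t ∈ 𝓝[S ×ˢ S] (z, w),
          ∃ P : Finset ((Fin 2 → ℂ) × (Fin 2 → ℂ)), (∀ p ∈ P, IsDoublePair ν p.1 p.2) ∧
          ∀ q ∈ t, IsDoublePair ν q.1 q.2 → ∃ p ∈ P, cross p.1 q.1 = 0 ∧ cross p.2 q.2 = 0 := by
        intro hev
        have : ∀ᶠ q : (Fin 2 → ℂ) × (Fin 2 → ℂ) in 𝓝 (z, w), ¬ IsDoublePair ν q.1 q.2 := by
          have hc : ContinuousAt (fun q : (Fin 2 → ℂ) × (Fin 2 → ℂ) =>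
            (((fun i => coefs d (ν i)), q) : PairParam (Fin 3) d)) (z, w) := by fun_prop
          have := hc.eventually hev
          simpa only [hν] using this
        exact ⟨_, mem_nhdsWithin_of_mem_nhds this, ∅, by simp, fun q hq hq' => absurd hq' hq⟩
      by_cases hc : cross z w = 0
      · exact fixed (eventually_not_isDoublePair_of_immersed hd hz0 hw0 hc
          (by rw [hν]; exact h.immersion z hz0))
      · by_cases hi : LinearIndependent ℂ ![val ν z, val ν w]
        · exact fixed (eventually_not_isDoublePair_of_independent (by rw [hν]; exact hi))
        · have hdp : IsDoublePair ν z w := ⟨hc, hi⟩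
          have := eventually_isDoublePair_unique hd (g := fun i => coefs d (ν i)) (z := z) (w := w)
            (by rw [hν]; exact fun z hz => h.toIsImmersed.val_ne_zero hz) (by rw [hν]; exact hdp)
            (by rw [hν]; exact h.transverse z w hdp)
          rw [hν] at this
          exact ⟨_, mem_nhdsWithin_of_mem_nhds this, {(z, w)}, by simpa using hdp, fun q hq hq' =>
            ⟨_, Finset.mem_singleton_self _, hq hq'⟩⟩
  obtain ⟨P, hP, hP'⟩ := key
  refine ⟨P, hP, fun z w hzw => ?_⟩
  obtain ⟨a, ha, haz⟩ := exists_smul_mem_sphere (ne_zero_of_cross_left hzw.1)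
  obtain ⟨b, hb, hbw⟩ := exists_smul_mem_sphere (ne_zero_of_cross_right hzw.1)
  obtain ⟨p, hp, h1, h2⟩ := hP' (a • z, b • w) ⟨haz, hbw⟩
    ((isDoublePair_smul h.homogeneous ha hb).mpr hzw)
  rw [cross_smul_right] at h1 h2
  exact ⟨p, hp, by simpa [ha] using h1, by simpa [hb] using h2⟩

/-- A limit of curves is embedded near the limit if its double pairs disappear locally. -/
lemma eventually_isEmbedded {X : Type} {l : Filter X} {d : ℕ} {Γ : X → Fin 4 → Fin (d + 1) → ℝ}
    {g : Fin 4 → Fin (d + 1) → ℝ} (hd : d ≠ 0) (hΓ : Tendsto Γ l (𝓝 g))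
    (hg : IsImmersed d (bforms d g))
    (h : ∀ z w, IsDoublePair (bforms d g) z w → ∀ᶠ p in l ×ˢ 𝓝 (z, w),
      ¬ IsDoublePair (bforms d (Γ p.1)) p.2.1 p.2.2) :
    ∀ᶠ x in l, IsEmbedded d (bforms d (Γ x)) := by
  have hhom : ∀ (g : Fin 4 → Fin (d + 1) → ℝ) i, (bforms d g i).IsHomogeneous d :=
    fun g i => isHomogeneous_bform d (g i)
  set S := Metric.sphere (0 : Fin 2 → ℂ) 1
  have hS : IsCompact S := isCompact_sphere _ _
  -- Compactness of the sphere makes the local statements uniform in the points; homogeneity extends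
  -- them to all nonzero vectors at the end.
  have him : ∀ᶠ x in l, ∀ z ∈ S,
      LinearIndependent ℂ ![dval (bforms d (Γ x)) 0 z, dval (bforms d (Γ x)) 1 z] := by
    refine hS.induction_on (p := fun T => ∀ᶠ x in l, ∀ z ∈ T,
      LinearIndependent ℂ ![dval (bforms d (Γ x)) 0 z, dval (bforms d (Γ x)) 1 z]) (by simp)
      (fun s t hst ht => ht.mono fun x hx z hz => hx z (hst hz))
      (fun s t hs ht => (hs.and ht).mono fun x hx z hz => hz.elim (hx.1 z) (hx.2 z)) ?_
    intro z hz
    have h1 := eventually_independent (x := (g, z)) (continuousAt_pair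
      (continuous_dval_bforms (ι := Fin 4) d 0).continuousAt (continuous_dval_bforms d 1).continuousAt)
      (hg.immersion z (ne_zero_of_mem_sphere hz))
    rw [nhds_prod_eq] at h1
    obtain ⟨p, hp, q, hq, hpq⟩ := eventually_prod_iff.mp h1
    exact ⟨_, mem_nhdsWithin_of_mem_nhds hq, (hΓ.eventually hp).mono fun x hx z hz => hpq hx hz⟩
  have hdp : ∀ᶠ x in l, ∀ p ∈ S ×ˢ S, ¬ IsDoublePair (bforms d (Γ x)) p.1 p.2 := by
    refine (hS.prod hS).induction_on (p := fun T => ∀ᶠ x in l, ∀ p ∈ T,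
      ¬ IsDoublePair (bforms d (Γ x)) p.1 p.2) (by simp)
      (fun s t hst ht => ht.mono fun x hx z hz => hx z (hst hz))
      (fun s t hs ht => (hs.and ht).mono fun x hx z hz => hz.elim (hx.1 z) (hx.2 z)) ?_
    rintro ⟨z, w⟩ ⟨hz, hw⟩
    have hz0 := ne_zero_of_mem_sphere hz
    have hw0 := ne_zero_of_mem_sphere hw
    have fixed : (∀ᶠ p : PairParam (Fin 4) d in 𝓝 (g, z, w),
        ¬ IsDoublePair (bforms d p.1) p.2.1 p.2.2) → ∃ t ∈ 𝓝[S ×ˢ S] (z, w),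
        ∀ᶠ x in l, ∀ p ∈ t, ¬ IsDoublePair (bforms d (Γ x)) p.1 p.2 := by
      intro hev
      rw [nhds_prod_eq] at hev
      obtain ⟨p, hp, q, hq, hpq⟩ := eventually_prod_iff.mp hev
      exact ⟨_, mem_nhdsWithin_of_mem_nhds hq, (hΓ.eventually hp).mono fun x hx z hz => hpq hx hz⟩
    by_cases hc : cross z w = 0
    · exact fixed (eventually_not_isDoublePair_of_immersed hd hz0 hw0 hc (hg.immersion z hz0))
    · by_cases hi : LinearIndependent ℂ ![val (bforms d g) z, val (bforms d g) w]
      · exact fixed (eventually_not_isDoublePair_of_independent hi)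
      -- Only at the double pairs of the limit curve is the hypothesis `h` needed.
      · obtain ⟨p, hp, q, hq, hpq⟩ := eventually_prod_iff.mp (h z w ⟨hc, hi⟩)
        exact ⟨_, mem_nhdsWithin_of_mem_nhds hq, hp.mono fun x hx z hz => hpq hx hz⟩
  filter_upwards [him, hdp] with x hx1 hx2
  refine ⟨⟨hhom _, fun z hz => ?_⟩, fun z w hzw => ?_⟩
  · obtain ⟨a, ha, haz⟩ := exists_smul_mem_sphere hz
    have := hx1 _ haz
    rw [dval_smul (hhom _), dval_smul (hhom _), independent_smul (pow_ne_zero _ ha)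
      (pow_ne_zero _ ha)] at this
    exact this
  · obtain ⟨a, ha, haz⟩ := exists_smul_mem_sphere (ne_zero_of_cross_left hzw.1)
    obtain ⟨b, hb, hbw⟩ := exists_smul_mem_sphere (ne_zero_of_cross_right hzw.1)
    exact hx2 (a • z, b • w) ⟨haz, hbw⟩ ((isDoublePair_smul (hhom _) ha hb).mpr hzw)

/-! ### Zeros of a reduced quadratic form -/

/-- The form `q` equals `k · cross z x · cross z y`, where the points `x`, `y` are distinct and
real or complex conjugate. -/
structure QuadraticZeros (q : Form) (x y : Fin 2 → ℂ) (k : ℂ) : Prop where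
  ne_zero : k ≠ 0
  cross_ne_zero : cross x y ≠ 0
  real : (star x = x ∧ star y = y) ∨ y = star x
  factor : ∀ z, MvPolynomial.aeval z q = k * cross z x * cross z y
  pderiv_zero : ∀ z : Fin 2 → ℂ, MvPolynomial.aeval z (MvPolynomial.pderiv 0 q) =
    k * (x 1 * cross z y + cross z x * y 1)
  pderiv_one : ∀ z : Fin 2 → ℂ, MvPolynomial.aeval z (MvPolynomial.pderiv 1 q) =
    - k * (x 0 * cross z y + cross z x * y 0)

/-- The quadratic formula. Reducedness makes the discriminant nonzero, and its sign decides between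
real and conjugate zeros; if the coefficient of `X₀²` vanishes, one zero is `[1 : 0]`. -/
lemma exists_quadraticZeros {q : Form} (hq : q.IsHomogeneous 2)
    (hred : ∀ z : Fin 2 → ℂ, z ≠ 0 → MvPolynomial.aeval z q = 0 →
      ∃ j, MvPolynomial.aeval z (MvPolynomial.pderiv j q) ≠ 0) :
    ∃ x y k, QuadraticZeros q x y k := by
  obtain ⟨a, rfl⟩ : ∃ a, q = bform 2 a := ⟨_, (bform_coefs hq).symm⟩
  have hv : ∀ z : Fin 2 → ℂ, MvPolynomial.aeval z (bform 2 a) =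
      a 0 * z 1 ^ 2 + a 1 * (z 0 * z 1) + a 2 * z 0 ^ 2 := by
    intro z; simp [aeval_bform, Fin.sum_univ_three]
  have h0 : ∀ z : Fin 2 → ℂ, MvPolynomial.aeval z (MvPolynomial.pderiv 0 (bform 2 a)) =
      a 1 * z 1 + 2 * a 2 * z 0 := by
    intro z
    simp [bform, Fin.sum_univ_three, Derivation.leibniz, Derivation.leibniz_pow]
    ring
  have h1 : ∀ z : Fin 2 → ℂ, MvPolynomial.aeval z (MvPolynomial.pderiv 1 (bform 2 a)) =
      2 * a 0 * z 1 + a 1 * z 0 := by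
    intro z
    simp [bform, Fin.sum_univ_three, Derivation.leibniz, Derivation.leibniz_pow]
    ring
  by_cases h2 : a 2 = 0
  · have ha1 : a 1 ≠ 0 := by
      intro ha1
      obtain ⟨j, hj⟩ := hred ![1, 0] (fun h => by simpa using congrFun h 0) (by simp [hv, h2])
      fin_cases j
      · simp [h0, h2] at hj
      · simp [h1, ha1] at hj
    refine ⟨![1, 0], ![-(a 0 : ℂ), a 1], -1, by simp, by simpa [cross] using ha1,
      Or.inl ⟨by ext i; fin_cases i <;> simp, by ext i; fin_cases i <;> simp⟩, fun z => ?_,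
      fun z => ?_, fun z => ?_⟩
    · rw [hv]; simp [cross, h2]; ring
    · rw [h0]; simp [cross, h2]; ring
    · rw [h1]; simp [cross]; ring
  · have h2' : (a 2 : ℂ) ≠ 0 := by exact_mod_cast h2
    have main : ∀ δ : ℂ, δ ^ 2 = (a 1 : ℂ) ^ 2 - 4 * a 0 * a 2 → δ ≠ 0 → (star δ = δ ∨ star δ = -δ) →
        ∃ x y k, QuadraticZeros (bform 2 a) x y k := by
      intro δ hδ hδ0 hr
      refine ⟨![-(a 1 : ℂ) + δ, 2 * a 2], ![-(a 1 : ℂ) - δ, 2 * a 2], (4 * (a 2 : ℂ))⁻¹,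
        by simp [h2], ?_, ?_, fun z => ?_, fun z => ?_, fun z => ?_⟩
      · have : cross ![-(a 1 : ℂ) + δ, 2 * a 2] ![-(a 1 : ℂ) - δ, 2 * a 2] = 4 * a 2 * δ := by
          simp [cross]; ring
        rw [this]
        simp [h2, hδ0]
      · rcases hr with hr | hr
        · refine Or.inl ⟨?_, ?_⟩ <;> ext i <;> fin_cases i <;> simp at hr ⊢ <;> rw [hr]
        · refine Or.inr ?_
          ext i; fin_cases i <;> simp at hr ⊢
          rw [hr]; ring
      · rw [hv]; simp [cross]; field_simp; linear_combination (z 1 ^ 2) * hδ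
      · rw [h0]; simp [cross]; field_simp; ring
      · rw [h1]; simp [cross]; field_simp; linear_combination (2 * z 1) * hδ
    -- With zero discriminant, `[-a₁ : 2a₂]` would be a zero at which both partial derivatives
    -- vanish.
    have hdisc : (a 1) ^ 2 - 4 * a 0 * a 2 ≠ 0 := by
      intro hd
      have hd' : (a 1 : ℂ) ^ 2 - 4 * a 0 * a 2 = 0 := by exact_mod_cast hd
      obtain ⟨j, hj⟩ := hred ![-(a 1 : ℂ), 2 * a 2] (fun h => by simpa [h2] using congrFun h 1)
        (by rw [hv]; simp; linear_combination -(a 2 : ℂ) * hd')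
      fin_cases j
      · apply hj; simp [h0]; ring
      · apply hj; simp [h1]; linear_combination -hd'
    rcases lt_or_gt_of_ne hdisc with hd | hd
    · refine main (Complex.I * (Real.sqrt (-((a 1) ^ 2 - 4 * a 0 * a 2)) : ℝ)) ?_ ?_ (Or.inr ?_)
      · rw [mul_pow, Complex.I_sq, ← Complex.ofReal_pow, Real.sq_sqrt (by linarith)]
        push_cast; ring
      · refine mul_ne_zero Complex.I_ne_zero ?_
        exact_mod_cast (Real.sqrt_pos.mpr (by linarith)).ne'
      · simp
    · refine main (Real.sqrt ((a 1) ^ 2 - 4 * a 0 * a 2) : ℝ) ?_ ?_ (Or.inl ?_)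
      · rw [← Complex.ofReal_pow, Real.sq_sqrt hd.le]
        push_cast; ring
      · exact_mod_cast (Real.sqrt_pos.mpr hd).ne'
      · simp

namespace QuadraticZeros

variable {q : Form} {x y : Fin 2 → ℂ} {k : ℂ}

lemma left (h : QuadraticZeros q x y k) : MvPolynomial.aeval x q = 0 := by
  simp [h.factor, cross_self]

lemma right (h : QuadraticZeros q x y k) : MvPolynomial.aeval y q = 0 := by
  simp [h.factor, cross_self]

lemma aeval_eq_zero_iff (h : QuadraticZeros q x y k) (z : Fin 2 → ℂ) :
    MvPolynomial.aeval z q = 0 ↔ cross z x = 0 ∨ cross z y = 0 := by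
  simp [h.factor, h.ne_zero]

lemma directional_left (h : QuadraticZeros q x y k) (e : Fin 2 → ℂ) :
    e 0 * MvPolynomial.aeval x (MvPolynomial.pderiv 0 q) +
      e 1 * MvPolynomial.aeval x (MvPolynomial.pderiv 1 q) = - (k * cross x e * cross x y) := by
  rw [h.pderiv_zero, h.pderiv_one, cross_self]
  simp only [cross]; ring

lemma directional_right (h : QuadraticZeros q x y k) (e : Fin 2 → ℂ) :
    e 0 * MvPolynomial.aeval y (MvPolynomial.pderiv 0 q) +
      e 1 * MvPolynomial.aeval y (MvPolynomial.pderiv 1 q) = k * cross y e * cross x y := by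
  rw [h.pderiv_zero, h.pderiv_one, cross_self]
  simp only [cross]; ring

end QuadraticZeros

/-! ### The lift of a plane curve -/

lemma val_lift (ν : Fin 3 → Form) (q F : Form) (z : Fin 2 → ℂ) :
    val (lift ν q F) z = ![MvPolynomial.aeval z q * val ν z 0, MvPolynomial.aeval z q * val ν z 1,
      MvPolynomial.aeval z q * val ν z 2, MvPolynomial.aeval z F] := by
  ext i; fin_cases i <;> simp [val, lift]

lemma dval_lift (ν : Fin 3 → Form) (q F : Form) (j : Fin 2) (z : Fin 2 → ℂ) :
    dval (lift ν q F) j z =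
      ![MvPolynomial.aeval z (MvPolynomial.pderiv j q) * val ν z 0 +
          MvPolynomial.aeval z q * dval ν j z 0,
        MvPolynomial.aeval z (MvPolynomial.pderiv j q) * val ν z 1 +
          MvPolynomial.aeval z q * dval ν j z 1,
        MvPolynomial.aeval z (MvPolynomial.pderiv j q) * val ν z 2 +
          MvPolynomial.aeval z q * dval ν j z 2,
        MvPolynomial.aeval z (MvPolynomial.pderiv j F)] := by
  ext i; fin_cases i <;> simp [val, dval, lift, Derivation.leibniz] <;> ring

lemma isHomogeneous_lift {ν : Fin 3 → Form} {q F : Form} (hν : ∀ i, (ν i).IsHomogeneous 4)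
    (hq : q.IsHomogeneous 2) (hF : F.IsHomogeneous 6) (i : Fin 4) :
    (lift ν q F i).IsHomogeneous 6 := by
  fin_cases i
  exacts [hq.mul (hν 0), hq.mul (hν 1), hq.mul (hν 2), hF]

lemma vec3_ext {u v : Fin 3 → ℂ} (h0 : u 0 = v 0) (h1 : u 1 = v 1) (h2 : u 2 = v 2) : u = v := by
  ext i; fin_cases i <;> assumption

/-- A relation with coefficients `(s, t)` between the partial derivatives is tested on the first
three coordinates. Away from `D⁻` the immersion `ν` forces it to be trivial. At a point of `D⁻` it
makes the derivative of `q` along `(s, t)` vanish; as the zero is simple, `(s, t)` is then radial,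
and Euler's identity for the last coordinate contradicts `F ≠ 0`. -/
lemma isImmersed_lift {ν : Fin 3 → Form} {q F : Form} (hν : IsImmersed 4 ν)
    (hq : q.IsHomogeneous 2)
    (hred : ∀ z : Fin 2 → ℂ, z ≠ 0 → MvPolynomial.aeval z q = 0 →
      ∃ j, MvPolynomial.aeval z (MvPolynomial.pderiv j q) ≠ 0)
    (hF : F.IsHomogeneous 6)
    (hdisj : ∀ z : Fin 2 → ℂ, z ≠ 0 → MvPolynomial.aeval z q = 0 → MvPolynomial.aeval z F ≠ 0) :
    IsImmersed 6 (lift ν q F) := by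
  refine ⟨isHomogeneous_lift hν.homogeneous hq hF, fun z hz => ?_⟩
  rw [LinearIndependent.pair_iff]
  intro s t hst
  rw [dval_lift, dval_lift] at hst
  have hst0 := congrFun hst 0
  have hst1 := congrFun hst 1
  have hst2 := congrFun hst 2
  have hst3 := congrFun hst 3
  simp only [Pi.add_apply, Pi.smul_apply, smul_eq_mul, Matrix.cons_val, Pi.zero_apply]
    at hst0 hst1 hst2 hst3
  set Q := MvPolynomial.aeval z q
  set q0 := MvPolynomial.aeval z (MvPolynomial.pderiv 0 q)
  set q1 := MvPolynomial.aeval z (MvPolynomial.pderiv 1 q)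
  have hvec : (s * q0 + t * q1) • val ν z + Q • (s • dval ν 0 z + t • dval ν 1 z) = 0 := by
    apply vec3_ext <;> simp only [Pi.add_apply, Pi.smul_apply, smul_eq_mul, Pi.zero_apply]
    · linear_combination hst0
    · linear_combination hst1
    · linear_combination hst2
  have heq := euler hq z
  have heF := euler hF z
  have heν := euler_val hν.homogeneous z
  push_cast at heq heF heν
  by_cases hQ : Q = 0
  · obtain ⟨j, hj⟩ := hred z hz hQ
    rw [hQ, zero_smul, add_zero, smul_eq_zero] at hvec
    have hD := hvec.resolve_right (hν.val_ne_zero hz)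
    have hc : cross z ![s, t] = 0 := by
      change z 0 * q0 + z 1 * q1 = 2 * Q at heq
      rw [hQ, mul_zero] at heq
      simp only [cross, Matrix.cons_val_zero, Matrix.cons_val_one]
      fin_cases j
      · apply mul_left_cancel₀ (show q0 ≠ 0 from hj); linear_combination t * heq - z 1 * hD
      · apply mul_left_cancel₀ (show q1 ≠ 0 from hj); linear_combination z 0 * hD - s * heq
    by_contra hne
    obtain ⟨c, hc0, hc⟩ := exists_smul_of_cross_eq_zero hz (w := ![s, t])
      (fun h => hne ⟨by simpa using congrFun h 0, by simpa using congrFun h 1⟩) hc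
    have hs : s = c * z 0 := by simpa using congrFun hc 0
    have ht : t = c * z 1 := by simpa using congrFun hc 1
    rw [hs, ht] at hst3
    have : c * (6 * MvPolynomial.aeval z F) = 0 := by rw [← heF, ← hst3]; ring
    simp [hc0] at this
    exact hdisj z hz hQ this
  · have h4 : (s * q0 + t * q1) • val ν z =
        ((s * q0 + t * q1) / 4) • (z 0 • dval ν 0 z + z 1 • dval ν 1 z) := by
      rw [heν]; module
    rw [h4] at hvec
    obtain ⟨e0, e1⟩ := LinearIndependent.pair_iff.mp (hν.immersion z hz)
      (Q * s + (s * q0 + t * q1) / 4 * z 0) (Q * t + (s * q0 + t * q1) / 4 * z 1) (by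
        rw [← hvec]; module)
    -- Pair `e0`, `e1` with the gradient of `q`: by Euler's identity for `q` the result is `Q D + (D
    -- / 4) · 2Q = (3 / 2) Q D`, where `D = s * q0 + t * q1`.
    have hD : s * q0 + t * q1 = 0 := by
      have : Q * (3 / 2) * (s * q0 + t * q1) = 0 := by
        linear_combination q0 * e0 + q1 * e1 - (s * q0 + t * q1) / 4 * heq
      simpa [hQ] using this
    rw [hD] at e0 e1
    simpa [hQ] using And.intro e0 e1

/-- Away from `D⁻` the projection from `p` is defined and sends the lift to `ν`. -/
lemma dependent_of_dependent_lift {ν : Fin 3 → Form} {q F : Form} {z w : Fin 2 → ℂ}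
    (hz : MvPolynomial.aeval z q ≠ 0) (hw : MvPolynomial.aeval w q ≠ 0)
    (h : IsDoublePair (lift ν q F) z w) : IsDoublePair ν z w := by
  refine ⟨h.1, fun h' => ?_⟩
  obtain ⟨s, t, hst, hne⟩ := exists_nontrivial_relation h.2
  have hst0 := congrFun hst 0
  have hst1 := congrFun hst 1
  have hst2 := congrFun hst 2
  simp only [val_lift, Pi.add_apply, Pi.smul_apply, smul_eq_mul, Matrix.cons_val, Pi.zero_apply]
    at hst0 hst1 hst2
  have := LinearIndependent.pair_iff.mp h' (s * MvPolynomial.aeval z q) (t * MvPolynomial.aeval w q) (by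
    apply vec3_ext <;> simp only [Pi.add_apply, Pi.smul_apply, smul_eq_mul, Pi.zero_apply]
    · linear_combination hst0
    · linear_combination hst1
    · linear_combination hst2)
  simp [hz, hw] at this
  tauto

/-- The image of `z` is `p`; the minors with the last coordinate, where `F z ≠ 0`, then kill the
first three coordinates at `w`. -/
lemma aeval_eq_zero_of_isDoublePair_lift {ν : Fin 3 → Form} (hν : IsImmersed 4 ν) {q F : Form}
    (hdisj : ∀ z : Fin 2 → ℂ, z ≠ 0 → MvPolynomial.aeval z q = 0 → MvPolynomial.aeval z F ≠ 0)
    {z w : Fin 2 → ℂ} (h : IsDoublePair (lift ν q F) z w) (hz : MvPolynomial.aeval z q = 0) :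
    MvPolynomial.aeval w q = 0 := by
  have hm : ∀ i : Fin 3, MvPolynomial.aeval w q * val ν w i = 0 := by
    intro i
    have h3 := minor_eq_zero h.2 i.castSucc 3
    rw [val_lift, val_lift, hz] at h3
    fin_cases i <;> simpa [hdisj z (ne_zero_of_cross_left h.1) hz] using h3
  by_contra hw
  refine hν.val_ne_zero (ne_zero_of_cross_right h.1) (funext fun i => ?_)
  simpa [hw] using hm i

/-- The height form `F` defines a nodal diagram: `D⁺` avoids `D⁻`, and the nodes are resolved. -/
structure IsGenericHeight (ν : Fin 3 → Form) (q F : Form) : Prop where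
  homogeneous : F.IsHomogeneous 6
  disjoint : ∀ z : Fin 2 → ℂ, z ≠ 0 → MvPolynomial.aeval z q = 0 → MvPolynomial.aeval z F ≠ 0
  separated : ∀ z w, IsDoublePair ν z w → ¬ IsDoublePair (lift ν q F) z w

/-- A double pair of the lift either lies in `D⁻` entirely or misses `D⁻`. In the latter case it
projects to a double pair of `ν`, which the lift separates. -/
lemma IsGenericHeight.only {ν : Fin 3 → Form} (hν : IsImmersed 4 ν) {q F : Form}
    (h : IsGenericHeight ν q F) {x y : Fin 2 → ℂ} {k : ℂ} (hxy : QuadraticZeros q x y k)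
    {z w : Fin 2 → ℂ} (hzw : IsDoublePair (lift ν q F) z w) :
    (cross z x = 0 ∧ cross w y = 0) ∨ (cross z y = 0 ∧ cross w x = 0) := by
  by_cases hz : MvPolynomial.aeval z q = 0
  · have hw := aeval_eq_zero_of_isDoublePair_lift hν h.disjoint hzw hz
    rw [hxy.aeval_eq_zero_iff] at hz hw
    have hz0 := ne_zero_of_cross_left hzw.1
    have hw0 := ne_zero_of_cross_right hzw.1
    have key : ∀ u : Fin 2 → ℂ, u ≠ 0 → cross z u = 0 → cross w u = 0 → False := by
      intro u hu h1 h2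
      obtain ⟨c, -, rfl⟩ := exists_smul_of_cross_eq_zero hu hz0 (by rw [cross_swap, h1, neg_zero])
      obtain ⟨c', -, rfl⟩ := exists_smul_of_cross_eq_zero hu hw0 (by rw [cross_swap, h2, neg_zero])
      exact hzw.1 (by simp [cross_smul, cross_self])
    have k1 := key x (ne_zero_of_cross_left hxy.cross_ne_zero)
    have k2 := key y (ne_zero_of_cross_right hxy.cross_ne_zero)
    tauto
  · have hw : MvPolynomial.aeval w q ≠ 0 :=
      fun hw => hz (aeval_eq_zero_of_isDoublePair_lift hν h.disjoint hzw.symm hw)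
    exact absurd hzw (h.separated z w (dependent_of_dependent_lift hz hw hzw))

/-- The tangent lines at `p` join `p`, represented by `E`, to the points `A` and `B` lying over
`ν(x)` and `ν(y)`. They differ because `D⁻` is not the preimage of a node. -/
lemma isOneNodal_lift {ν : Fin 3 → Form} (hν : IsImmersed 4 ν) {q F : Form}
    (hq : q.IsHomogeneous 2)
    (hred : ∀ z : Fin 2 → ℂ, z ≠ 0 → MvPolynomial.aeval z q = 0 →
      ∃ j, MvPolynomial.aeval z (MvPolynomial.pderiv j q) ≠ 0)
    (havoid : ∀ z w : Fin 2 → ℂ, IsDoublePair ν z w → MvPolynomial.aeval z q ≠ 0)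
    (h : IsGenericHeight ν q F) {x y : Fin 2 → ℂ} {k : ℂ} (hxy : QuadraticZeros q x y k) :
    IsOneNodal 6 (lift ν q F) x y := by
  have hx0 := ne_zero_of_cross_left hxy.cross_ne_zero
  have hy0 := ne_zero_of_cross_right hxy.cross_ne_zero
  have hFx := h.disjoint x hx0 hxy.left
  have hFy := h.disjoint y hy0 hxy.right
  refine ⟨isImmersed_lift hν hq hred h.homogeneous h.disjoint, ⟨hxy.cross_ne_zero, ?_⟩, ?_,
    fun z w => h.only hν hxy⟩
  · rw [LinearIndependent.pair_iff]
    intro hi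
    have := hi (MvPolynomial.aeval y F) (-MvPolynomial.aeval x F) (by
      ext i; rw [val_lift, val_lift, hxy.left, hxy.right]; fin_cases i <;> simp; ring)
    exact hFy this.1
  · set A : Fin 4 → ℂ := ![val ν x 0, val ν x 1, val ν x 2, 0]
    set B : Fin 4 → ℂ := ![val ν y 0, val ν y 1, val ν y 2, 0]
    set E : Fin 4 → ℂ := ![0, 0, 0, 1]
    have hi : LinearIndependent ℂ ![val ν x, val ν y] := by
      by_contra hi
      exact havoid x y ⟨hxy.cross_ne_zero, hi⟩ hxy.left
    have hABE : LinearIndependent ℂ ![A, B, E] := by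
      rw [Fintype.linearIndependent_iff]
      intro g hg
      simp only [Fin.sum_univ_three, Matrix.cons_val] at hg
      have g0 := congrFun hg 0
      have g1 := congrFun hg 1
      have g2 := congrFun hg 2
      have g3 := congrFun hg 3
      simp [A, B, E] at g0 g1 g2 g3
      have := LinearIndependent.pair_iff.mp hi (g 0) (g 1) (vec3_ext g0 g1 g2)
      intro i; fin_cases i
      exacts [this.1, this.2, g3]
    have hx : ∀ j, dval (lift ν q F) j x = MvPolynomial.aeval x (MvPolynomial.pderiv j q) • A +
        MvPolynomial.aeval x (MvPolynomial.pderiv j F) • E := by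
      intro j; rw [dval_lift, hxy.left]; ext i; fin_cases i <;> simp [A, E]
    have hy : ∀ j, dval (lift ν q F) j y = MvPolynomial.aeval y (MvPolynomial.pderiv j q) • B +
        MvPolynomial.aeval y (MvPolynomial.pderiv j F) • E := by
      intro j; rw [dval_lift, hxy.right]; ext i; fin_cases i <;> simp [B, E]
    have hspan : Submodule.span ℂ {dval (lift ν q F) 0 x, dval (lift ν q F) 1 x,
        dval (lift ν q F) 0 y, dval (lift ν q F) 1 y} = Submodule.span ℂ (Set.range ![A, B, E]) := by
      apply le_antisymm
      · rw [Submodule.span_le]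
        set S := Submodule.span ℂ (Set.range ![A, B, E])
        have mA : A ∈ S := Submodule.subset_span ⟨0, rfl⟩
        have mB : B ∈ S := Submodule.subset_span ⟨1, rfl⟩
        have mE : E ∈ S := Submodule.subset_span ⟨2, rfl⟩
        rintro v (rfl | rfl | rfl | rfl)
        · rw [hx]; exact S.add_mem (S.smul_mem _ mA) (S.smul_mem _ mE)
        · rw [hx]; exact S.add_mem (S.smul_mem _ mA) (S.smul_mem _ mE)
        · rw [hy]; exact S.add_mem (S.smul_mem _ mB) (S.smul_mem _ mE)
        · rw [hy]; exact S.add_mem (S.smul_mem _ mB) (S.smul_mem _ mE)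
      · rw [Submodule.span_le]
        set S := Submodule.span ℂ {dval (lift ν q F) 0 x, dval (lift ν q F) 1 x,
          dval (lift ν q F) 0 y, dval (lift ν q F) 1 y}
        have mx : ∀ j, dval (lift ν q F) j x ∈ S := by
          intro j; apply Submodule.subset_span; fin_cases j <;> simp
        have my : ∀ j, dval (lift ν q F) j y ∈ S := by
          intro j; apply Submodule.subset_span; fin_cases j <;> simp
        have mE : E ∈ S := by
          -- Euler's identity at `x`, whose image is `p`, recovers `E`; the directions `A`, `B`
          -- follow because the zeros of `q` are simple.
          have h1 : (6 * MvPolynomial.aeval x F) • E =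
              x 0 • dval (lift ν q F) 0 x + x 1 • dval (lift ν q F) 1 x := by
            rw [euler_val (isHomogeneous_lift hν.homogeneous hq h.homogeneous), val_lift, hxy.left]
            ext i; fin_cases i <;> simp [E]
          have h2 : (6 * MvPolynomial.aeval x F) • E ∈ S := by
            rw [h1]; exact S.add_mem (S.smul_mem _ (mx 0)) (S.smul_mem _ (mx 1))
          rwa [S.smul_mem_iff (by simpa using hFx)] at h2
        have mA : A ∈ S := by
          obtain ⟨j, hj⟩ := hred x hx0 hxy.left
          have h2 : MvPolynomial.aeval x (MvPolynomial.pderiv j q) • A ∈ S := by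
            rw [← add_sub_cancel_right (_ • A) (MvPolynomial.aeval x (MvPolynomial.pderiv j F) • E),
              ← hx]
            exact S.sub_mem (mx j) (S.smul_mem _ mE)
          rwa [S.smul_mem_iff hj] at h2
        have mB : B ∈ S := by
          obtain ⟨j, hj⟩ := hred y hy0 hxy.right
          have h2 : MvPolynomial.aeval y (MvPolynomial.pderiv j q) • B ∈ S := by
            rw [← add_sub_cancel_right (_ • B) (MvPolynomial.aeval y (MvPolynomial.pderiv j F) • E),
              ← hy]
            exact S.sub_mem (my j) (S.smul_mem _ mE)
          rwa [S.smul_mem_iff hj] at h2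
        rintro v ⟨i, rfl⟩
        fin_cases i
        exacts [mA, mB, mE]
    rw [hspan, finrank_span_eq_card hABE]
    rfl

/-- If two points over a node of `ν` were not separated, they would be the unique double pair of the
lift and hence lie in `D⁻`, which avoids the nodes. -/
lemma VirtualNodalDiagram.isNodalDiagram_iff (V : VirtualNodalDiagram) (F : Form) :
    IsNodalDiagram V.ν V.q F ↔ IsGenericHeight V.ν V.q F := by
  have hν := V.nodal.toIsImmersed
  constructor
  · rintro ⟨h1, h2, x, y, hx, hy, h3⟩
    refine ⟨h1, h2, fun z w hzw hzw' => V.q_avoids_nodes z w hzw ?_⟩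
    have hx0 := ne_zero_of_cross_left h3.double.1
    have hy0 := ne_zero_of_cross_right h3.double.1
    have hz0 := ne_zero_of_cross_left hzw.1
    rcases h3.only z w hzw' with ⟨h, -⟩ | ⟨h, -⟩
    · obtain ⟨c, -, rfl⟩ := exists_smul_of_cross_eq_zero hx0 hz0 (by rw [cross_swap, h, neg_zero])
      rw [aeval_smul V.q_homogeneous, hx, mul_zero]
    · obtain ⟨c, -, rfl⟩ := exists_smul_of_cross_eq_zero hy0 hz0 (by rw [cross_swap, h, neg_zero])
      rw [aeval_smul V.q_homogeneous, hy, mul_zero]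
  · intro h
    obtain ⟨x, y, k, hxy⟩ := exists_quadraticZeros V.q_homogeneous V.q_reduced
    exact ⟨h.homogeneous, h.disjoint, x, y, hxy.left, hxy.right,
      isOneNodal_lift hν V.q_homogeneous V.q_reduced V.q_avoids_nodes h hxy⟩

/-! ### Perturbations of the lift -/

/-- The determinant of three vectors. -/
def triple (u v m : Fin 3 → ℂ) : ℂ :=
  u 0 * (v 1 * m 2 - v 2 * m 1) - u 1 * (v 0 * m 2 - v 2 * m 0) + u 2 * (v 0 * m 1 - v 1 * m 0)

/-- Coefficients of quadruples of binary forms of degree 6. -/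
abbrev Coef := Fin 4 → Fin 7 → ℝ

/-- The relative velocity of the two branches at `z`, `w` under a deformation in direction `H`. -/
def jump (a : Fin 7 → ℝ) (H : Coef) (z w : Fin 2 → ℂ) : Fin 3 → ℂ := fun i =>
  val (bforms 6 H) z i.castSucc * MvPolynomial.aeval w (bform 6 a) -
    MvPolynomial.aeval z (bform 6 a) * val (bforms 6 H) w i.castSucc

/-- The component of the relative velocity transverse to the tangent plane of a double point. -/
def transversal (ν : Fin 3 → Form) (a : Fin 7 → ℝ) (H : Coef) (z w : Fin 2 → ℂ) : ℂ :=
  triple (val ν z) (val ν w) (jump a H z w)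

/-- The coefficients of the lift of `ν` with height form `bform 6 a`. -/
def liftCoef (ν : Fin 3 → Form) (q : Form) (a : Fin 7 → ℝ) : Coef :=
  ![coefs 6 (q * ν 0), coefs 6 (q * ν 1), coefs 6 (q * ν 2), a]

lemma bforms_liftCoef {ν : Fin 3 → Form} {q : Form} (hν : ∀ i, (ν i).IsHomogeneous 4)
    (hq : q.IsHomogeneous 2) (a : Fin 7 → ℝ) :
    bforms 6 (liftCoef ν q a) = lift ν q (bform 6 a) := by
  ext1 i
  fin_cases i
  exacts [bform_coefs (hq.mul (hν 0)), bform_coefs (hq.mul (hν 1)), bform_coefs (hq.mul (hν 2)), rfl]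

lemma continuous_liftCoef (ν : Fin 3 → Form) (q : Form) : Continuous (liftCoef ν q) := by
  refine continuous_pi fun i => ?_
  fin_cases i
  exacts [continuous_const, continuous_const, continuous_const, continuous_id]

lemma val_bforms_add_smul {ι : Type} {d : ℕ} (g H : ι → Fin (d + 1) → ℝ) (t : ℝ) (z : Fin 2 → ℂ) :
    val (bforms d (g + t • H)) z = val (bforms d g) z + (t : ℂ) • val (bforms d H) z := by
  ext i
  simp [val, bforms, bform_add, bform_smul]

lemma aeval_bform_add_smul {d : ℕ} (a b : Fin (d + 1) → ℝ) (t : ℝ) (z : Fin 2 → ℂ) :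
    MvPolynomial.aeval z (bform d (a + t • b)) =
      MvPolynomial.aeval z (bform d a) + (t : ℂ) * MvPolynomial.aeval z (bform d b) := by
  simp [bform_add, bform_smul]

lemma transversal_smul {ν : Fin 3 → Form} (hν : ∀ i, (ν i).IsHomogeneous 4) (a : Fin 7 → ℝ)
    (H : Coef) (b c : ℂ) (z w : Fin 2 → ℂ) :
    transversal ν a H (b • z) (c • w) = b ^ 10 * c ^ 10 * transversal ν a H z w := by
  have hH : ∀ (c : ℂ) u, val (bforms 6 H) (c • u) = c ^ 6 • val (bforms 6 H) u :=
    fun c u => val_smul (fun i => isHomogeneous_bform 6 (H i)) c u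
  simp only [transversal, triple, jump, val_smul hν, hH,
    aeval_smul (isHomogeneous_bform 6 a), Pi.smul_apply, smul_eq_mul]
  ring

/-- Exchanging the branches changes the sign both of `jump` and of the orientation of `ν(z)`,
`ν(w)`. -/
lemma transversal_swap (ν : Fin 3 → Form) (a : Fin 7 → ℝ) (H : Coef) (z w : Fin 2 → ℂ) :
    transversal ν a H w z = transversal ν a H z w := by
  simp only [transversal, triple, jump]
  ring

lemma transversal_star (ν : Fin 3 → Form) (a : Fin 7 → ℝ) (H : Coef) (z w : Fin 2 → ℂ) :
    transversal ν a H (star z) (star w) = star (transversal ν a H z w) := by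
  simp [transversal, triple, jump, val_star, aeval_star]

lemma continuous_transversal {ν : Fin 3 → Form} :
    Continuous fun p : (Fin 7 → ℝ) × Coef × (Fin 2 → ℂ) × (Fin 2 → ℂ) =>
      transversal ν p.1 p.2.1 p.2.2.1 p.2.2.2 := by
  have h1 : Continuous fun p : (Fin 7 → ℝ) × Coef × (Fin 2 → ℂ) × (Fin 2 → ℂ) =>
      val ν p.2.2.1 := (continuous_val ν).comp (by fun_prop)
  have h2 : Continuous fun p : (Fin 7 → ℝ) × Coef × (Fin 2 → ℂ) × (Fin 2 → ℂ) =>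
      val ν p.2.2.2 := (continuous_val ν).comp (by fun_prop)
  have h3 : Continuous fun p : (Fin 7 → ℝ) × Coef × (Fin 2 → ℂ) × (Fin 2 → ℂ) =>
      val (bforms 6 p.2.1) p.2.2.1 := (continuous_val_bforms 6).comp
        (f := fun p : (Fin 7 → ℝ) × Coef × (Fin 2 → ℂ) × (Fin 2 → ℂ) => (p.2.1, p.2.2.1)) (by fun_prop)
  have h4 : Continuous fun p : (Fin 7 → ℝ) × Coef × (Fin 2 → ℂ) × (Fin 2 → ℂ) =>
      val (bforms 6 p.2.1) p.2.2.2 := (continuous_val_bforms 6).comp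
        (f := fun p : (Fin 7 → ℝ) × Coef × (Fin 2 → ℂ) × (Fin 2 → ℂ) => (p.2.1, p.2.2.2)) (by fun_prop)
  have h5 : Continuous fun p : (Fin 7 → ℝ) × Coef × (Fin 2 → ℂ) × (Fin 2 → ℂ) =>
      MvPolynomial.aeval p.2.2.1 (bform 6 p.1) := by
    simp_rw [aeval_bform]; fun_prop
  have h6 : Continuous fun p : (Fin 7 → ℝ) × Coef × (Fin 2 → ℂ) × (Fin 2 → ℂ) =>
      MvPolynomial.aeval p.2.2.2 (bform 6 p.1) := by
    simp_rw [aeval_bform]; fun_prop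
  have h7 : Continuous fun p : (Fin 7 → ℝ) × Coef × (Fin 2 → ℂ) × (Fin 2 → ℂ) =>
      jump p.1 p.2.1 p.2.2.1 p.2.2.2 := by
    refine continuous_pi fun i => ?_
    exact (((continuous_apply _).comp h3).mul h6).sub (h5.mul ((continuous_apply _).comp h4))
  have e1 := fun i => (continuous_apply i).comp h1
  have e2 := fun i => (continuous_apply i).comp h2
  have e7 := fun i => (continuous_apply i).comp h7
  simp only [Function.comp_def] at e1 e2 e7
  unfold transversal triple
  fun_prop

/-- The minors with the last coordinate express `t` times the jump as a combination of `ν(z)` and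
`ν(w)`. The condition is exact, not of first order in `t`, once the height form of the deformed
curve, `a + t • H 3`, enters the determinant. -/
lemma transversal_eq_zero {ν : Fin 3 → Form} {q : Form} (hν : ∀ i, (ν i).IsHomogeneous 4)
    (hq : q.IsHomogeneous 2) {a : Fin 7 → ℝ} {H : Coef} {t : ℝ} (ht : t ≠ 0) {z w : Fin 2 → ℂ}
    (h : IsDoublePair (bforms 6 (liftCoef ν q a + t • H)) z w) :
    transversal ν (a + t • H 3) H z w = 0 := by
  have ht' : (t : ℂ) ≠ 0 := by exact_mod_cast ht
  have hm : ∀ i : Fin 3, (t : ℂ) * jump (a + t • H 3) H z w i =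
      -(MvPolynomial.aeval z q * MvPolynomial.aeval w (bform 6 (a + t • H 3))) * val ν z i +
        (MvPolynomial.aeval w q * MvPolynomial.aeval z (bform 6 (a + t • H 3))) * val ν w i := by
    intro i
    have h3 := minor_eq_zero h.2 i.castSucc 3
    rw [val_bforms_add_smul, val_bforms_add_smul, bforms_liftCoef hν hq, val_lift, val_lift] at h3
    simp only [jump, aeval_bform_add_smul]
    have e : ∀ u : Fin 2 → ℂ, val (bforms 6 H) u 3 = MvPolynomial.aeval u (bform 6 (H 3)) :=
      fun u => rfl
    fin_cases i <;> simp [e] at h3 ⊢ <;> linear_combination h3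
  apply mul_left_cancel₀ ht'
  have : (t : ℂ) * transversal ν (a + t • H 3) H z w =
      triple (val ν z) (val ν w) (fun i => (t : ℂ) * jump (a + t • H 3) H z w i) := by
    simp only [transversal, triple]; ring
  rw [this]
  simp only [hm, triple]
  ring

/-- Deformations of the lift in a transversal direction are embedded. -/
lemma eventually_isEmbedded_lift {ν : Fin 3 → Form} (hν : IsImmersed 4 ν) {q : Form}
    (hq : q.IsHomogeneous 2)
    (hred : ∀ z : Fin 2 → ℂ, z ≠ 0 → MvPolynomial.aeval z q = 0 →
      ∃ j, MvPolynomial.aeval z (MvPolynomial.pderiv j q) ≠ 0)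
    {x y : Fin 2 → ℂ} {k : ℂ} (hxy : QuadraticZeros q x y k) {a : Fin 7 → ℝ} {H : Coef}
    (h : IsGenericHeight ν q (bform 6 a)) (ht : transversal ν a H x y ≠ 0) :
    ∀ᶠ p : ((Fin 7 → ℝ) × Coef) × ℝ in 𝓝 (a, H) ×ˢ 𝓝[>] (0 : ℝ),
      IsEmbedded 6 (bforms 6 (liftCoef ν q p.1.1 + p.2 • p.1.2)) := by
  have hle : 𝓝 (a, H) ×ˢ 𝓝[>] (0 : ℝ) ≤ 𝓝 ((a, H), (0 : ℝ)) := by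
    rw [nhds_prod_eq (x := (a, H))]
    exact prod_mono_right _ nhdsWithin_le_nhds
  have hc : Continuous fun p : ((Fin 7 → ℝ) × Coef) × ℝ => liftCoef ν q p.1.1 + p.2 • p.1.2 := by
    have : Continuous fun p : ((Fin 7 → ℝ) × Coef) × ℝ => liftCoef ν q p.1.1 :=
      (continuous_liftCoef ν q).comp (continuous_fst.comp continuous_fst)
    fun_prop
  refine eventually_isEmbedded (d := 6) (Γ := fun p : ((Fin 7 → ℝ) × Coef) × ℝ =>
    liftCoef ν q p.1.1 + p.2 • p.1.2) (g := liftCoef ν q a) (by norm_num) ?_ ?_ ?_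
  · have := hc.tendsto ((a, H), (0 : ℝ))
    simp only [zero_smul, add_zero] at this
    exact this.mono_left hle
  · rw [bforms_liftCoef hν.homogeneous hq]
    exact isImmersed_lift hν hq hred h.homogeneous h.disjoint
  · intro z w hzw
    rw [bforms_liftCoef hν.homogeneous hq] at hzw
    -- Every double pair of the lift is `x`, `y` up to order and scaling, which `transversal`
    -- respects up to nonzero factors.
    have hne : transversal ν a H z w ≠ 0 := by
      have hz0 := ne_zero_of_cross_left hzw.1
      have hw0 := ne_zero_of_cross_right hzw.1
      have hx0 := ne_zero_of_cross_left hxy.cross_ne_zero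
      have hy0 := ne_zero_of_cross_right hxy.cross_ne_zero
      rcases h.only hν hxy hzw with ⟨h1, h2⟩ | ⟨h1, h2⟩
      · obtain ⟨b, hb, rfl⟩ := exists_smul_of_cross_eq_zero hx0 hz0 (by rw [cross_swap, h1, neg_zero])
        obtain ⟨c, hc, rfl⟩ := exists_smul_of_cross_eq_zero hy0 hw0 (by rw [cross_swap, h2, neg_zero])
        rw [transversal_smul hν.homogeneous]
        simp [hb, hc, ht]
      · obtain ⟨b, hb, rfl⟩ := exists_smul_of_cross_eq_zero hy0 hz0 (by rw [cross_swap, h1, neg_zero])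
        obtain ⟨c, hc, rfl⟩ := exists_smul_of_cross_eq_zero hx0 hw0 (by rw [cross_swap, h2, neg_zero])
        rw [transversal_smul hν.homogeneous, transversal_swap]
        simp [hb, hc, ht]
    have hcT : Continuous fun p : (((Fin 7 → ℝ) × Coef) × ℝ) × (Fin 2 → ℂ) × (Fin 2 → ℂ) =>
        transversal ν (p.1.1.1 + p.1.2 • p.1.1.2 3) p.1.1.2 p.2.1 p.2.2 :=
      continuous_transversal.comp
        (f := fun p : (((Fin 7 → ℝ) × Coef) × ℝ) × (Fin 2 → ℂ) × (Fin 2 → ℂ) =>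
          (p.1.1.1 + p.1.2 • p.1.1.2 3, p.1.1.2, p.2.1, p.2.2)) (by fun_prop)
    have h1 : ∀ᶠ p in (𝓝 (a, H) ×ˢ 𝓝[>] (0 : ℝ)) ×ˢ 𝓝 (z, w),
        transversal ν (p.1.1.1 + p.1.2 • p.1.1.2 3) p.1.1.2 p.2.1 p.2.2 ≠ 0 := by
      have h2 := hcT.continuousAt.eventually_ne (x := (((a, H), (0 : ℝ)), (z, w))) (y := 0)
        (by simpa using hne)
      rw [nhds_prod_eq] at h2
      exact h2.filter_mono (prod_mono_left _ hle)
    have h2 : ∀ᶠ p in (𝓝 (a, H) ×ˢ 𝓝[>] (0 : ℝ)) ×ˢ 𝓝 (z, w), 0 < p.1.2 :=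
      (tendsto_snd.comp tendsto_fst).eventually (eventually_mem_nhdsWithin (a := (0 : ℝ)))
    filter_upwards [h1, h2] with p hp1 hp2 hdp
    exact hp1 (transversal_eq_zero hν.homogeneous hq hp2.ne' hdp)

/-! ### The sign of a deformation -/

lemma vec4_ext {u v : Fin 4 → ℂ} (h0 : u 0 = v 0) (h1 : u 1 = v 1) (h2 : u 2 = v 2)
    (h3 : u 3 = v 3) : u = v := by
  ext i; fin_cases i <;> assumption

lemma det_combination (A B C D : Fin 4 → ℂ) (x e y f : Fin 2 → ℂ) :
    Matrix.det (Matrix.of ![x 0 • A + x 1 • B, e 0 • A + e 1 • B, y 0 • C + y 1 • D,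
      f 0 • C + f 1 • D]) = cross x e * cross y f * Matrix.det (Matrix.of ![A, B, C, D]) := by
  simp [Matrix.det_succ_row_zero, Fin.sum_univ_succ, cross, Fin.succAbove]
  ring

/-- Each tangent plane gets a new basis, the value and a directional derivative; the factor 36 is
one Euler factor 6 for each point. -/
lemma crossingDet_directional {G : Fin 4 → Form} (hG : ∀ i, (G i).IsHomogeneous 6)
    (x e y f : Fin 2 → ℂ) :
    cross x e * cross y f * crossingDet G x y =
      36 * Matrix.det (Matrix.of ![val G x, e 0 • dval G 0 x + e 1 • dval G 1 x, val G y,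
        f 0 • dval G 0 y + f 1 • dval G 1 y]) := by
  rw [crossingDet, ← det_combination, euler_val hG, euler_val hG]
  simp [Matrix.det_succ_row_zero, Fin.sum_univ_succ, Fin.succAbove]
  ring

lemma det_row_combination (A B C D : Fin 4 → ℂ) (s t : ℂ) :
    Matrix.det (Matrix.of ![s • A - t • C, B, C, D]) = s * Matrix.det (Matrix.of ![A, B, C, D]) := by
  simp [Matrix.det_succ_row_zero, Fin.sum_univ_succ, Fin.succAbove]
  ring

lemma det_smul_row (A B C D : Fin 4 → ℂ) (s : ℂ) :
    Matrix.det (Matrix.of ![s • A, B, C, D]) = s * Matrix.det (Matrix.of ![A, B, C, D]) := by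
  simp [Matrix.det_succ_row_zero, Fin.sum_univ_succ, Fin.succAbove]
  ring

/-- The derivative of the crossing determinant at the double point of a lift. -/
lemma tendsto_crossingDet {ν : Fin 3 → Form} (hν : ∀ i, (ν i).IsHomogeneous 4) {q : Form}
    (hq : q.IsHomogeneous 2) {x y : Fin 2 → ℂ} {k : ℂ} (hxy : QuadraticZeros q x y k)
    {a : Fin 7 → ℝ} (hy : MvPolynomial.aeval y (bform 6 a) ≠ 0) {H : ℝ → Coef} {H₀ : Coef}
    (hH : Tendsto H (𝓝[>] 0) (𝓝 H₀)) :
    Tendsto (fun t : ℝ => (t : ℂ)⁻¹ * crossingDet (bforms 6 (liftCoef ν q a + t • H t)) x y)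
      (𝓝[>] 0) (𝓝 (36 * k ^ 2 * cross x y ^ 2 * transversal ν a H₀ x y)) := by
  obtain ⟨e, he⟩ := exists_cross_ne_zero (ne_zero_of_cross_left hxy.cross_ne_zero)
  obtain ⟨f, hf⟩ := exists_cross_ne_zero (ne_zero_of_cross_right hxy.cross_ne_zero)
  set G : ℝ × Coef → Fin 4 → Form := fun p => bforms 6 (liftCoef ν q a + p.1 • p.2) with hG
  have hGhom : ∀ p i, (G p i).IsHomogeneous 6 := fun p i => isHomogeneous_bform 6 _
  have cv : ∀ z, Continuous fun p => val (G p) z := fun z =>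
    (continuous_val_bforms 6).comp (f := fun p : ℝ × Coef => (liftCoef ν q a + p.1 • p.2, z))
      (by fun_prop)
  have cd : ∀ j z, Continuous fun p => dval (G p) j z := fun j z =>
    (continuous_dval_bforms 6 j).comp (f := fun p : ℝ × Coef => (liftCoef ν q a + p.1 • p.2, z))
      (by fun_prop)
  have cF : ∀ z : Fin 2 → ℂ, Continuous fun p : ℝ × Coef =>
      MvPolynomial.aeval z (bform 6 (a + p.1 • p.2 3)) := by
    intro z; simp_rw [aeval_bform]; fun_prop
  -- The combination of `G(x)` and `G(y)` that cancels the last coordinate is `t • J`, since `q`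
  -- vanishes at `x` and `y`. Using it as a row splits the factor `t` off the determinant, and `M`
  -- is what remains.
  set J : ℝ × Coef → Fin 4 → ℂ := fun p => ![jump (a + p.1 • p.2 3) p.2 x y 0,
    jump (a + p.1 • p.2 3) p.2 x y 1, jump (a + p.1 • p.2 3) p.2 x y 2, 0] with hJ
  have cJ : Continuous J := by
    have h1 : ∀ z, Continuous fun p : ℝ × Coef => val (bforms 6 p.2) z := fun z =>
      (continuous_val_bforms 6).comp (f := fun p : ℝ × Coef => (p.2, z)) (by fun_prop)
    have h2 : ∀ i, Continuous fun p : ℝ × Coef => jump (a + p.1 • p.2 3) p.2 x y i := fun i =>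
      (((continuous_apply _).comp (h1 x)).mul (cF y)).sub
        ((cF x).mul ((continuous_apply _).comp (h1 y)))
    refine continuous_pi fun i => ?_
    fin_cases i
    exacts [h2 0, h2 1, h2 2, continuous_const]
  set M : ℝ × Coef → Matrix (Fin 4) (Fin 4) ℂ := fun p => Matrix.of ![J p,
    e 0 • dval (G p) 0 x + e 1 • dval (G p) 1 x, val (G p) y,
    f 0 • dval (G p) 0 y + f 1 • dval (G p) 1 y] with hM
  have cM : Continuous fun p => (M p).det := by
    refine Continuous.matrix_det (continuous_pi fun i => ?_)
    fin_cases i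
    · exact cJ
    · change Continuous fun p => e 0 • dval (G p) 0 x + e 1 • dval (G p) 1 x
      exact ((cd 0 x).const_smul (e 0)).add ((cd 1 x).const_smul (e 1))
    · exact cv y
    · change Continuous fun p => f 0 • dval (G p) 0 y + f 1 • dval (G p) 1 y
      exact ((cd 0 y).const_smul (f 0)).add ((cd 1 y).const_smul (f 1))
  have hrow : ∀ p : ℝ × Coef, (p.1 : ℂ) • J p =
      MvPolynomial.aeval y (bform 6 (a + p.1 • p.2 3)) • val (G p) x -
        MvPolynomial.aeval x (bform 6 (a + p.1 • p.2 3)) • val (G p) y := by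
    intro p
    have e3 : ∀ u : Fin 2 → ℂ, val (bforms 6 p.2) u 3 = MvPolynomial.aeval u (bform 6 (p.2 3)) :=
      fun u => rfl
    simp only [hG, val_bforms_add_smul, bforms_liftCoef hν hq, val_lift, hxy.left, hxy.right, hJ, jump,
      aeval_bform_add_smul]
    have c0 : (0 : Fin 3).castSucc = (0 : Fin 4) := rfl
    have c1 : (1 : Fin 3).castSucc = (1 : Fin 4) := rfl
    have c2 : (2 : Fin 3).castSucc = (2 : Fin 4) := rfl
    apply vec4_ext <;> simp only [Pi.add_apply, Pi.sub_apply, Pi.smul_apply, smul_eq_mul,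
      Matrix.cons_val, e3, c0, c1, c2] <;> ring
  have hdet : ∀ p : ℝ × Coef, MvPolynomial.aeval y (bform 6 (a + p.1 • p.2 3)) *
      (cross x e * cross y f * crossingDet (G p) x y) = 36 * (p.1 * (M p).det) := by
    intro p
    have e1 := det_smul_row (J p) (e 0 • dval (G p) 0 x + e 1 • dval (G p) 1 x) (val (G p) y)
      (f 0 • dval (G p) 0 y + f 1 • dval (G p) 1 y) p.1
    rw [hrow, det_row_combination] at e1
    rw [crossingDet_directional (hGhom p)]
    linear_combination 36 * e1
  -- The velocity may depend on `t`, so that it can be the difference quotient of any differentiable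
  -- path.
  have hlim : Tendsto (fun t => ((t, H t) : ℝ × Coef)) (𝓝[>] 0) (𝓝 (0, H₀)) :=
    Tendsto.prodMk_nhds (tendsto_id.mono_left nhdsWithin_le_nhds) hH
  -- At `t = 0` the row of `y` is `(0, 0, 0, F(y))`, and the derivative rows are multiples of
  -- `ν(x)`, `ν(y)` in the first three coordinates; expansion leaves `triple`.
  have hM0 : (M (0, H₀)).det = MvPolynomial.aeval y (bform 6 a) *
      (k ^ 2 * cross x y ^ 2 * (cross x e * cross y f)) * transversal ν a H₀ x y := by
    have e0 : G (0, H₀) = lift ν q (bform 6 a) := by simp [hG, bforms_liftCoef hν hq]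
    have hdx : e 0 • dval (G (0, H₀)) 0 x + e 1 • dval (G (0, H₀)) 1 x =
        ![-(k * cross x e * cross x y) * val ν x 0, -(k * cross x e * cross x y) * val ν x 1,
          -(k * cross x e * cross x y) * val ν x 2,
          e 0 * MvPolynomial.aeval x (MvPolynomial.pderiv 0 (bform 6 a)) +
            e 1 * MvPolynomial.aeval x (MvPolynomial.pderiv 1 (bform 6 a))] := by
      rw [e0, dval_lift, dval_lift, hxy.left, ← hxy.directional_left e]
      ext i; fin_cases i <;> simp <;> ring
    have hdy : f 0 • dval (G (0, H₀)) 0 y + f 1 • dval (G (0, H₀)) 1 y =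
        ![(k * cross y f * cross x y) * val ν y 0, (k * cross y f * cross x y) * val ν y 1,
          (k * cross y f * cross x y) * val ν y 2,
          f 0 * MvPolynomial.aeval y (MvPolynomial.pderiv 0 (bform 6 a)) +
            f 1 * MvPolynomial.aeval y (MvPolynomial.pderiv 1 (bform 6 a))] := by
      rw [e0, dval_lift, dval_lift, hxy.right, ← hxy.directional_right f]
      ext i; fin_cases i <;> simp <;> ring
    have hvy : val (G (0, H₀)) y = ![0, 0, 0, MvPolynomial.aeval y (bform 6 a)] := by
      rw [e0, val_lift, hxy.right]; simp
    simp only [hM]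
    rw [hdx, hdy, hvy]
    simp [Matrix.det_succ_row_zero, Fin.sum_univ_succ, Fin.succAbove, hJ, transversal, triple]
    ring
  have h1 : Tendsto (fun t => 36 * (M (t, H t)).det /
      (MvPolynomial.aeval y (bform 6 (a + t • H t 3)) * (cross x e * cross y f))) (𝓝[>] 0)
      (𝓝 (36 * (M (0, H₀)).det / (MvPolynomial.aeval y (bform 6 (a + (0 : ℝ) • H₀ 3)) *
        (cross x e * cross y f)))) := by
    refine Tendsto.div (((cM.tendsto _).comp hlim).const_mul _)
      ((((cF y).tendsto _).comp hlim).mul_const _) ?_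
    simp [hy, he, hf]
  have h2 : 36 * (M (0, H₀)).det / (MvPolynomial.aeval y (bform 6 (a + (0 : ℝ) • H₀ 3)) *
        (cross x e * cross y f)) = 36 * k ^ 2 * cross x y ^ 2 * transversal ν a H₀ x y := by
    rw [hM0, zero_smul, add_zero]
    field_simp
  rw [h2] at h1
  refine h1.congr' ?_
  have hFy : ∀ᶠ t in 𝓝[>] (0 : ℝ), MvPolynomial.aeval y (bform 6 (a + t • H t 3)) ≠ 0 := by
    refine (((cF y).tendsto _).comp hlim).eventually_ne ?_
    simpa using hy
  filter_upwards [hFy, eventually_mem_nhdsWithin (a := (0 : ℝ))] with t ht ht0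
  have ht0' : (t : ℂ) ≠ 0 := by exact_mod_cast (ne_of_gt ht0)
  have := hdet (t, H t)
  simp only [hG] at this
  rw [div_eq_iff (by simp [ht, he, hf])]
  field_simp
  linear_combination -this

/-- The derivative of the crossing determinant in direction `H`. -/
def crossingSpeed (ν : Fin 3 → Form) (x y : Fin 2 → ℂ) (k : ℂ) (a : Fin 7 → ℝ) (H : Coef) : ℝ :=
  (36 * k ^ 2 * cross x y ^ 2 * transversal ν a H x y).re

/-- Conjugation preserves `q` and fixes or exchanges its zeros; comparing the two factorizations at
`x + y`, where both linear factors are nonzero, gives the claim. -/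
lemma QuadraticZeros.real_leading {q : Form} {x y : Fin 2 → ℂ} {k : ℂ} (h : QuadraticZeros q x y k) :
    star k = k := by
  have hx0 := ne_zero_of_cross_left h.cross_ne_zero
  have hs : ∀ z, star k * (cross (star z) (star x) * cross (star z) (star y)) =
      k * (cross (star z) x * cross (star z) y) := by
    intro z
    rw [← mul_assoc k, ← h.factor, aeval_star, h.factor, cross_star, cross_star]
    simp; ring
  have h1 : ∀ z, star k * (cross z x * cross z y) = k * (cross z x * cross z y) := by
    intro z
    have := hs (star z)
    rw [star_star] at this
    rcases h.real with ⟨e1, e2⟩ | e1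
    · rwa [e1, e2] at this
    · rw [e1, star_star, mul_comm (cross z (star x))] at this
      rw [e1]; exact this
  have h2 := h1 (x + y)
  have e1 : cross (x + y) x = - cross x y := by simp [cross]; ring
  have e2 : cross (x + y) y = cross x y := by simp [cross]; ring
  rw [e1, e2] at h2
  exact mul_right_cancel₀ (mul_ne_zero (neg_ne_zero.mpr h.cross_ne_zero) h.cross_ne_zero) h2

/-- Conjugation fixes or exchanges `x` and `y`, and all factors are symmetric in them. Hence taking
the real part in `crossingSpeed` loses nothing. -/
lemma star_crossingSpeed {ν : Fin 3 → Form} {q : Form} {x y : Fin 2 → ℂ} {k : ℂ}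
    (h : QuadraticZeros q x y k) (a : Fin 7 → ℝ) (H : Coef) :
    star (36 * k ^ 2 * cross x y ^ 2 * transversal ν a H x y) =
      36 * k ^ 2 * cross x y ^ 2 * transversal ν a H x y := by
  have h1 : star (cross x y ^ 2) = cross x y ^ 2 := by
    rw [star_pow, ← cross_star]
    rcases h.real with ⟨e1, e2⟩ | rfl
    · rw [e1, e2]
    · rw [star_star, cross_swap, neg_sq]
  have h2 : star (transversal ν a H x y) = transversal ν a H x y := by
    rw [← transversal_star]
    rcases h.real with ⟨e1, e2⟩ | rfl
    · rw [e1, e2]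
    · rw [star_star, transversal_swap]
  have h3 : star (36 : ℂ) = 36 := by simp
  rw [star_mul, star_mul, star_mul, h1, h2, h3, star_pow, h.real_leading]
  ring

lemma crossingSpeed_ne_zero_iff {ν : Fin 3 → Form} {q : Form} {x y : Fin 2 → ℂ} {k : ℂ}
    (h : QuadraticZeros q x y k) (a : Fin 7 → ℝ) (H : Coef) :
    crossingSpeed ν x y k a H ≠ 0 ↔ transversal ν a H x y ≠ 0 := by
  have h1 := Complex.conj_eq_iff_re.mp (star_crossingSpeed (ν := ν) h a H)
  rw [crossingSpeed, ← Complex.ofReal_ne_zero, h1]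
  simp [h.ne_zero, h.cross_ne_zero]

lemma crossingSpeed_add_smul (ν : Fin 3 → Form) (x y : Fin 2 → ℂ) (k : ℂ) (a : Fin 7 → ℝ)
    (r s : ℝ) (H K : Coef) : crossingSpeed ν x y k a (r • H + s • K) =
      r * crossingSpeed ν x y k a H + s * crossingSpeed ν x y k a K := by
  have hv : ∀ z, val (bforms 6 (r • H + s • K)) z =
      (r : ℂ) • val (bforms 6 H) z + (s : ℂ) • val (bforms 6 K) z := by
    intro z; ext i; simp [val, bforms, bform_add, bform_smul]
  have : transversal ν a (r • H + s • K) x y =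
      r * transversal ν a H x y + s * transversal ν a K x y := by
    simp only [transversal, triple, jump, hv, Pi.add_apply, Pi.smul_apply, smul_eq_mul]
    ring
  rw [crossingSpeed, crossingSpeed, crossingSpeed, this, ← Complex.re_ofReal_mul,
    ← Complex.re_ofReal_mul, ← Complex.add_re]
  congr 1
  ring

lemma continuous_crossingSpeed (ν : Fin 3 → Form) (x y : Fin 2 → ℂ) (k : ℂ) :
    Continuous fun p : (Fin 7 → ℝ) × Coef => crossingSpeed ν x y k p.1 p.2 := by
  have := continuous_transversal (ν := ν).comp
    (f := fun p : (Fin 7 → ℝ) × Coef => (p.1, p.2, x, y)) (by fun_prop)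
  exact Complex.continuous_re.comp (continuous_const.mul this)

/-- Otherwise evaluation at `x` and at `y` would be proportional on all monomials of degree 6.
Neighbouring monomials at the two ends of the list then give `[x] = [y]`. -/
lemma exists_form_separating {x y : Fin 2 → ℂ} (hxy : cross x y ≠ 0) {A B : ℂ} (hA : A ≠ 0)
    (hB : B ≠ 0) : ∃ b : Fin 7 → ℝ,
      MvPolynomial.aeval x (bform 6 b) * B - A * MvPolynomial.aeval y (bform 6 b) ≠ 0 := by
  by_contra! h
  have hm : ∀ i : Fin 7, x 0 ^ (i : ℕ) * x 1 ^ (6 - i : ℕ) * B = A * (y 0 ^ (i : ℕ) * y 1 ^ (6 - i : ℕ)) := by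
    intro i
    have := h (Pi.single i 1)
    rw [aeval_bform, aeval_bform, Finset.sum_eq_single i (by intro j _ hj; simp [hj]) (by simp),
      Finset.sum_eq_single i (by intro j _ hj; simp [hj]) (by simp)] at this
    simp at this
    linear_combination this
  apply hxy
  have h0 := hm 0
  have h1 := hm 1
  have h5 := hm 5
  have h6 := hm 6
  norm_num [Fin.val_ofNat] at h0 h1 h5 h6
  by_cases hx : x 0 = 0
  · rw [hx] at h1
    have hy : y 0 * y 1 ^ 5 = 0 := by
      apply mul_left_cancel₀ hA; simp at h1 ⊢; tauto
    rcases mul_eq_zero.mp hy with hy | hy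
    · simp [cross, hx, hy]
    · have hy1 : y 1 = 0 := by simpa using hy
      rw [hy1] at h0
      have : x 1 = 0 := by simpa [hB] using h0
      simp [cross, hx, this]
  · have hp : x 0 ^ 5 ≠ 0 := pow_ne_zero _ hx
    have hy : y 0 ≠ 0 := by
      intro hy
      rw [hy] at h6
      simp [hx, hB] at h6
    have hp' : y 0 ^ 5 ≠ 0 := pow_ne_zero _ hy
    apply mul_left_cancel₀ (mul_ne_zero (mul_ne_zero (mul_ne_zero hp hp') hB) hA)
    simp only [cross]
    linear_combination (A * y 0 ^ 5 * y 1) * h6 - (A * y 0 ^ 6) * h5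

/-- Moving one of the first three coordinates by a form `b` that separates `x` from `y` gives, up to
sign, a nonzero multiple of a minor of `ν(x)`, `ν(y)`, and some minor is nonzero. Linearity in `H`
then allows either sign. -/
lemma exists_crossingSpeed_pos {ν : Fin 3 → Form} {q : Form} {x y : Fin 2 → ℂ} {k : ℂ}
    (h : QuadraticZeros q x y k) (hi : LinearIndependent ℂ ![val ν x, val ν y]) {a : Fin 7 → ℝ}
    (hx : MvPolynomial.aeval x (bform 6 a) ≠ 0) (hy : MvPolynomial.aeval y (bform 6 a) ≠ 0)
    (c : ℤˣ) : ∃ H, 0 < ((c : ℤ) : ℝ) * crossingSpeed ν x y k a H := by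
  obtain ⟨b, hb⟩ := exists_form_separating h.cross_ne_zero hx hy
  set D := MvPolynomial.aeval x (bform 6 b) * MvPolynomial.aeval y (bform 6 a) -
    MvPolynomial.aeval x (bform 6 a) * MvPolynomial.aeval y (bform 6 b) with hD
  have h0 : bform 6 0 = 0 := by simp [bform]
  obtain ⟨H, hH⟩ : ∃ H, transversal ν a H x y ≠ 0 := by
    by_contra! hall
    have c0 := hall ![b, 0, 0, 0]
    have c1 := hall ![0, b, 0, 0]
    have c2 := hall ![0, 0, b, 0]
    simp only [transversal, triple, jump, val, bforms] at c0 c1 c2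
    simp [h0] at c0 c1 c2
    rw [← hD] at c0 c1 c2
    have m0 : val ν x 1 * val ν y 2 - val ν x 2 * val ν y 1 = 0 := by
      apply mul_left_cancel₀ hb; simp only [val]; linear_combination c0
    have m1 : val ν x 0 * val ν y 2 - val ν x 2 * val ν y 0 = 0 := by
      apply mul_left_cancel₀ hb; simp only [val]; linear_combination -c1
    have m2 : val ν x 0 * val ν y 1 - val ν x 1 * val ν y 0 = 0 := by
      apply mul_left_cancel₀ hb; simp only [val]; linear_combination c2
    have hvx : val ν x ≠ 0 := by simpa using hi.ne_zero 0
    obtain ⟨i, hvi⟩ := Function.ne_iff.mp hvx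
    have := LinearIndependent.pair_iff.mp hi (val ν y i) (-val ν x i) (by
      fin_cases i <;> apply vec3_ext <;> simp <;> (first
        | ring1
        | linear_combination m0
        | linear_combination m1
        | linear_combination m2
        | linear_combination -m0
        | linear_combination -m1
        | linear_combination -m2))
    exact hvi (by simpa using this.2)
  have hne := (crossingSpeed_ne_zero_iff (ν := ν) h a H).mpr hH
  have hc : (((c : ℤ) : ℝ)) * ((c : ℤ) : ℝ) = 1 := by
    rcases Int.units_eq_one_or c with rfl | rfl <;> simp
  refine ⟨(((c : ℤ) : ℝ) * crossingSpeed ν x y k a H) • H + (0 : ℝ) • H, ?_⟩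
  rw [crossingSpeed_add_smul, zero_mul, add_zero]
  have : ((c : ℤ) : ℝ) * (((c : ℤ) : ℝ) * crossingSpeed ν x y k a H * crossingSpeed ν x y k a H) =
      crossingSpeed ν x y k a H ^ 2 := by
    linear_combination (crossingSpeed ν x y k a H ^ 2) * hc
  rw [this]
  positivity

/-! ### Complements of subspaces of codimension two in convex sets -/

section Codim

variable {E : Type} [NormedAddCommGroup E] [NormedSpace ℝ E]

lemma dense_ne_zero {φ : E →ₗ[ℝ] ℝ} (h : φ ≠ 0) : Dense {c | φ c ≠ 0} := by
  have : ({c | φ c ≠ 0} : Set E) = (LinearMap.ker φ : Set E)ᶜ := by ext c; simp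
  rw [this, ← interior_eq_empty_iff_dense_compl]
  by_contra hne
  exact h (LinearMap.ker_eq_top.mp (Submodule.eq_top_of_nonempty_interior' _
    (Set.nonempty_iff_ne_empty.mpr hne)))

variable [FiniteDimensional ℝ E]

lemma exists_forall_ne_zero {I : Type} [Finite I] {U : Set E} (hU : IsOpen U) (hne : U.Nonempty)
    {φ : I → E →ₗ[ℝ] ℝ} (h : ∀ i, φ i ≠ 0) : ∃ c ∈ U, ∀ i, φ i c ≠ 0 := by
  have : Dense (⋂ i, {c | φ i c ≠ 0}) := by
    refine dense_iInter_of_isOpen (fun i => ?_) fun i => dense_ne_zero (h i)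
    exact isOpen_ne_fun (LinearMap.continuous_of_finiteDimensional _) continuous_const
  obtain ⟨c, hc, hcU⟩ := this.inter_open_nonempty U hU hne
  exact ⟨c, hc, by simpa using hcU⟩

variable {I : Type} [Finite I] {U : Set E} {l : I → E →ₗ[ℝ] ℂ}

lemma nonempty_compl_kernels (hU : IsOpen U) (hne : U.Nonempty)
    (hl : ∀ i, Function.Surjective (l i)) : ∃ a ∈ U, ∀ i, l i a ≠ 0 := by
  obtain ⟨c, hc, h⟩ := exists_forall_ne_zero (φ := fun i => Complex.reLm ∘ₗ l i) hU hne (fun i h => by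
    obtain ⟨c, hc⟩ := hl i 1
    have := LinearMap.congr_fun h c
    simp [hc] at this)
  refine ⟨c, hc, fun i hi => h i ?_⟩
  simp [hi]

/-- The segment from `a` to `c` avoids the kernel of `l i` if `l i c` is not a real multiple of `l i
a`. For finitely many `i` and two endpoints this holds for a generic `c` in `U`, so any two points
are joined through such a `c`. -/
lemma isPreconnected_compl_kernels (hU : IsOpen U) (hconv : Convex ℝ U)
    (hl : ∀ i, Function.Surjective (l i)) : IsPreconnected {a | a ∈ U ∧ ∀ i, l i a ≠ 0} := by
  refine isPreconnected_of_forall_pair fun a ha b hb => ?_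
  -- `φ a i` vanishes exactly on the vectors whose image under `l i` is a real multiple of `l i a`
  -- (for `l i a ≠ 0`).
  set φ : E → I → E →ₗ[ℝ] ℝ := fun a i =>
    Complex.imLm ∘ₗ (LinearMap.mulRight ℝ (star (l i a))) ∘ₗ l i with hφ
  have hφa : ∀ a c i, φ a i c = (l i c * star (l i a)).im := fun a c i => rfl
  have hne : ∀ a i, l i a ≠ 0 → φ a i ≠ 0 := by
    intro a i ha h
    obtain ⟨c, hc⟩ := hl i (Complex.I * l i a)
    have h1 := LinearMap.congr_fun h c
    rw [hφa, hc, mul_assoc, Complex.star_def, Complex.mul_conj] at h1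
    simp [ha] at h1
  have hseg : ∀ a c, a ∈ U → c ∈ U → (∀ i, l i a ≠ 0) → (∀ i, φ a i c ≠ 0) →
      segment ℝ a c ⊆ {a | a ∈ U ∧ ∀ i, l i a ≠ 0} := by
    rintro a c ha hc hla hφc v hv
    refine ⟨hconv.segment_subset ha hc hv, fun i hi => ?_⟩
    obtain ⟨r, s, hr, hs, hrs, rfl⟩ := hv
    have h1 : φ a i (r • a + s • c) = 0 := by rw [hφa, hi]; simp
    have h2 : φ a i a = 0 := by rw [hφa, Complex.star_def, Complex.mul_conj, Complex.ofReal_im]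
    rw [map_add, map_smul, map_smul, h2] at h1
    have h3 : s = 0 := by simpa [hφc i] using h1
    subst h3
    have h4 : r = 1 := by linarith
    subst h4
    simp at hi
    exact hla i hi
  obtain ⟨c, hc, h⟩ := exists_forall_ne_zero (I := I ⊕ I) (φ := Sum.elim (φ a) (φ b)) hU
    ⟨a, ha.1⟩ (by rintro (i | i); exacts [hne a i (ha.2 i), hne b i (hb.2 i)])
  refine ⟨segment ℝ a c ∪ segment ℝ b c, Set.union_subset
    (hseg a c ha.1 hc ha.2 fun i => h (Sum.inl i)) (hseg b c hb.1 hc hb.2 fun i => h (Sum.inr i)),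
    Or.inl (left_mem_segment ℝ a c), Or.inr (left_mem_segment ℝ b c), ?_⟩
  exact (convex_segment a c).isPreconnected.union c (right_mem_segment ℝ a c)
    (right_mem_segment ℝ b c) (convex_segment b c).isPreconnected

end Codim

/-! ### Real forms with prescribed values -/

/-- The hypothesis says that the point `z` is not real, so that `z 0`, `z 1` form a basis of ℂ over
ℝ. A real linear form times `X₀ ^ d` therefore takes any value. -/
lemma exists_form_aeval_eq {d : ℕ} {z : Fin 2 → ℂ} (hz : cross z (star z) ≠ 0) (c : ℂ) :
    ∃ F : Form, F.IsHomogeneous (d + 1) ∧ MvPolynomial.aeval z F = c := by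
  have hz0 : z 0 ≠ 0 := by intro h; simp [cross, h] at hz
  set D := cross z (star z) with hD
  set c' := c / z 0 ^ d with hc'
  have hDs : star D = - D := by simp [hD, cross]; ring
  have hDs' : (starRingEnd ℂ) D = - D := hDs
  have hα : (((c' * star (z 1) - star c' * z 1) / D).re : ℂ) = (c' * star (z 1) - star c' * z 1) / D := by
    rw [← Complex.conj_eq_iff_re]
    simp [hDs']
    rw [div_neg, ← neg_div]; ring
  have hβ : (((z 0 * star c' - star (z 0) * c') / D).re : ℂ) = (z 0 * star c' - star (z 0) * c') / D := by
    rw [← Complex.conj_eq_iff_re]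
    simp [hDs']
    rw [div_neg, ← neg_div]; ring
  have key : (((c' * star (z 1) - star c' * z 1) / D).re : ℂ) * z 0 +
      (((z 0 * star c' - star (z 0) * c') / D).re : ℂ) * z 1 = c' := by
    rw [hα, hβ]
    field_simp
    rw [hD]
    simp only [cross, Pi.star_apply]
    ring
  generalize ((c' * star (z 1) - star c' * z 1) / D).re = α at key
  generalize ((z 0 * star c' - star (z 0) * c') / D).re = β at key
  refine ⟨(MvPolynomial.C α * MvPolynomial.X 0 + MvPolynomial.C β * MvPolynomial.X 1) *
    MvPolynomial.X 0 ^ d, ?_, ?_⟩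
  · have h0 := (MvPolynomial.isHomogeneous_C (Fin 2) α).mul (MvPolynomial.isHomogeneous_X ℝ (0 : Fin 2))
    have h1 := (MvPolynomial.isHomogeneous_C (Fin 2) β).mul (MvPolynomial.isHomogeneous_X ℝ (1 : Fin 2))
    have h2 := (h0.add h1).mul ((MvPolynomial.isHomogeneous_X ℝ (0 : Fin 2)).pow d)
    convert h2 using 1
    ring
  · simp only [map_mul, map_add, map_pow, MvPolynomial.aeval_X, MvPolynomial.aeval_C,
      Complex.coe_algebraMap, key]
    rw [hc']
    field_simp

/-- The real quadratic form with zeros `w` and `star w`. -/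
lemma exists_quadratic (w : Fin 2 → ℂ) : ∃ N : Form, N.IsHomogeneous 2 ∧
    ∀ z, MvPolynomial.aeval z N = cross z w * cross z (star w) := by
  refine ⟨bform 2 ![Complex.normSq (w 0), -(2 * (w 0 * star (w 1)).re), Complex.normSq (w 1)],
    isHomogeneous_bform _ _, fun z => ?_⟩
  have h1 : ((2 * (w 0 * star (w 1)).re : ℝ) : ℂ) = w 0 * star (w 1) + star (w 0) * w 1 := by
    have := Complex.add_conj (w 0 * star (w 1))
    rw [← this]; simp
  have h2 : ∀ a : Fin 3 → ℝ, MvPolynomial.aeval z (bform 2 a) =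
      a 0 * z 1 ^ 2 + a 1 * (z 0 * z 1) + a 2 * z 0 ^ 2 := by
    intro a; simp [aeval_bform, Fin.sum_univ_three]
  rw [h2]
  simp only [Matrix.cons_val, Complex.ofReal_neg, h1]
  simp [cross, Complex.normSq_eq_conj_mul_self]
  ring

/-- Evaluation at `z` as a linear map on coefficients. -/
def evalLin (z : Fin 2 → ℂ) : (Fin 7 → ℝ) →ₗ[ℝ] ℂ where
  toFun a := MvPolynomial.aeval z (bform 6 a)
  map_add' a b := by rw [bform_add, map_add]
  map_smul' c a := by rw [bform_smul, map_smul]; rfl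

lemma evalLin_apply (z : Fin 2 → ℂ) (a : Fin 7 → ℝ) :
    evalLin z a = MvPolynomial.aeval z (bform 6 a) := rfl

lemma evalLin_surjective {z : Fin 2 → ℂ} (hz : cross z (star z) ≠ 0) :
    Function.Surjective (evalLin z) := by
  intro c
  obtain ⟨F, hF, h⟩ := exists_form_aeval_eq (d := 5) hz c
  exact ⟨coefs 6 F, by rw [evalLin_apply, bform_coefs hF, h]⟩

/-- It is enough to use sextics divisible by the real quadratic form with zeros `w`, `star w`. The
second term vanishes on them, and their quartic cofactor takes any value at the non-real point `z`.
-/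
lemma evalLin_sub_surjective {z w : Fin 2 → ℂ} (hz : cross z (star z) ≠ 0) (hzw : cross z w ≠ 0)
    (hzw' : cross z (star w) ≠ 0) {α β : ℂ} (hα : α ≠ 0) :
    Function.Surjective (LinearMap.mulLeft ℝ α ∘ₗ evalLin z - LinearMap.mulLeft ℝ β ∘ₗ evalLin w) := by
  intro c
  obtain ⟨N, hN, hN'⟩ := exists_quadratic w
  obtain ⟨f, hf, h⟩ := exists_form_aeval_eq (d := 3) hz (c / (α * (cross z w * cross z (star w))))
  refine ⟨coefs 6 (N * f), ?_⟩
  have hh : (N * f).IsHomogeneous 6 := hN.mul hf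
  simp only [LinearMap.sub_apply, LinearMap.comp_apply, LinearMap.mulLeft_apply, evalLin_apply,
    bform_coefs hh, map_mul, hN', h, cross_self]
  field_simp
  ring

/-! ### Real points -/

/-- After division by a nonzero coordinate the factor `c` cancels, so all ratios are real. -/
lemma isRealVec_of_star {ι : Type} {v : ι → ℂ} (hv : v ≠ 0) {c : ℂ} (h : star v = c • v) :
    IsRealVec v := by
  obtain ⟨i, hi⟩ := Function.ne_iff.mp hv
  have hi' : v i ≠ 0 := hi
  refine ⟨v i, hi', fun j => (v j / v i).re, ?_⟩
  have hj : ∀ j, (((v j / v i).re : ℝ) : ℂ) = v j / v i := by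
    intro j
    rw [← Complex.conj_eq_iff_re, map_div₀]
    have e1 : (starRingEnd ℂ) (v j) = c * v j := congrFun h j
    have e2 : (starRingEnd ℂ) (v i) = c * v i := congrFun h i
    have hc : c ≠ 0 := by
      rintro rfl
      rw [zero_mul] at e2
      exact hi' (by simpa using e2)
    rw [e1, e2, mul_div_mul_left _ _ hc]
  ext j
  simp only [Pi.smul_apply, cx, smul_eq_mul, hj]
  field_simp

lemma IsRealVec.smul {ι : Type} {v : ι → ℂ} (h : IsRealVec v) {c : ℂ} (hc : c ≠ 0) :
    IsRealVec (c • v) := by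
  obtain ⟨a, ha, r, rfl⟩ := h
  exact ⟨c * a, mul_ne_zero hc ha, r, by rw [smul_smul]⟩

lemma star_cx {ι : Type} (r : ι → ℝ) : star (cx r) = cx r := by
  ext i; simp [cx]

lemma cross_star_eq_zero_of_isRealVec {z : Fin 2 → ℂ} (h : IsRealVec z) : cross z (star z) = 0 := by
  obtain ⟨a, -, r, rfl⟩ := h
  rw [star_smul, star_cx, cross_smul, cross_self, mul_zero]

lemma cx_ne_zero {ι : Type} {r : ι → ℝ} (h : cx r ≠ 0) : r ≠ 0 := by
  rintro rfl; exact h (by ext; simp [cx])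

lemma cx_smul {ι : Type} (c : ℝ) (r : ι → ℝ) : cx (c • r) = (c : ℂ) • cx r := by
  ext; simp [cx]

lemma exists_real_ratio {ν : Fin 3 → Form} {d : ℕ} (hν : IsImmersed d ν) {x y : Fin 2 → ℝ}
    (h : IsDoublePair ν (cx x) (cx y)) : ∃ s : ℝ, s ≠ 0 ∧ rval ν x = s • rval ν y := by
  have hy := hν.val_ne_zero (ne_zero_of_cross_right h.1)
  obtain ⟨s, hs, hxy⟩ := exists_eq_smul_of_dependent
    (hν.val_ne_zero (ne_zero_of_cross_left h.1)) hy h.2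
  rw [val_cx] at hy
  rw [val_cx, val_cx] at hxy
  obtain ⟨i, hi⟩ := Function.ne_iff.mp (cx_ne_zero hy)
  have hi' : rval ν y i ≠ 0 := hi
  have hsr : s = ((rval ν x i / rval ν y i : ℝ) : ℂ) := by
    have := congrFun hxy i
    simp only [cx, Pi.smul_apply, smul_eq_mul] at this
    push_cast
    rw [this]
    have hic : (rval ν y i : ℂ) ≠ 0 := by exact_mod_cast hi'
    field_simp
  rw [hsr] at hxy hs
  refine ⟨rval ν x i / rval ν y i, by exact_mod_cast hs, ?_⟩
  ext j
  have := congrFun hxy j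
  simp only [cx, Pi.smul_apply, smul_eq_mul] at this ⊢
  exact_mod_cast this

/-- Real points of `P¹`. -/
abbrev RP1 := Projectivization ℝ (Fin 2 → ℝ)

lemma RP1.eq_of_cross {x y : RP1} (h : cross x.rep y.rep = 0) : x = y := by
  obtain ⟨c, hc, hxy⟩ := exists_smul_of_cross_eq_zero y.rep_nonzero x.rep_nonzero
    (by rw [cross_swap, h, neg_zero])
  rw [← x.mk_rep, ← y.mk_rep]
  exact (Projectivization.mk_eq_mk_iff' ℝ _ _ _ _).mpr ⟨c, hxy.symm⟩

lemma RP1.exists_rep {r : Fin 2 → ℝ} (hr : r ≠ 0) : ∃ (x : RP1) (c : ℝ), c ≠ 0 ∧ r = c • x.rep := by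
  obtain ⟨a, ha⟩ := Projectivization.exists_smul_eq_mk_rep ℝ r hr
  refine ⟨Projectivization.mk ℝ r hr, ((a⁻¹ : ℝˣ) : ℝ), (a⁻¹).ne_zero, ?_⟩
  rw [← ha, ← Units.smul_def, inv_smul_smul]

lemma exists_rep_of_isRealVec {z : Fin 2 → ℂ} (hz : z ≠ 0) (h : IsRealVec z) :
    ∃ (x : RP1) (c : ℂ), c ≠ 0 ∧ z = c • cx x.rep := by
  obtain ⟨a, ha, r, rfl⟩ := h
  obtain ⟨x, c, hc, rfl⟩ := RP1.exists_rep (cx_ne_zero (right_ne_zero_of_smul hz))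
  exact ⟨x, a * c, mul_ne_zero ha (by exact_mod_cast hc), by rw [cx_smul, smul_smul]⟩

/-! ### Polarization of real quadratic forms -/

/-- The vector `x` turned by a right angle in the positive direction. -/
def perp (x : Fin 2 → ℝ) : Fin 2 → ℝ := ![- x 1, x 0]

/-- The derivative of `q` at `u` in direction `v`. -/
def polar (q : Form) (u v : Fin 2 → ℝ) : ℝ :=
  v 0 * MvPolynomial.eval u (MvPolynomial.pderiv 0 q) +
    v 1 * MvPolynomial.eval u (MvPolynomial.pderiv 1 q)

lemma polar_bform (a : Fin 3 → ℝ) (u v : Fin 2 → ℝ) : polar (bform 2 a) u v =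
    2 * a 0 * (u 1 * v 1) + a 1 * (u 0 * v 1 + u 1 * v 0) + 2 * a 2 * (u 0 * v 0) := by
  simp [polar, bform, Fin.sum_univ_three, Derivation.leibniz, Derivation.leibniz_pow]
  ring

lemma eval_bform (d : ℕ) (a : Fin (d + 1) → ℝ) (x : Fin 2 → ℝ) :
    MvPolynomial.eval x (bform d a) = ∑ i, a i * (x 0 ^ (i : ℕ) * x 1 ^ (d - i)) := by
  simp [bform]

lemma eval_quadratic (a : Fin 3 → ℝ) (u : Fin 2 → ℝ) : MvPolynomial.eval u (bform 2 a) =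
    a 0 * u 1 ^ 2 + a 1 * (u 0 * u 1) + a 2 * u 0 ^ 2 := by
  simp [eval_bform, Fin.sum_univ_three]

lemma eval_combination {q : Form} (hq : q.IsHomogeneous 2) (s t : ℝ) (u v : Fin 2 → ℝ) :
    MvPolynomial.eval (s • u + t • v) q = s ^ 2 * MvPolynomial.eval u q + s * t * polar q u v +
      t ^ 2 * MvPolynomial.eval v q := by
  obtain ⟨a, rfl⟩ : ∃ a, q = bform 2 a := ⟨_, (bform_coefs hq).symm⟩
  rw [polar_bform, eval_quadratic, eval_quadratic, eval_quadratic]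
  simp only [Pi.add_apply, Pi.smul_apply, smul_eq_mul]
  ring

lemma polar_symm {q : Form} (hq : q.IsHomogeneous 2) (u v : Fin 2 → ℝ) :
    polar q u v = polar q v u := by
  obtain ⟨a, rfl⟩ : ∃ a, q = bform 2 a := ⟨_, (bform_coefs hq).symm⟩
  rw [polar_bform, polar_bform]
  ring

lemma polar_smul_right (q : Form) (u v : Fin 2 → ℝ) (c : ℝ) :
    polar q u (c • v) = c * polar q u v := by
  simp only [polar, Pi.smul_apply, smul_eq_mul]; ring

lemma cross_perp_pos {x : Fin 2 → ℝ} (hx : x ≠ 0) : 0 < cross x (perp x) := by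
  have h : cross x (perp x) = x 0 ^ 2 + x 1 ^ 2 := by simp [cross, perp]; ring
  rw [h]
  by_contra! hle
  have h0 : x 0 = 0 := by nlinarith [sq_nonneg (x 0), sq_nonneg (x 1)]
  have h1 : x 1 = 0 := by nlinarith [sq_nonneg (x 0), sq_nonneg (x 1)]
  exact hx (by ext i; fin_cases i <;> simp [h0, h1])

/-- At a zero `u` of `q`, the derivative in direction `v` is proportional to `cross u v`. -/
lemma polar_of_eval_eq_zero {q : Form} (hq : q.IsHomogeneous 2) {u : Fin 2 → ℝ}
    (hu : MvPolynomial.eval u q = 0) (v : Fin 2 → ℝ) :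
    cross u (perp u) * polar q u v = cross u v * polar q u (perp u) := by
  obtain ⟨a, rfl⟩ : ∃ a, q = bform 2 a := ⟨_, (bform_coefs hq).symm⟩
  rw [eval_quadratic] at hu
  rw [polar_bform, polar_bform]
  simp [cross, perp]
  linear_combination (2 * (u 1 * v 1 + u 0 * v 0)) * hu

lemma polar_perp_ne_zero {q : Form} (hq : q.IsHomogeneous 2)
    (hred : ∀ z : Fin 2 → ℂ, z ≠ 0 → MvPolynomial.aeval z q = 0 →
      ∃ j, MvPolynomial.aeval z (MvPolynomial.pderiv j q) ≠ 0)
    {u : Fin 2 → ℝ} (hu0 : u ≠ 0) (hu : MvPolynomial.eval u q = 0) : polar q u (perp u) ≠ 0 := by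
  intro h
  have h1 : ∀ v, polar q u v = 0 := by
    intro v
    have := polar_of_eval_eq_zero hq hu v
    rw [h, mul_zero] at this
    exact (mul_eq_zero.mp this).resolve_left (cross_perp_pos hu0).ne'
  obtain ⟨j, hj⟩ := hred (cx u) (fun h => hu0 (by
    ext i; simpa [cx] using congrFun h i)) (by rw [aeval_cx, hu, Complex.ofReal_zero])
  rw [aeval_cx] at hj
  apply hj
  have h0 := h1 ![1, 0]
  have h1 := h1 ![0, 1]
  simp [polar] at h0 h1
  fin_cases j
  · simpa using h0
  · simpa using h1

/-! ### Signs at the marked points -/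

namespace VirtualNodalDiagram

open Classical in
/-- The sign of `F` at a marked point that is required by `τ`. -/
def signAt (V : VirtualNodalDiagram) (x : V.Marked) : ℝ :=
  ((V.τ x : ℤ) : ℝ) * if MvPolynomial.eval x.1.rep V.q = 0 then polar V.q x.1.rep (perp x.1.rep)
    else MvPolynomial.eval x.1.rep V.q

lemma unit_ne_zero (c : ℤˣ) : ((c : ℤ) : ℝ) ≠ 0 := by
  rcases Int.units_eq_one_or c with rfl | rfl <;> simp

lemma signAt_ne_zero (V : VirtualNodalDiagram) (x : V.Marked) : V.signAt x ≠ 0 := by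
  refine mul_ne_zero (unit_ne_zero _) ?_
  split_ifs with h
  · exact polar_perp_ne_zero V.q_homogeneous V.q_reduced x.1.rep_nonzero h
  · exact h

lemma eventually_pos_iff {l : Filter ℝ} [l.NeBot] {f : ℝ → ℝ} {L : ℝ} (hL : L ≠ 0)
    (hf : Tendsto f l (𝓝 L)) : (∀ᶠ e in l, 0 < f e) ↔ 0 < L := by
  constructor
  · intro h
    exact lt_of_le_of_ne (ge_of_tendsto hf (h.mono fun _ => le_of_lt)) hL.symm
  · intro h
    exact hf.eventually (lt_mem_nhds h)

lemma continuous_eval_form (F : Form) : Continuous fun x : Fin 2 → ℝ => MvPolynomial.eval x F := by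
  simp_rw [MvPolynomial.eval_eq']
  fun_prop

/-- The height has the sign of `q F`. Just after a zero `u` of `q` the value of `q` is `ε` times a
quantity tending to its derivative along `perp u`; elsewhere it tends to `q(u)`. -/
lemma tau_iff (V : VirtualNodalDiagram) {F : Form} (x : V.Marked)
    (hF : MvPolynomial.eval x.1.rep F ≠ 0) :
    (∀ᶠ ε in 𝓝[>] (0 : ℝ), 0 < ((V.τ x : ℤ) : ℝ) *
      height V.q F (x.1.rep + ε • ![- x.1.rep 1, x.1.rep 0])) ↔
      0 < V.signAt x * MvPolynomial.eval x.1.rep F := by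
  set u := x.1.rep with hu
  change (∀ᶠ ε in 𝓝[>] (0 : ℝ), 0 < ((V.τ x : ℤ) : ℝ) * height V.q F (u + ε • perp u)) ↔ _
  have hpath : Tendsto (fun ε : ℝ => u + ε • perp u) (𝓝[>] 0) (𝓝 u) := by
    have : Continuous fun ε : ℝ => u + ε • perp u := by fun_prop
    have := this.tendsto 0
    simp only [zero_smul, add_zero] at this
    exact this.mono_left nhdsWithin_le_nhds
  have hFlim := ((continuous_eval_form F).tendsto u).comp hpath
  have hq : ∀ ε : ℝ, MvPolynomial.eval (u + ε • perp u) V.q = MvPolynomial.eval u V.q +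
      ε * (polar V.q u (perp u) + ε * MvPolynomial.eval (perp u) V.q) := by
    intro ε
    have := eval_combination V.q_homogeneous 1 ε u (perp u)
    rw [one_smul] at this
    rw [this]; ring
  -- Both cases at once: `q` along the half-arc is a positive factor (`ε` or 1) times a function
  -- with nonzero limit.
  have main : ∀ (g : ℝ → ℝ) (g₀ : ℝ), V.signAt x = ((V.τ x : ℤ) : ℝ) * g₀ → Tendsto g (𝓝[>] 0) (𝓝 g₀) →
      (∀ᶠ ε in 𝓝[>] (0 : ℝ), ∃ r > 0, MvPolynomial.eval (u + ε • perp u) V.q = r * g ε) →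
      ((∀ᶠ ε in 𝓝[>] (0 : ℝ), 0 < ((V.τ x : ℤ) : ℝ) * height V.q F (u + ε • perp u)) ↔
        0 < V.signAt x * MvPolynomial.eval u F) := by
    intro g g₀ h1 h2 h3
    rw [← eventually_pos_iff (l := 𝓝[>] (0 : ℝ)) (mul_ne_zero (V.signAt_ne_zero x) hF)
      (f := fun ε => ((V.τ x : ℤ) : ℝ) * g ε * MvPolynomial.eval (u + ε • perp u) F)
      (by rw [h1]; exact (h2.const_mul _).mul hFlim)]
    apply eventually_congr
    filter_upwards [h3] with ε hr
    obtain ⟨r, hr, hq⟩ := hr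
    rw [height, hq, ← mul_div_assoc, mul_comm r, ← div_div, div_pos_iff_of_pos_right hr,
      div_pos_iff, mul_right_comm,
      mul_pos_iff (b := g ε)]
  by_cases h0 : MvPolynomial.eval u V.q = 0
  · refine main (fun ε => polar V.q u (perp u) + ε * MvPolynomial.eval (perp u) V.q)
      (polar V.q u (perp u)) (by rw [signAt, if_pos h0]) ?_ ?_
    · have : Continuous fun ε : ℝ => polar V.q u (perp u) + ε * MvPolynomial.eval (perp u) V.q := by
        fun_prop
      have := this.tendsto 0
      simp only [zero_mul, add_zero] at this
      exact this.mono_left nhdsWithin_le_nhds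
    · filter_upwards [eventually_mem_nhdsWithin (a := (0 : ℝ))] with ε hε
      exact ⟨ε, hε, by rw [hq, h0, zero_add]⟩
  · refine main (fun ε => MvPolynomial.eval (u + ε • perp u) V.q) (MvPolynomial.eval u V.q)
      (by rw [signAt, if_neg h0]) (((continuous_eval_form V.q).tendsto u).comp hpath) ?_
    exact Eventually.of_forall fun ε => ⟨1, one_pos, by rw [one_mul]⟩

/-- The marked points are finite in number. -/
lemma finite_marked (V : VirtualNodalDiagram) : Finite V.Marked := by
  classical
  obtain ⟨P, hP, hP'⟩ := V.nodal.exists_finset (by norm_num)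
  obtain ⟨x, y, k, hxy⟩ := exists_quadraticZeros V.q_homogeneous V.q_reduced
  set T : Finset (Fin 2 → ℂ) := P.image Prod.fst ∪ {x, y} with hT
  have hT0 : ∀ u ∈ T, u ≠ 0 := by
    intro u hu
    simp only [hT, Finset.mem_union, Finset.mem_image, Finset.mem_insert, Finset.mem_singleton] at hu
    rcases hu with ⟨p, hp, rfl⟩ | rfl | rfl
    · exact ne_zero_of_cross_left (hP p hp).1
    · exact ne_zero_of_cross_left hxy.cross_ne_zero
    · exact ne_zero_of_cross_right hxy.cross_ne_zero
  have hcov : ∀ m : V.Marked, ∃ u ∈ T, cross u (cx m.1.rep) = 0 := by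
    rintro ⟨m, hm | ⟨m', hm⟩⟩
    · have : MvPolynomial.aeval (cx m.rep) V.q = 0 := by rw [aeval_cx, hm, Complex.ofReal_zero]
      rw [hxy.aeval_eq_zero_iff] at this
      rcases this with h | h
      · exact ⟨x, by simp [hT], by rw [cross_swap, h, neg_zero]⟩
      · exact ⟨y, by simp [hT], by rw [cross_swap, h, neg_zero]⟩
    · obtain ⟨p, hp, h1, -⟩ := hP' _ _ hm
      exact ⟨p.1, by simp only [hT, Finset.mem_union, Finset.mem_image]; exact Or.inl ⟨p, hp, rfl⟩, h1⟩
  choose f hf hf' using hcov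
  refine Finite.of_injective (fun m => (⟨f m, hf m⟩ : T)) fun m m' h => ?_
  have h' : f m = f m' := congrArg Subtype.val h
  have cx0 : ∀ m : V.Marked, cx m.1.rep ≠ 0 := fun m h =>
    m.1.rep_nonzero (by ext i; simpa [cx] using congrFun h i)
  obtain ⟨c, -, hc⟩ := exists_smul_of_cross_eq_zero (hT0 _ (hf m)) (cx0 m) (hf' m)
  obtain ⟨c', -, hc'⟩ := exists_smul_of_cross_eq_zero (hT0 _ (hf m')) (cx0 m') (hf' m')
  apply Subtype.ext
  apply RP1.eq_of_cross
  have : cross (cx m.1.rep) (cx m'.1.rep) = 0 := by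
    rw [hc, hc', h', cross_smul, cross_self, mul_zero]
  rw [cross_cx] at this
  exact_mod_cast this

/-! ### The space of realizing height forms -/

/-- Two points over a node coincide if and only if a linear functional of `F` vanishes. -/
lemma isDoublePair_lift_iff {ν : Fin 3 → Form} (hν : IsImmersed 4 ν) {q F : Form}
    {z w : Fin 2 → ℂ} (hq : MvPolynomial.aeval w q ≠ 0) (h : IsDoublePair ν z w) {s : ℂ}
    (hs : val ν z = s • val ν w) :
    IsDoublePair (lift ν q F) z w ↔ MvPolynomial.aeval w q * MvPolynomial.aeval z F -
      s * MvPolynomial.aeval z q * MvPolynomial.aeval w F = 0 := by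
  constructor
  · intro hd
    obtain ⟨i, hi⟩ := Function.ne_iff.mp (hν.val_ne_zero (ne_zero_of_cross_right h.1))
    have hi' : val ν w i ≠ 0 := hi
    have m := fun j => minor_eq_zero hd.2 j 3
    rw [val_lift, val_lift, hs] at m
    have m0 := m 0
    have m1 := m 1
    have m2 := m 2
    simp only [Matrix.cons_val, Pi.smul_apply, smul_eq_mul] at m0 m1 m2
    have key : ∀ i, val ν w i * (MvPolynomial.aeval w q * MvPolynomial.aeval z F -
        s * MvPolynomial.aeval z q * MvPolynomial.aeval w F) = 0 := by
      refine Fin.forall_fin_succ.mpr ⟨?_, Fin.forall_fin_two.mpr ⟨?_, ?_⟩⟩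
      · linear_combination -m0
      · change val ν w 1 * _ = 0
        linear_combination -m1
      · change val ν w 2 * _ = 0
        linear_combination -m2
    exact (mul_eq_zero.mp (key i)).resolve_left hi'
  · intro h0
    refine ⟨h.1, fun hi => hq ?_⟩
    have := LinearIndependent.pair_iff.mp hi (MvPolynomial.aeval w q)
      (-(s * MvPolynomial.aeval z q)) (by
        rw [val_lift, val_lift, hs]
        apply vec4_ext <;> simp
        · ring
        · ring
        · ring
        · linear_combination h0)
    exact this.1

/-- Realizing forms are described by signs at the marked points, by the separation of the imaginary
nodes and by the condition that `D⁺` avoids `D⁻`. -/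
lemma isRealizedBy_iff (V : VirtualNodalDiagram) (hV : AllRealNodesHyperbolic V.ν)
    {x y : Fin 2 → ℂ} {k : ℂ} (hxy : QuadraticZeros V.q x y k) {F : Form} (hF : F.IsHomogeneous 6) :
    V.IsRealizedBy F ↔
      (∀ m : V.Marked, 0 < V.signAt m * MvPolynomial.eval m.1.rep F) ∧
      (∀ z w, IsDoublePair V.ν z w → ¬ IsRealVec (val V.ν z) → ¬ IsDoublePair (lift V.ν V.q F) z w) ∧
      (y = star x → MvPolynomial.aeval x F ≠ 0) := by
  have hν := V.nodal.toIsImmersed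
  have cx0 : ∀ m : RP1, cx m.rep ≠ 0 := fun m h =>
    m.rep_nonzero (by ext i; simpa [cx] using congrFun h i)
  have hx0 := ne_zero_of_cross_left hxy.cross_ne_zero
  constructor
  · intro h
    have hg := (V.isNodalDiagram_iff F).mp h.diagram
    refine ⟨fun m => ?_, fun z w hzw _ => hg.separated z w hzw, fun _ => hg.disjoint x hx0 hxy.left⟩
    rw [← tau_iff V m]
    · exact h.tau m
    · intro h0
      rcases m.2 with hm | ⟨m', hm⟩
      · refine hg.disjoint (cx m.1.rep) (cx0 _) ?_ ?_
        · rw [aeval_cx, hm, Complex.ofReal_zero]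
        · rw [aeval_cx, h0, Complex.ofReal_zero]
      · obtain ⟨s, -, hs⟩ := exists_real_ratio hν hm
        have := h.explicit _ _ s hm hs
        simp [height, h0] at this
  · rintro ⟨h1, h2, h3⟩
    have hF0 : ∀ m : V.Marked, MvPolynomial.eval m.1.rep F ≠ 0 := by
      intro m h; have := h1 m; rw [h, mul_zero] at this; exact lt_irrefl _ this
    have hsign : ∀ m : V.Marked, MvPolynomial.eval m.1.rep V.q ≠ 0 →
        0 < ((V.τ m : ℤ) : ℝ) * height V.q F m.1.rep := by
      intro m hm
      have := h1 m
      rw [signAt, if_neg hm] at this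
      rw [height, ← mul_div_assoc, div_pos_iff, ← mul_pos_iff]
      linarith
    have hnode : ∀ {X Y : RP1}, IsDoublePair V.ν (cx X.rep) (cx Y.rep) →
        ∀ s : ℝ, rval V.ν X.rep = s • rval V.ν Y.rep →
        MvPolynomial.eval X.rep V.q ≠ 0 ∧ MvPolynomial.eval Y.rep V.q ≠ 0 ∧
        s * height V.q F X.rep * height V.q F Y.rep < 0 := by
      intro X Y hd s hs
      have hqX : MvPolynomial.eval X.rep V.q ≠ 0 := by
        have := V.q_avoids_nodes _ _ hd
        rw [aeval_cx] at this; exact_mod_cast this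
      have hqY : MvPolynomial.eval Y.rep V.q ≠ 0 := by
        have := V.q_avoids_nodes _ _ hd.symm
        rw [aeval_cx] at this; exact_mod_cast this
      refine ⟨hqX, hqY, ?_⟩
      have hX := hsign ⟨X, Or.inr ⟨Y, hd⟩⟩ hqX
      have hY := hsign ⟨Y, Or.inr ⟨X, hd.symm⟩⟩ hqY
      have hou := V.τ_over_under ⟨X, Or.inr ⟨Y, hd⟩⟩ ⟨Y, Or.inr ⟨X, hd.symm⟩⟩ s hd hs
      set tX : ℝ := ((V.τ ⟨X, Or.inr ⟨Y, hd⟩⟩ : ℤ) : ℝ)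
      set tY : ℝ := ((V.τ ⟨Y, Or.inr ⟨X, hd.symm⟩⟩ : ℤ) : ℝ)
      have hpos := mul_pos hX hY
      have htt : tX ^ 2 * tY ^ 2 = 1 := by
        have e1 : ∀ c : ℤˣ, ((c : ℤ) : ℝ) ^ 2 = 1 := by
          intro c; rcases Int.units_eq_one_or c with rfl | rfl <;> simp
        rw [e1, e1, one_mul]
      -- Since the squares of the signs are 1, the height product is the over/under product times
      -- two positive numbers, and `τ_over_under` makes it negative.
      have e : s * height V.q F X.rep * height V.q F Y.rep =
          (s * tX * tY) * (tX * height V.q F X.rep * (tY * height V.q F Y.rep)) := by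
        linear_combination -(s * height V.q F X.rep * height V.q F Y.rep) * htt
      rw [e]
      exact mul_neg_of_neg_of_pos hou hpos
    refine ⟨(V.isNodalDiagram_iff F).mpr ⟨hF, ?_, ?_⟩, ?_, fun m => (V.tau_iff m (hF0 m)).mpr (h1 m), ?_⟩
    · intro z hz hqz hFz
      have real : ∀ u : Fin 2 → ℂ, u ≠ 0 → star u = u → MvPolynomial.aeval u V.q = 0 →
          MvPolynomial.aeval u F ≠ 0 := by
        intro u hu hru hqu hFu
        obtain ⟨X, c, hc, rfl⟩ := exists_rep_of_isRealVec hu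
          (isRealVec_of_star hu (c := 1) (by rw [one_smul, hru]))
        rw [aeval_smul V.q_homogeneous, aeval_cx] at hqu
        rw [aeval_smul hF, aeval_cx] at hFu
        simp [hc] at hqu hFu
        exact hF0 ⟨X, Or.inl hqu⟩ hFu
      have hxF : MvPolynomial.aeval x F ≠ 0 := by
        rcases hxy.real with ⟨e1, -⟩ | e
        · exact real x hx0 e1 hxy.left
        · exact h3 e
      have hyF : MvPolynomial.aeval y F ≠ 0 := by
        rcases hxy.real with ⟨-, e2⟩ | e
        · exact real y (ne_zero_of_cross_right hxy.cross_ne_zero) e2 hxy.right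
        · rw [e, aeval_star]; exact star_ne_zero.mpr hxF
      rcases (hxy.aeval_eq_zero_iff z).mp hqz with h | h
      · obtain ⟨c, hc, rfl⟩ := exists_smul_of_cross_eq_zero hz hx0 h
        rw [aeval_smul hF, hFz, mul_zero] at hxF
        exact hxF rfl
      · obtain ⟨c, hc, rfl⟩ := exists_smul_of_cross_eq_zero hz
          (ne_zero_of_cross_right hxy.cross_ne_zero) h
        rw [aeval_smul hF, hFz, mul_zero] at hyF
        exact hyF rfl
    · intro z w hzw hlift
      by_cases hr : IsRealVec (val V.ν z)
      · obtain ⟨rz, rw'⟩ := hV z w hzw hr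
        obtain ⟨X, a, ha, rfl⟩ := exists_rep_of_isRealVec (ne_zero_of_cross_left hzw.1) rz
        obtain ⟨Y, b, hb, rfl⟩ := exists_rep_of_isRealVec (ne_zero_of_cross_right hzw.1) rw'
        rw [isDoublePair_smul hν.homogeneous ha hb] at hzw
        rw [isDoublePair_smul (isHomogeneous_lift hν.homogeneous V.q_homogeneous hF) ha hb] at hlift
        obtain ⟨s, hs0, hs⟩ := exists_real_ratio hν hzw
        obtain ⟨hX, hY, hneg⟩ := hnode hzw s hs
        rw [isDoublePair_lift_iff hν (s := (s : ℂ)) (by rw [aeval_cx]; exact_mod_cast hY) hzw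
          (by rw [val_cx, val_cx, hs, cx_smul])] at hlift
        simp only [aeval_cx] at hlift
        have hreal : MvPolynomial.eval Y.rep V.q * MvPolynomial.eval X.rep F -
          s * MvPolynomial.eval X.rep V.q * MvPolynomial.eval Y.rep F = 0 := by exact_mod_cast hlift
        have : height V.q F X.rep = s * height V.q F Y.rep := by
          simp only [height]; field_simp; linear_combination hreal
        rw [this] at hneg
        nlinarith [sq_nonneg (s * height V.q F Y.rep)]
      · exact h2 z w hzw hr hlift
    · intro u v s huv hs
      obtain ⟨X, a, ha, rfl⟩ := RP1.exists_rep (cx_ne_zero (ne_zero_of_cross_left huv.1))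
      obtain ⟨Y, b, hb, rfl⟩ := RP1.exists_rep (cx_ne_zero (ne_zero_of_cross_right huv.1))
      rw [cx_smul, cx_smul, isDoublePair_smul hν.homogeneous (by exact_mod_cast ha)
        (by exact_mod_cast hb)] at huv
      rw [rval_smul hν.homogeneous, rval_smul hν.homogeneous] at hs
      -- The ratio `s` for arbitrary representatives becomes this one for the chosen ones; `height`
      -- is homogeneous of degree 4, so the change of sign condition is by the positive factor `a ^
      -- 8`.
      obtain ⟨hX, hY, hneg⟩ := hnode huv ((a ^ 4)⁻¹ * (s * b ^ 4)) (by
        rw [mul_smul, mul_smul, ← hs, inv_smul_smul₀ (pow_ne_zero 4 ha)])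
      have hh : ∀ (r : ℝ) (u : Fin 2 → ℝ), r ≠ 0 → height V.q F (r • u) = r ^ 4 * height V.q F u := by
        intro r u hr
        rw [height, height, eval_smul hF, eval_smul V.q_homogeneous, mul_div_mul_comm]
        congr 1
        field_simp
      rw [hh a _ ha, hh b _ hb]
      have e : s * (a ^ 4 * height V.q F X.rep) * (b ^ 4 * height V.q F Y.rep) =
          a ^ 8 * ((a ^ 4)⁻¹ * (s * b ^ 4) * height V.q F X.rep * height V.q F Y.rep) := by
        field_simp
      rw [e]
      exact mul_neg_of_pos_of_neg (by positivity) hneg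
    -- The sign condition at elliptic nodes is void: such a node would be a real node, so its
    -- branches would be real, yet they form a conjugate pair of distinct points.
    · rintro u z hz ⟨a, ha⟩
      exfalso
      have hne := hν.val_ne_zero (ne_zero_of_cross_left hz.1)
      have ha0 : a ≠ 0 := by rintro rfl; rw [zero_smul] at ha; exact hne ha
      exact hz.1 (cross_star_eq_zero_of_isRealVec (hV z _ hz ⟨a, ha0, _, ha⟩).1)

/-- The coefficients of the realizing forms. -/
def realizers (V : VirtualNodalDiagram) : Set (Fin 7 → ℝ) := {a | V.IsRealizedBy (bform 6 a)}

/-- The coefficients of the forms with the required signs at the marked points. -/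
def signed (V : VirtualNodalDiagram) : Set (Fin 7 → ℝ) :=
  {a | ∀ m : V.Marked, 0 < V.signAt m * MvPolynomial.eval m.1.rep (bform 6 a)}

lemma isOpen_signed (V : VirtualNodalDiagram) : IsOpen V.signed := by
  have := V.finite_marked
  have e : V.signed = ⋂ m : V.Marked, {a | 0 < V.signAt m * MvPolynomial.eval m.1.rep (bform 6 a)} := by
    ext; simp [signed]
  rw [e]
  refine isOpen_iInter_of_finite fun m => isOpen_lt continuous_const ?_
  simp_rw [eval_bform]
  fun_prop

lemma convex_signed (V : VirtualNodalDiagram) : Convex ℝ V.signed := by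
  intro a ha b hb r s hr hs hrs m
  have h1 := ha m
  have h2 := hb m
  rw [bform_add, bform_smul, bform_smul, map_add, MvPolynomial.smul_eval, MvPolynomial.smul_eval]
  set A := V.signAt m * MvPolynomial.eval m.1.rep (bform 6 a)
  set B := V.signAt m * MvPolynomial.eval m.1.rep (bform 6 b)
  have e : V.signAt m * (r * MvPolynomial.eval m.1.rep (bform 6 a) +
    s * MvPolynomial.eval m.1.rep (bform 6 b)) = r * A + s * B := by ring
  rw [e]
  rcases hr.lt_or_eq with hr | rfl
  · have := mul_pos hr h1
    have := mul_nonneg hs h2.le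
    linarith
  · have : s = 1 := by linarith
    subst this
    linarith

/-- The realizing forms are the forms with the required signs outside finitely many subspaces of
codimension two. -/
lemma exists_realizers_eq (V : VirtualNodalDiagram) (hV : AllRealNodesHyperbolic V.ν) :
    ∃ (I : Type) (_ : Finite I) (l : I → (Fin 7 → ℝ) →ₗ[ℝ] ℂ), (∀ i, Function.Surjective (l i)) ∧
      V.realizers = {a | a ∈ V.signed ∧ ∀ i, l i a ≠ 0} := by
  have hν := V.nodal.toIsImmersed
  obtain ⟨P, hP, hP'⟩ := V.nodal.exists_finset (by norm_num)
  obtain ⟨x, y, k, hxy⟩ := exists_quadraticZeros V.q_homogeneous V.q_reduced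
  have hx0 := ne_zero_of_cross_left hxy.cross_ne_zero
  have hratio : ∀ p : P, ∃ s : ℂ, s ≠ 0 ∧ val V.ν p.1.1 = s • val V.ν p.1.2 := fun p =>
    exists_eq_smul_of_dependent (hν.val_ne_zero (ne_zero_of_cross_left (hP p.1 p.2).1))
      (hν.val_ne_zero (ne_zero_of_cross_right (hP p.1 p.2).1)) (hP p.1 p.2).2
  choose s hs0 hs using hratio
  -- One functional for each listed double pair over a non-real node, and one more exactly when `D⁻`
  -- is a conjugate pair.
  refine ⟨{p : P // ¬ IsRealVec (val V.ν p.1.1)} ⊕ PLift (y = star x), inferInstance,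
    Sum.elim (fun p => LinearMap.mulLeft ℝ (MvPolynomial.aeval p.1.1.2 V.q) ∘ₗ evalLin p.1.1.1 -
      LinearMap.mulLeft ℝ (s p.1 * MvPolynomial.aeval p.1.1.1 V.q) ∘ₗ evalLin p.1.1.2)
      (fun _ => evalLin x), ?_, ?_⟩
  · rintro (⟨⟨⟨z, w⟩, hp⟩, hr⟩ | e)
    · have hd := hP _ hp
      have hz := ne_zero_of_cross_left hd.1
      have hw := ne_zero_of_cross_right hd.1
      have hvz := hν.val_ne_zero hz
      have h1 := hs ⟨⟨z, w⟩, hp⟩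
      have h0 := hs0 ⟨⟨z, w⟩, hp⟩
      -- If `z` were real, or conjugate to `w`, the node would be real.
      refine evalLin_sub_surjective ?_ hd.1 ?_ (V.q_avoids_nodes _ _ hd.symm)
      · intro hc
        obtain ⟨c, -, hc⟩ := exists_smul_of_cross_eq_zero hz (star_ne_zero.mpr hz) hc
        exact hr (isRealVec_of_star hvz (c := c ^ 4) (by
          rw [← val_star, hc, val_smul hν.homogeneous]))
      · intro hc
        obtain ⟨c, -, hc⟩ := exists_smul_of_cross_eq_zero hz (star_ne_zero.mpr hw) hc
        have : IsRealVec (val V.ν w) := isRealVec_of_star (hν.val_ne_zero hw) (c := c ^ 4 * s ⟨⟨z, w⟩, hp⟩) (by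
          rw [← val_star, hc, val_smul hν.homogeneous, mul_smul, ← h1])
        apply hr
        change IsRealVec (val V.ν z)
        rw [h1]
        exact this.smul h0
    · have := hxy.cross_ne_zero
      rw [e.down] at this
      exact evalLin_surjective this
  · ext a
    have hlin : ∀ p : P, (MvPolynomial.aeval p.1.2 V.q * MvPolynomial.aeval p.1.1 (bform 6 a) -
        s p * MvPolynomial.aeval p.1.1 V.q * MvPolynomial.aeval p.1.2 (bform 6 a) ≠ 0 ↔
        ¬ IsDoublePair (lift V.ν V.q (bform 6 a)) p.1.1 p.1.2) := fun p =>
      (isDoublePair_lift_iff hν (V.q_avoids_nodes _ _ (hP p.1 p.2).symm) (hP p.1 p.2) (hs p)).not.symm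
    have hhom := isHomogeneous_bform 6 a
    rw [realizers, Set.mem_ofPred_eq, isRealizedBy_iff V hV hxy hhom]
    constructor
    · rintro ⟨h1, h2, h3⟩
      refine ⟨h1, ?_⟩
      rintro (⟨p, hr⟩ | e)
      · exact (hlin p).mpr (h2 _ _ (hP p.1 p.2) hr)
      · exact h3 e.down
    · rintro ⟨h1, h2⟩
      refine ⟨h1, fun z w hzw hr hd => ?_, fun e => h2 (Sum.inr ⟨e⟩)⟩
      obtain ⟨p, hp, e1, e2⟩ := hP' z w hzw
      obtain ⟨b, hb, rfl⟩ := exists_smul_of_cross_eq_zero (ne_zero_of_cross_left (hP p hp).1)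
        (ne_zero_of_cross_left hzw.1) e1
      obtain ⟨c, hc, rfl⟩ := exists_smul_of_cross_eq_zero (ne_zero_of_cross_right (hP p hp).1)
        (ne_zero_of_cross_right hzw.1) e2
      rw [isDoublePair_smul (isHomogeneous_lift hν.homogeneous V.q_homogeneous hhom) hb hc] at hd
      refine (hlin ⟨p, hp⟩).mp (h2 (Sum.inl ⟨⟨p, hp⟩, fun h => hr ?_⟩)) hd
      rw [val_smul hν.homogeneous]
      exact h.smul (pow_ne_zero 4 hb)

lemma isPreconnected_realizers (V : VirtualNodalDiagram) (hV : AllRealNodesHyperbolic V.ν) :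
    IsPreconnected V.realizers := by
  obtain ⟨I, hI, l, hl, h⟩ := V.exists_realizers_eq hV
  rw [h]
  exact isPreconnected_compl_kernels V.isOpen_signed V.convex_signed hl

lemma realizers_nonempty_iff (V : VirtualNodalDiagram) (hV : AllRealNodesHyperbolic V.ν) :
    V.realizers.Nonempty ↔ V.signed.Nonempty := by
  obtain ⟨I, hI, l, hl, h⟩ := V.exists_realizers_eq hV
  rw [h]
  exact ⟨fun ⟨a, ha⟩ => ⟨a, ha.1⟩, fun hne => nonempty_compl_kernels V.isOpen_signed hne hl⟩

lemma exists_isRealizedBy_iff (V : VirtualNodalDiagram) (hV : AllRealNodesHyperbolic V.ν) :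
    (∃ F, V.IsRealizedBy F) ↔ V.signed.Nonempty := by
  rw [← V.realizers_nonempty_iff hV]
  constructor
  · rintro ⟨F, hF⟩
    exact ⟨coefs 6 F, by rw [realizers, Set.mem_ofPred_eq, bform_coefs hF.diagram.homogeneous]; exact hF⟩
  · rintro ⟨a, ha⟩
    exact ⟨_, ha⟩

end VirtualNodalDiagram

/-! ### Zeros of real forms -/

lemma cross_rep_ne_zero {x y : RP1} (h : x ≠ y) : cross x.rep y.rep ≠ 0 :=
  fun h' => h (RP1.eq_of_cross h')

lemma cross_add_smul_right {R : Type} [CommRing R] (x u v : Fin 2 → R) (s t : R) :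
    cross x (s • u + t • v) = s * cross x u + t * cross x v := by
  simp [cross]; ring

lemma cross_add_smul_left {R : Type} [CommRing R] (x u v : Fin 2 → R) (s t : R) :
    cross (s • u + t • v) x = s * cross u x + t * cross v x := by
  simp [cross]; ring

/-- A real form of degree `d` which is not identically zero has at most `d` real zeros. -/
lemma encard_zeros_le {d : ℕ} {F : Form} (hF : F.IsHomogeneous d) {u : Fin 2 → ℝ}
    (hu : MvPolynomial.eval u F ≠ 0) : {x : RP1 | MvPolynomial.eval x.rep F = 0}.encard ≤ d := by
  have hu0 : u ≠ 0 ∨ d = 0 := by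
    by_contra! h
    apply hu
    have := eval_smul hF 0 u
    rw [zero_smul, zero_pow h.2, zero_mul] at this
    rw [h.1]; exact this
  rcases hu0 with hu0 | rfl
  swap
  · have hs : {x : RP1 | MvPolynomial.eval x.rep F = 0} = ∅ := by
      ext x
      simp only [Set.mem_ofPred_eq, Set.mem_empty_iff_false, iff_false]
      intro hx
      apply hu
      rw [← bform_coefs hF, eval_bform] at hx ⊢
      simpa using hx
    rw [hs]; simp
  have hN := cross_perp_pos hu0
  -- The affine chart `t ↦ t • u + perp u` omits only the point `u`, which is not a zero of `F`, so
  -- no zero is lost.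
  set P : Polynomial ℝ := ∑ i : Fin (d + 1), Polynomial.C (coefs d F i) *
    ((Polynomial.C (u 0) * Polynomial.X + Polynomial.C (perp u 0)) ^ (i : ℕ) *
      (Polynomial.C (u 1) * Polynomial.X + Polynomial.C (perp u 1)) ^ (d - i)) with hP
  have hPeval : ∀ t, P.eval t = MvPolynomial.eval (t • u + perp u) F := by
    intro t
    rw [← bform_coefs hF, eval_bform, hP, Polynomial.eval_finsetSum]
    refine Finset.sum_congr rfl fun i _ => ?_
    simp only [Polynomial.eval_mul, Polynomial.eval_C, Polynomial.eval_pow, Polynomial.eval_add,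
      Polynomial.eval_X, Pi.add_apply, Pi.smul_apply, smul_eq_mul, mul_comm t]
  have hdeg : P.natDegree ≤ d := by
    refine Polynomial.natDegree_sum_le_of_forall_le _ _ fun i _ => ?_
    refine (Polynomial.natDegree_C_mul_le _ _).trans ?_
    refine Polynomial.natDegree_mul_le.trans ?_
    have h1 := Polynomial.natDegree_pow_le_of_le (i : ℕ)
      (Polynomial.natDegree_linear_le (a := u 0) (b := perp u 0))
    have h2 := Polynomial.natDegree_pow_le_of_le (d - i : ℕ)
      (Polynomial.natDegree_linear_le (a := u 1) (b := perp u 1))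
    have := i.2
    omega
  have hP0 : P ≠ 0 := by
    intro h0
    have h1 : ∀ ε : ℝ, ε ≠ 0 → MvPolynomial.eval (u + ε • perp u) F = 0 := by
      intro ε hε
      have e : u + ε • perp u = ε • (ε⁻¹ • u + perp u) := by
        rw [smul_add, smul_inv_smul₀ hε]
      rw [e, eval_smul hF, ← hPeval, h0]
      simp
    have h2 : Tendsto (fun ε : ℝ => MvPolynomial.eval (u + ε • perp u) F) (𝓝[≠] 0)
        (𝓝 (MvPolynomial.eval u F)) := by
      have : Continuous fun ε : ℝ => MvPolynomial.eval (u + ε • perp u) F :=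
        (VirtualNodalDiagram.continuous_eval_form F).comp (by fun_prop)
      have := this.tendsto 0
      simp only [zero_smul, add_zero] at this
      exact this.mono_left nhdsWithin_le_nhds
    have h3 : Tendsto (fun ε : ℝ => MvPolynomial.eval (u + ε • perp u) F) (𝓝[≠] 0) (𝓝 0) :=
      tendsto_const_nhds.congr' (by
        filter_upwards [self_mem_nhdsWithin] with ε hε
        exact (h1 ε hε).symm)
    exact hu (tendsto_nhds_unique h2 h3)
  have hrep : ∀ x : RP1, MvPolynomial.eval x.rep F = 0 → cross u x.rep ≠ 0 := by
    intro x hx h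
    obtain ⟨c, hc, hx'⟩ := exists_smul_of_cross_eq_zero hu0 x.rep_nonzero h
    rw [hx', eval_smul hF] at hx
    simp [hc, hu] at hx
  have hexp : ∀ x : RP1, cross u x.rep ≠ 0 →
      x.rep = (cross u x.rep / cross u (perp u)) •
        ((cross x.rep (perp u) / cross u x.rep) • u + perp u) := by
    intro x hx
    conv_lhs => rw [cross_expand hN.ne' x.rep]
    rw [smul_add, smul_smul]
    congr 2
    field_simp
  have hmaps : Set.MapsTo (fun x : RP1 => cross x.rep (perp u) / cross u x.rep)
      {x : RP1 | MvPolynomial.eval x.rep F = 0} P.roots.toFinset := by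
    intro x hx
    have hx' := hrep x hx
    rw [Set.mem_ofPred_eq, hexp x hx', eval_smul hF] at hx
    simp only [SetLike.mem_coe, Multiset.mem_toFinset, Polynomial.mem_roots hP0, Polynomial.IsRoot]
    rw [hPeval]
    refine (mul_eq_zero.mp hx).resolve_left (pow_ne_zero _ (div_ne_zero hx' hN.ne'))
  have hinj : Set.InjOn (fun x : RP1 => cross x.rep (perp u) / cross u x.rep)
      {x : RP1 | MvPolynomial.eval x.rep F = 0} := by
    intro x hx y hy hxy
    apply RP1.eq_of_cross
    rw [hexp x (hrep x hx), hexp y (hrep y hy), cross_smul]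
    simp only at hxy
    rw [hxy, cross_self, mul_zero]
  calc {x : RP1 | MvPolynomial.eval x.rep F = 0}.encard ≤ (P.roots.toFinset : Set ℝ).encard :=
        Set.encard_le_encard_of_injOn hmaps hinj
    _ = (P.roots.toFinset.card : ℕ∞) := Set.encard_coe_eq_coe_finsetCard _
    _ ≤ d := by
        exact_mod_cast (Multiset.toFinset_card_le _).trans ((Polynomial.card_roots' P).trans hdeg)

lemma exists_zero_of_sign_change {f : ℝ → ℝ} (hf : Continuous f) (h : f 0 * f 1 < 0) :
    ∃ r, 0 < r ∧ r < 1 ∧ f r = 0 := by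
  have h0 : f 0 ≠ 0 := by intro h0; simp [h0] at h
  have h1 : f 1 ≠ 0 := by intro h1; simp [h1] at h
  have key : ∃ r ∈ Set.Icc (0 : ℝ) 1, f r = 0 := by
    rcases lt_or_gt_of_ne h0 with h0 | h0
    · have : 0 < f 1 := by by_contra! hle; nlinarith
      exact intermediate_value_Icc zero_le_one hf.continuousOn ⟨h0.le, this.le⟩
    · have : f 1 < 0 := by by_contra! hle; nlinarith
      exact intermediate_value_Icc' zero_le_one hf.continuousOn ⟨this.le, h0.le⟩
  obtain ⟨r, ⟨hr0, hr1⟩, hr⟩ := key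
  refine ⟨r, lt_of_le_of_ne hr0 ?_, lt_of_le_of_ne hr1 ?_, hr⟩
  · rintro rfl; exact h0 hr
  · rintro rfl; exact h1 hr

/-- A quadratic function without zeros has the same sign at the two ends of the interval. -/
lemma quadratic_end_signs {α β γ : ℝ}
    (h : ∀ r, 0 < r → r < 1 → (1 - r) ^ 2 * α + (1 - r) * r * β + r ^ 2 * γ ≠ 0)
    {p q : ℝ} (hp0 : p ≠ 0) (hq0 : q ≠ 0) (hp : (α = p) ∨ (α = 0 ∧ β = p))
    (hq : (γ = q) ∨ (γ = 0 ∧ β = q)) : 0 < p * q := by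
  by_contra! hle
  have hlt : p * q < 0 := lt_of_le_of_ne hle (mul_ne_zero hp0 hq0)
  -- If an end value vanishes, divide by `r` or `1 - r`: the intermediate value theorem then applies
  -- to a linear function. If both vanish, the two signs are those of the same number `β`.
  rcases hp with rfl | ⟨rfl, rfl⟩ <;> rcases hq with rfl | ⟨rfl, rfl⟩
  · obtain ⟨r, h0, h1, hr⟩ := exists_zero_of_sign_change
      (f := fun r => (1 - r) ^ 2 * α + (1 - r) * r * β + r ^ 2 * γ) (by fun_prop) (by simpa using hlt)
    exact h r h0 h1 hr
  · obtain ⟨r, h0, h1, hr⟩ := exists_zero_of_sign_change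
      (f := fun r => (1 - r) * α + r * β) (by fun_prop) (by simpa using hlt)
    exact h r h0 h1 (by linear_combination (1 - r) * hr)
  · obtain ⟨r, h0, h1, hr⟩ := exists_zero_of_sign_change
      (f := fun r => (1 - r) * β + r * γ) (by fun_prop) (by simpa using hlt)
    exact h r h0 h1 (by linear_combination r * hr)
  · nlinarith [sq_nonneg β]

namespace VirtualNodalDiagram

/-! ### Diagram arcs -/

/-- Each point occurs in two of the three determinants, so rescaling contributes only squares. -/
lemma between_iff {a z b : RP1} {u v w : Fin 2 → ℝ} {r s t : ℝ} (hr : r ≠ 0) (hs : s ≠ 0)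
    (ht : t ≠ 0) (ha : a.rep = r • u) (hz : z.rep = s • v) (hb : b.rep = t • w) :
    Between a z b ↔ 0 < cross u v * cross v w * cross u w := by
  rw [Between, ha, hz, hb, cross_smul, cross_smul, cross_smul]
  have e : r * s * cross u v * (s * t * cross v w) * (r * t * cross u w) =
      (r * s * t) ^ 2 * (cross u v * cross v w * cross u w) := by ring
  rw [e]
  have : 0 < (r * s * t) ^ 2 := by positivity
  exact mul_pos_iff_of_pos_left this

/-- The points of the open arc from `a` to `b`. -/
lemma exists_between {a b : RP1} (hab : a ≠ b) {r : ℝ} (h0 : 0 < r) (h1 : r < 1) :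
    ∃ (z : RP1) (c : ℝ), c ≠ 0 ∧ Between a z b ∧
      (1 - r) • a.rep + r • (cross a.rep b.rep • b.rep) = c • z.rep := by
  -- Multiplying `b.rep` by `cross a.rep b.rep` orients it so that the segment from `a.rep` projects
  -- to the positive arc rather than to the complementary one.
  have hc := cross_rep_ne_zero hab
  set u := a.rep
  set v := b.rep
  have h2 : 0 < r * (cross u v) ^ 2 := by positivity
  have hx : cross u ((1 - r) • u + r • (cross u v • v)) = r * (cross u v) ^ 2 := by
    rw [cross_add_smul_right, cross_self, cross_smul_right]; ring
  have hy : cross ((1 - r) • u + r • (cross u v • v)) v = (1 - r) * cross u v := by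
    rw [cross_add_smul_left, cross_smul_left, cross_self]; ring
  have hne : (1 - r) • u + r • (cross u v • v) ≠ 0 :=
    ne_zero_of_cross_right (z := u) (by rw [hx]; exact h2.ne')
  obtain ⟨z, c, hc0, hz⟩ := RP1.exists_rep hne
  refine ⟨z, c, hc0, ?_, hz⟩
  rw [between_iff (r := 1) (s := c⁻¹) (t := 1) one_ne_zero (inv_ne_zero hc0) one_ne_zero
    (one_smul _ _).symm (v := (1 - r) • u + r • (cross u v • v)) (by rw [hz, inv_smul_smul₀ hc0])
    (one_smul _ _).symm, hx, hy]
  have : r * cross u v ^ 2 * ((1 - r) * cross u v) * cross u v = r * (1 - r) * (cross u v ^ 2) ^ 2 := by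
    ring
  rw [this]
  have : 0 < 1 - r := by linarith
  positivity

/-- The sign of `q` just before a marked point. -/
lemma signAt_eq_before (V : VirtualNodalDiagram) (x : V.Marked) :
    ∃ p : ℝ, p ≠ 0 ∧ V.signAt x = ((V.τBefore x : ℤ) : ℝ) * p ∧
      (MvPolynomial.eval x.1.rep V.q = p ∨
        (MvPolynomial.eval x.1.rep V.q = 0 ∧ - polar V.q x.1.rep (perp x.1.rep) = p)) := by
  by_cases h : MvPolynomial.eval x.1.rep V.q = 0
  · refine ⟨-polar V.q x.1.rep (perp x.1.rep), neg_ne_zero.mpr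
      (polar_perp_ne_zero V.q_homogeneous V.q_reduced x.1.rep_nonzero h), ?_, Or.inr ⟨h, rfl⟩⟩
    rw [signAt, τBefore, if_pos h, if_pos h]
    push_cast
    ring
  · exact ⟨_, h, by rw [signAt, τBefore, if_neg h, if_neg h], Or.inl rfl⟩

/-- The sign of `q` just after a marked point. -/
lemma signAt_eq_after (V : VirtualNodalDiagram) (x : V.Marked) :
    ∃ p : ℝ, p ≠ 0 ∧ V.signAt x = ((V.τ x : ℤ) : ℝ) * p ∧
      (MvPolynomial.eval x.1.rep V.q = p ∨
        (MvPolynomial.eval x.1.rep V.q = 0 ∧ polar V.q x.1.rep (perp x.1.rep) = p)) := by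
  by_cases h : MvPolynomial.eval x.1.rep V.q = 0
  · exact ⟨polar V.q x.1.rep (perp x.1.rep),
      polar_perp_ne_zero V.q_homogeneous V.q_reduced x.1.rep_nonzero h,
      by rw [signAt, if_pos h], Or.inr ⟨h, rfl⟩⟩
  · exact ⟨_, h, by rw [signAt, if_neg h], Or.inl rfl⟩

/-- An arc is odd if and only if the required signs of `F` at its ends are opposite. -/
lemma mem_oddArcs_iff (V : VirtualNodalDiagram) {A : V.Marked × V.Marked} (hA : A ∈ V.arcs) :
    A ∈ V.oddArcs ↔ V.signAt A.1 * V.signAt A.2 < 0 := by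
  obtain ⟨a, b⟩ := A
  obtain ⟨hab, harc⟩ := hA
  have hab' : a.1 ≠ b.1 := fun h => hab (Subtype.ext h)
  have hc := cross_rep_ne_zero hab'
  obtain ⟨p, hp0, hp, hp'⟩ := V.signAt_eq_after a
  obtain ⟨p', hq0, hq, hq'⟩ := V.signAt_eq_before b
  have hu := cross_perp_pos a.1.rep_nonzero
  have hv := cross_perp_pos b.1.rep_nonzero
  set u := a.1.rep with hu'
  set v := b.1.rep with hv'
  set c := cross u v with hcdef
  have hqv : MvPolynomial.eval (c • v) V.q = c ^ 2 * MvPolynomial.eval v V.q :=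
    eval_smul V.q_homogeneous c v
  have hc2 : 0 < c ^ 2 := by positivity
  -- There is no zero of `q` inside the arc, so `q` has the same sign just after `a` and just before
  -- `b`, measured along the segment from `u` to `c • v`. Below, `P` and `Q` are these signs taken
  -- with the derivative along the segment instead of `perp`.
  have hpos : 0 < p * p' := by
    have hno : ∀ r, 0 < r → r < 1 → (1 - r) ^ 2 * MvPolynomial.eval u V.q +
        (1 - r) * r * polar V.q u (c • v) + r ^ 2 * MvPolynomial.eval (c • v) V.q ≠ 0 := by
      intro r h0 h1 hzero
      rw [← eval_combination V.q_homogeneous] at hzero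
      obtain ⟨z, d, hd, hz, hzr⟩ := exists_between hab' h0 h1
      rw [← hu', ← hv', ← hcdef] at hzr
      rw [hzr, eval_smul V.q_homogeneous] at hzero
      exact harc ⟨z, Or.inl ((mul_eq_zero.mp hzero).resolve_left (pow_ne_zero _ hd))⟩ hz
    obtain ⟨P, hP0, hPp, hP⟩ : ∃ P, P ≠ 0 ∧ 0 < P * p ∧ (MvPolynomial.eval u V.q = P ∨
        MvPolynomial.eval u V.q = 0 ∧ polar V.q u (c • v) = P) := by
      rcases hp' with h | ⟨h, h'⟩
      · exact ⟨p, hp0, mul_self_pos.mpr hp0, Or.inl h⟩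
      · have := polar_of_eval_eq_zero V.q_homogeneous h (c • v)
        rw [cross_smul_right, ← hcdef, h'] at this
        have e : polar V.q u (c • v) = c ^ 2 / cross u (perp u) * p := by
          field_simp; linear_combination this
        refine ⟨_, ?_, ?_, Or.inr ⟨h, rfl⟩⟩
        · rw [e]; positivity
        · rw [e, mul_assoc, ← sq]; positivity
    obtain ⟨Q, hQ0, hQp, hQ⟩ : ∃ Q, Q ≠ 0 ∧ 0 < Q * p' ∧ (MvPolynomial.eval (c • v) V.q = Q ∨
        MvPolynomial.eval (c • v) V.q = 0 ∧ polar V.q u (c • v) = Q) := by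
      rcases hq' with h | ⟨h, h'⟩
      · refine ⟨c ^ 2 * p', by positivity, by rw [mul_assoc, ← sq]; positivity, Or.inl ?_⟩
        rw [hqv, h]
      · have := polar_of_eval_eq_zero V.q_homogeneous h u
        rw [cross_swap u v, ← hcdef] at this
        have e : polar V.q u (c • v) = c ^ 2 / cross v (perp v) * p' := by
          rw [polar_smul_right, polar_symm V.q_homogeneous, ← h']
          field_simp; linear_combination this
        refine ⟨_, ?_, ?_, Or.inr ⟨by rw [hqv, h, mul_zero], rfl⟩⟩
        · rw [e]; positivity
        · rw [e, mul_assoc, ← sq]; positivity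
    have hPQ := quadratic_end_signs hno hP0 hQ0 hP hQ
    have h1 : 0 < (P * Q) * (p * p') := by
      have := mul_pos hPp hQp
      linarith
    exact (mul_pos_iff_of_pos_left hPQ).mp h1
  rw [oddArcs]
  simp only [Set.mem_ofPred_eq]
  rw [hp, hq]
  have e : ((V.τ a : ℤ) : ℝ) * p * (((V.τBefore b : ℤ) : ℝ) * p') =
    (((V.τ a : ℤ) : ℝ) * ((V.τBefore b : ℤ) : ℝ)) * (p * p') := by ring
  rw [e, mul_neg_iff]
  have hm : (a, b) ∈ V.arcs := ⟨hab, harc⟩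
  rcases Int.units_eq_one_or (V.τ a) with h1 | h1 <;>
    rcases Int.units_eq_one_or (V.τBefore b) with h2 | h2 <;> simp [h1, h2, hm, hpos, hpos.le]

/-- Under this normalization the Plücker relations turn the determinants into differences of
coordinates. If `a` and `a'` differed, one of them would lie inside the arc starting at the other;
the same then holds for `b` and `b'`. -/
lemma crossing_ends {a b a' b' e : Fin 2 → ℝ} (h1 : cross a e = 1) (h2 : cross e b = 1)
    (h3 : cross a' e = 1) (h4 : cross e b' = 1) (h : 0 < cross a b) (h' : 0 < cross a' b')
    (k1 : ¬ 0 < cross a a' * cross a' b * cross a b)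
    (k2 : ¬ 0 < cross a' a * cross a b' * cross a' b')
    (k3 : ¬ 0 < cross a b' * cross b' b * cross a b)
    (k4 : ¬ 0 < cross a' b * cross b b' * cross a' b') : cross a a' = 0 ∧ cross b b' = 0 := by
  have p1 : cross a a' * cross e b - cross a e * cross a' b + cross a b * cross a' e = 0 := by
    simp only [cross]; ring
  have p2 : cross a' a * cross e b' - cross a' e * cross a b' + cross a' b' * cross a e = 0 := by
    simp only [cross]; ring
  have p3 : cross a e * cross b b' - cross a b * cross e b' + cross a b' * cross e b = 0 := by
    simp only [cross]; ring
  rw [h1, h2, h3] at p1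
  rw [h1, h3, h4] at p2
  rw [h1, h2, h4] at p3
  rw [cross_swap a a'] at p2 k2
  rw [cross_swap b b'] at k3
  have e1 : cross a' b = cross a a' + cross a b := by linarith
  have e2 : cross a b' = cross a' b' - cross a a' := by linarith
  have hs : cross a a' = 0 := by
    rcases lt_trichotomy (cross a a') 0 with hs | hs | hs
    · exfalso
      apply k2
      rw [e2]
      exact mul_pos (mul_pos (by linarith) (by linarith)) h'
    · exact hs
    · exfalso
      apply k1
      rw [e1]
      exact mul_pos (mul_pos hs (by linarith)) h
  refine ⟨hs, ?_⟩
  rw [hs] at e1 e2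
  rcases lt_trichotomy (cross b b') 0 with ht | ht | ht
  · exfalso
    apply k3
    exact mul_pos (mul_pos (by linarith) (by linarith)) h
  · exact ht
  · exfalso
    apply k4
    exact mul_pos (mul_pos (by linarith) ht) h'

/-- Distinct arcs are disjoint. -/
lemma arcs_disjoint (V : VirtualNodalDiagram) {A B : V.Marked × V.Marked} (hA : A ∈ V.arcs)
    (hB : B ∈ V.arcs) {z : RP1} (hzA : Between A.1.1 z A.2.1) (hzB : Between B.1.1 z B.2.1) :
    A = B := by
  obtain ⟨⟨a, ha⟩, ⟨b, hb⟩⟩ := A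
  obtain ⟨⟨a', ha'⟩, ⟨b', hb'⟩⟩ := B
  simp only at hzA hzB
  have normalize : ∀ {a b : RP1}, Between a z b → ∃ (u w : Fin 2 → ℝ) (r t : ℝ), r ≠ 0 ∧ t ≠ 0 ∧
      a.rep = r • u ∧ b.rep = t • w ∧ cross u z.rep = 1 ∧ cross z.rep w = 1 ∧ 0 < cross u w := by
    intro a b h
    have h1 : cross a.rep z.rep ≠ 0 := by intro h1; simp [Between, h1] at h
    have h2 : cross z.rep b.rep ≠ 0 := by intro h2; simp [Between, h2] at h
    have e1 : a.rep = cross a.rep z.rep • ((cross a.rep z.rep)⁻¹ • a.rep) := by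
      rw [smul_inv_smul₀ h1]
    have e2 : b.rep = cross z.rep b.rep • ((cross z.rep b.rep)⁻¹ • b.rep) := by
      rw [smul_inv_smul₀ h2]
    have c1 : cross ((cross a.rep z.rep)⁻¹ • a.rep) z.rep = 1 := by
      rw [cross_smul_left, inv_mul_cancel₀ h1]
    have c2 : cross z.rep ((cross z.rep b.rep)⁻¹ • b.rep) = 1 := by
      rw [cross_smul_right, inv_mul_cancel₀ h2]
    refine ⟨_, _, _, _, h1, h2, e1, e2, c1, c2, ?_⟩
    rw [between_iff h1 one_ne_zero h2 e1 (one_smul _ _).symm e2, c1, c2] at h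
    simpa using h
  obtain ⟨u, w, r, t, hr, ht, eu, ew, n1, n2, n3⟩ := normalize hzA
  obtain ⟨u', w', r', t', hr', ht', eu', ew', n1', n2', n3'⟩ := normalize hzB
  have k1 := hA.2 ⟨a', ha'⟩
  have k2 := hB.2 ⟨a, ha⟩
  have k3 := hA.2 ⟨b', hb'⟩
  have k4 := hB.2 ⟨b, hb⟩
  simp only at k1 k2 k3 k4
  rw [between_iff hr hr' ht eu eu' ew] at k1
  rw [between_iff hr' hr ht' eu' eu ew'] at k2
  rw [between_iff hr ht' ht eu ew' ew] at k3
  rw [between_iff hr' ht ht' eu' ew ew'] at k4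
  obtain ⟨c1, c2⟩ := crossing_ends n1 n2 n1' n2' n3 n3' k1 k2 k3 k4
  have e1 : a = a' := RP1.eq_of_cross (by rw [eu, eu', cross_smul, c1, mul_zero])
  have e2 : b = b' := RP1.eq_of_cross (by rw [ew, ew', cross_smul, c2, mul_zero])
  subst e1 e2
  rfl

/-- A form with the required signs has a zero on each odd arc. -/
lemma encard_oddArcs_le (V : VirtualNodalDiagram) (h : V.signed.Nonempty) :
    V.oddArcs.encard ≤ 6 := by
  obtain ⟨f, hf⟩ := h
  have hF := isHomogeneous_bform 6 f
  have hzero : ∀ A : V.oddArcs, ∃ z : RP1, Between A.1.1.1 z A.1.2.1 ∧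
      MvPolynomial.eval z.rep (bform 6 f) = 0 := by
    rintro ⟨⟨a, b⟩, hA⟩
    have harc : (a, b) ∈ V.arcs := hA.1
    have hab : a.1 ≠ b.1 := fun h => harc.1 (Subtype.ext h)
    have hlt := (V.mem_oddArcs_iff harc).mp hA
    have ha := hf a
    have hb := hf b
    simp only at hlt
    have hc := cross_rep_ne_zero hab
    set c := cross a.1.rep b.1.rep with hcdef
    have hsign : MvPolynomial.eval a.1.rep (bform 6 f) * MvPolynomial.eval b.1.rep (bform 6 f) < 0 := by
      have h1 := mul_pos ha hb
      have h2 : 0 < (V.signAt a * V.signAt b) *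
        (MvPolynomial.eval a.1.rep (bform 6 f) * MvPolynomial.eval b.1.rep (bform 6 f)) := by linarith
      by_contra! hle
      have := mul_nonpos_of_nonpos_of_nonneg hlt.le hle
      linarith
    obtain ⟨r, h0, h1, hr⟩ := exists_zero_of_sign_change
      (f := fun r => MvPolynomial.eval ((1 - r) • a.1.rep + r • (c • b.1.rep)) (bform 6 f))
      ((continuous_eval_form _).comp (by fun_prop)) (by
        simp only [sub_zero, one_smul, zero_smul, add_zero, sub_self, zero_add]
        rw [eval_smul hF]
        have : 0 < c ^ 6 := by positivity
        have e : MvPolynomial.eval a.1.rep (bform 6 f) * (c ^ 6 * MvPolynomial.eval b.1.rep (bform 6 f)) =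
          c ^ 6 * (MvPolynomial.eval a.1.rep (bform 6 f) * MvPolynomial.eval b.1.rep (bform 6 f)) := by
          ring
        rw [e]
        exact mul_neg_of_pos_of_neg this hsign)
    obtain ⟨z, d, hd, hz, hzr⟩ := exists_between hab h0 h1
    refine ⟨z, hz, ?_⟩
    rw [hcdef, hzr, eval_smul hF] at hr
    exact (mul_eq_zero.mp hr).resolve_left (pow_ne_zero _ hd)
  choose g hg hg' using hzero
  rcases V.oddArcs.eq_empty_or_nonempty with he | ⟨A, hA⟩
  · simp [he]
  have hne : MvPolynomial.eval A.1.1.rep (bform 6 f) ≠ 0 := by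
    intro h; have := hf A.1; rw [h, mul_zero] at this; exact lt_irrefl _ this
  have hinj : Function.Injective g := by
    intro A B hAB
    refine Subtype.ext (V.arcs_disjoint A.2.1 B.2.1 (hg A) ?_)
    rw [hAB]; exact hg B
  -- Distinct arcs are disjoint, so the chosen zeros are distinct; the form is nonzero because of
  -- its sign at an end of an odd arc.
  exact hinj.encard_range.trans <| (Set.encard_le_encard (by rintro _ ⟨A, rfl⟩; exact hg' A)).trans (encard_zeros_le hF hne)

end VirtualNodalDiagram

/-! ### Sign interpolation -/

/-- The function `s` changes sign between `a ∈ T` and the next element of `T`, or between `a` and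
`+∞`, where the sign is that of `s₀`, if `a` is the last element. -/
def OddGap (T : Finset ℝ) (s : ℝ → ℝ) (s₀ : ℝ) (a : ℝ) : Prop :=
  (∃ b ∈ T, a < b ∧ (∀ c ∈ T, c ≤ a ∨ b ≤ c) ∧ s a * s b < 0) ∨ ((∀ c ∈ T, c ≤ a) ∧ s a * s₀ < 0)

open Classical in
/-- There is a polynomial with prescribed signs at the points of `T` and at `+∞`, which has at most
one zero in each gap where the sign has to change. -/
lemma exists_sign_interpolation (T : Finset ℝ) (s : ℝ → ℝ) (hs : ∀ a ∈ T, s a ≠ 0) {s₀ : ℝ}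
    (hs₀ : s₀ ≠ 0) : ∃ Z : Finset ℝ, (∀ t ∈ T, 0 < s₀ * s t * ∏ z ∈ Z, (t - z)) ∧
      (∀ z ∈ Z, ∃ a ∈ T, a < z) ∧ Z.card ≤ (T.filter (OddGap T s s₀)).card := by
  -- Points are added from right to left. The zeros chosen so far lie to the right of the new point
  -- `a` and, if there is a next point, to the right of that one, so the product has the same sign
  -- at both. A new zero is inserted between them only if the signs have to differ.
  induction T using Finset.induction_on_min with
  | empty => exact ⟨∅, by simp, by simp, by simp⟩
  | insert a T ha ih =>
    obtain ⟨Z, h1, h2, h3⟩ := ih fun b hb => hs b (Finset.mem_insert_of_mem hb)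
    have haT : a ∉ T := fun h => lt_irrefl _ (ha a h)
    have hsa := hs a (Finset.mem_insert_self a T)
    have hZ : ∀ z ∈ Z, a < z := fun z hz => by
      obtain ⟨b, hb, hbz⟩ := h2 z hz
      exact (ha b hb).trans hbz
    have hmono : ∀ b ∈ T, OddGap T s s₀ b → OddGap (insert a T) s s₀ b := by
      rintro b hb (⟨c, hc, h4, h5, h6⟩ | ⟨h4, h5⟩)
      · refine Or.inl ⟨c, Finset.mem_insert_of_mem hc, h4, fun d hd => ?_, h6⟩
        rcases Finset.mem_insert.mp hd with rfl | hd
        · exact Or.inl (ha b hb).le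
        · exact h5 d hd
      · refine Or.inr ⟨fun d hd => ?_, h5⟩
        rcases Finset.mem_insert.mp hd with rfl | hd
        · exact (ha b hb).le
        · exact h4 d hd
    have hsub : T.filter (OddGap T s s₀) ⊆ (insert a T).filter (OddGap (insert a T) s s₀) := by
      intro b hb
      rw [Finset.mem_filter] at hb ⊢
      exact ⟨Finset.mem_insert_of_mem hb.1, hmono b hb.1 hb.2⟩
    have keep : 0 < s₀ * s a * ∏ z ∈ Z, (a - z) → ∃ Z : Finset ℝ,
        (∀ t ∈ insert a T, 0 < s₀ * s t * ∏ z ∈ Z, (t - z)) ∧ (∀ z ∈ Z, ∃ b ∈ insert a T, b < z) ∧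
        Z.card ≤ ((insert a T).filter (OddGap (insert a T) s s₀)).card := by
      intro h
      refine ⟨Z, fun t ht => ?_, fun z hz => ⟨a, Finset.mem_insert_self a T, hZ z hz⟩,
        h3.trans (Finset.card_le_card hsub)⟩
      rcases Finset.mem_insert.mp ht with rfl | ht
      exacts [h, h1 t ht]
    have extend : ∀ z₀, a < z₀ → (∀ t ∈ T, z₀ < t) → (∀ z ∈ Z, z₀ < z) →
        OddGap (insert a T) s s₀ a → s₀ * s a * ∏ z ∈ Z, (a - z) < 0 → ∃ Z : Finset ℝ,
        (∀ t ∈ insert a T, 0 < s₀ * s t * ∏ z ∈ Z, (t - z)) ∧ (∀ z ∈ Z, ∃ b ∈ insert a T, b < z) ∧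
        Z.card ≤ ((insert a T).filter (OddGap (insert a T) s s₀)).card := by
      intro z₀ h4 h5 h6 h7 h8
      have hz₀ : z₀ ∉ Z := fun h => lt_irrefl _ (h6 z₀ h)
      refine ⟨insert z₀ Z, fun t ht => ?_, fun z hz => ⟨a, Finset.mem_insert_self a T, ?_⟩, ?_⟩
      · rw [Finset.prod_insert hz₀]
        rcases Finset.mem_insert.mp ht with rfl | ht
        · nlinarith
        · have := mul_pos (h1 t ht) (sub_pos.mpr (h5 t ht))
          linarith
      · rcases Finset.mem_insert.mp hz with rfl | hz
        exacts [h4, hZ z hz]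
      · rw [Finset.card_insert_of_notMem hz₀]
        have hss : T.filter (OddGap T s s₀) ⊂ (insert a T).filter (OddGap (insert a T) s s₀) := by
          refine Finset.ssubset_iff_of_subset hsub |>.mpr ⟨a, ?_, ?_⟩
          · exact Finset.mem_filter.mpr ⟨Finset.mem_insert_self a T, h7⟩
          · exact fun h => haT (Finset.mem_filter.mp h).1
        exact Nat.succ_le_of_lt (h3.trans_lt (Finset.card_lt_card hss))
    rcases T.eq_empty_or_nonempty with rfl | hT
    · have hZe : Z = ∅ := Finset.eq_empty_of_forall_notMem fun z hz => by simpa using h2 z hz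
      subst hZe
      rcases lt_or_gt_of_ne (mul_ne_zero hs₀ hsa) with h | h
      -- The first point added is compared with the sign at `+∞`, so any zero to its right will do.
      · refine extend (a + 1) (by linarith) (by simp) (by simp) (Or.inr ⟨by simp, by linarith⟩) ?_
        simpa using h
      · exact keep (by simpa using h)
    · set b := T.min' hT with hb
      have hbT : b ∈ T := T.min'_mem hT
      have hab := ha b hbT
      have hbZ : ∀ z ∈ Z, b < z := fun z hz => by
        obtain ⟨c, hc, hcz⟩ := h2 z hz
        exact (T.min'_le c hc).trans_lt hcz
      have hprod : 0 < (∏ z ∈ Z, (a - z)) * ∏ z ∈ Z, (b - z) := by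
        rw [← Finset.prod_mul_distrib]
        refine Finset.prod_pos fun z hz => mul_pos_of_neg_of_neg ?_ ?_
        · linarith [hZ z hz]
        · linarith [hbZ z hz]
      have hbs := h1 b hbT
      have hkey : 0 < (s₀ * s a * ∏ z ∈ Z, (a - z)) * (s a * s b) := by
        have h4 : 0 < s a ^ 2 := by positivity
        have h5 := mul_pos h4 (mul_pos hprod hbs)
        have h6 : (s a ^ 2 * (((∏ z ∈ Z, (a - z)) * ∏ z ∈ Z, (b - z)) *
            (s₀ * s b * ∏ z ∈ Z, (b - z)))) = (s₀ * s a * ∏ z ∈ Z, (a - z)) * (s a * s b) *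
            (∏ z ∈ Z, (b - z)) ^ 2 := by ring
        rw [h6] at h5
        exact pos_of_mul_pos_left h5 (sq_nonneg _)
      rcases lt_or_gt_of_ne (mul_ne_zero hsa (hs b (Finset.mem_insert_of_mem hbT))) with h | h
      · refine extend ((a + b) / 2) (by linarith) (fun t ht => ?_) (fun z hz => ?_)
          (Or.inl ⟨b, Finset.mem_insert_of_mem hbT, hab, fun c hc => ?_, h⟩) ?_
        · have := T.min'_le t ht
          linarith
        · linarith [hbZ z hz]
        · rcases Finset.mem_insert.mp hc with rfl | hc
          · exact Or.inl le_rfl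
          · exact Or.inr (T.min'_le c hc)
        · by_contra! hle
          have := mul_nonpos_of_nonneg_of_nonpos hle h.le
          linarith
      · exact keep ((pos_iff_pos_of_mul_pos hkey).mpr h)

/-- The product of the linear forms vanishing at `Z` and of a definite form. -/
def zeroForm (Z : Finset ℝ) (w : ℝ → Fin 2 → ℝ) (s₀ : ℝ) (k : ℕ) : Form :=
  MvPolynomial.C s₀ * ((∏ z ∈ Z, (MvPolynomial.C (w z 0) * MvPolynomial.X 1 +
    MvPolynomial.C (-w z 1) * MvPolynomial.X 0)) * (MvPolynomial.X 0 ^ 2 + MvPolynomial.X 1 ^ 2) ^ k)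

lemma isHomogeneous_zeroForm (Z : Finset ℝ) (w : ℝ → Fin 2 → ℝ) (s₀ : ℝ) (k : ℕ) :
    (zeroForm Z w s₀ k).IsHomogeneous (Z.card + 2 * k) := by
  have h0 : ∀ z : ℝ, (MvPolynomial.C (w z 0) * MvPolynomial.X 1 +
      MvPolynomial.C (-w z 1) * MvPolynomial.X 0 : Form).IsHomogeneous 1 := by
    intro z
    have h0 := (MvPolynomial.isHomogeneous_C (Fin 2) (w z 0)).mul (MvPolynomial.isHomogeneous_X ℝ (1 : Fin 2))
    have h1 := (MvPolynomial.isHomogeneous_C (Fin 2) (-w z 1)).mul (MvPolynomial.isHomogeneous_X ℝ (0 : Fin 2))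
    rw [zero_add] at h0 h1
    exact h0.add h1
  have h1 := MvPolynomial.IsHomogeneous.prod Z _ (fun _ => 1) fun z _ => h0 z
  have h2 : (MvPolynomial.X 0 ^ 2 + MvPolynomial.X 1 ^ 2 : Form).IsHomogeneous 2 :=
    (MvPolynomial.isHomogeneous_X_pow 0 2).add (MvPolynomial.isHomogeneous_X_pow 1 2)
  have h3 := (MvPolynomial.isHomogeneous_C (Fin 2) s₀).mul (h1.mul (h2.pow k))
  rw [zero_add, Finset.sum_const, smul_eq_mul, mul_one] at h3
  exact h3

lemma eval_zeroForm (Z : Finset ℝ) (w : ℝ → Fin 2 → ℝ) (s₀ : ℝ) (k : ℕ) (x : Fin 2 → ℝ) :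
    MvPolynomial.eval x (zeroForm Z w s₀ k) =
      s₀ * ((∏ z ∈ Z, cross (w z) x) * (x 0 ^ 2 + x 1 ^ 2) ^ k) := by
  simp only [zeroForm, map_mul, map_prod, map_add, map_pow, MvPolynomial.eval_C, MvPolynomial.eval_X, cross]
  congr 3
  ext z
  ring

namespace VirtualNodalDiagram

/-- A diagram with at most 6 odd arcs admits a form with the required signs. -/
lemma signed_nonempty (V : VirtualNodalDiagram) (h : V.oddArcs.encard ≤ 6) : V.signed.Nonempty := by
  classical
  have hfin := V.finite_marked
  have := Fintype.ofFinite V.Marked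
  rcases isEmpty_or_nonempty V.Marked with hemp | ⟨⟨m₀⟩⟩
  · exact ⟨0, fun m => hemp.elim m⟩
  set u := m₀.1.rep with hu
  have hu0 : u ≠ 0 := m₀.1.rep_nonzero
  set N := cross u (perp u) with hNdef
  have hN : 0 < N := cross_perp_pos hu0
  -- An increasing affine coordinate with the marked point `m₀` at infinity: `cross (w s) (w t)` is
  -- a positive multiple of `t - s`, so cyclic order becomes the order of ℝ.
  set w : ℝ → Fin 2 → ℝ := fun t => t • u + (-1 : ℝ) • perp u with hw
  have cuu : cross u u = 0 := cross_self u
  have cpp : cross (perp u) (perp u) = 0 := cross_self _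
  have cpu : cross (perp u) u = -N := cross_swap _ _
  have cww : ∀ s t, cross (w s) (w t) = (t - s) * N := by
    intro s t
    simp only [hw, cross_add_smul_left, cross_add_smul_right, cuu, cpp, cpu, ← hNdef]
    ring
  have cwu : ∀ t, cross (w t) u = N := by
    intro t; simp only [hw, cross_add_smul_left, cuu, cpu]; ring
  have cuw : ∀ t, cross u (w t) = -N := by
    intro t; simp only [hw, cross_add_smul_right, cuu, ← hNdef]; ring
  have hcoord : ∀ m : V.Marked, ∃ t l : ℝ, m ≠ m₀ → l ≠ 0 ∧ m.1.rep = l • w t := by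
    intro m
    by_cases hm : m = m₀
    · exact ⟨0, 0, fun h => absurd hm h⟩
    have hne : cross u m.1.rep ≠ 0 := cross_rep_ne_zero fun h => hm (Subtype.ext h.symm)
    refine ⟨-(cross m.1.rep (perp u) / cross u m.1.rep), -(cross u m.1.rep / N), fun _ =>
      ⟨by simp [hne, hN.ne'], ?_⟩⟩
    conv_lhs => rw [cross_expand hN.ne' m.1.rep]
    simp only [hw, smul_add, smul_smul, ← hNdef]
    congr 2
    · field_simp
    · ring
  choose c l hcl using hcoord
  have hinj : ∀ m m', m ≠ m₀ → m' ≠ m₀ → c m = c m' → m = m' := by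
    intro m m' hm hm' hc
    refine Subtype.ext (RP1.eq_of_cross ?_)
    rw [(hcl m hm).2, (hcl m' hm').2, hc, cross_smul, cross_self, mul_zero]
  set M : Finset V.Marked := Finset.univ.filter (· ≠ m₀) with hM
  have hMm : ∀ {m}, m ∈ M ↔ m ≠ m₀ := by simp [hM]
  set T : Finset ℝ := M.image c with hT
  have hcT : ∀ {m}, m ≠ m₀ → c m ∈ T := fun hm => Finset.mem_image_of_mem c (hMm.mpr hm)
  set s : ℝ → ℝ := fun t => if h : ∃ m, m ≠ m₀ ∧ c m = t then V.signAt h.choose else 1 with hs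
  have hsc : ∀ m, m ≠ m₀ → s (c m) = V.signAt m := by
    intro m hm
    have hex : ∃ m', m' ≠ m₀ ∧ c m' = c m := ⟨m, hm, rfl⟩
    simp only [hs, dif_pos hex]
    rw [hinj _ _ hex.choose_spec.1 hm hex.choose_spec.2]
  have bet : ∀ {a z b : V.Marked} {x y v : Fin 2 → ℝ} {r p t : ℝ}, r ≠ 0 → p ≠ 0 → t ≠ 0 →
      a.1.rep = r • x → z.1.rep = p • y → b.1.rep = t • v →
      cross x y * cross y v * cross x v ≤ 0 → ¬ Between a.1 z.1 b.1 := by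
    intro a z b x y v r p t hr hp ht ha hz hb hle
    rw [between_iff hr hp ht ha hz hb]
    exact not_lt.mpr hle
  have hm₀ : m₀.1.rep = (1 : ℝ) • u := (one_smul _ _).symm
  -- Gaps of `T` are arcs, the last one ending at `m₀`; each odd arc is counted by its initial end.
  -- The arc from `m₀` to the first point is treated separately.
  have arc_of_gap : ∀ m, m ≠ m₀ → OddGap T s (V.signAt m₀) (c m) → ∃ A ∈ V.oddArcs, A.1 = m := by
    rintro m hm (⟨b, hb, h1, h2, h3⟩ | ⟨h1, h2⟩)
    · obtain ⟨m', hm', rfl⟩ := Finset.mem_image.mp hb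
      rw [hMm] at hm'
      refine ⟨(m, m'), (V.mem_oddArcs_iff ⟨fun h => ?_, fun z => ?_⟩).mpr ?_, rfl⟩
      · simp only at h; rw [h] at h1; exact lt_irrefl _ h1
      · by_cases hz : z = m₀
        · subst hz
          refine bet (hcl m hm).1 one_ne_zero (hcl m' hm').1 (hcl m hm).2 hm₀ (hcl m' hm').2 ?_
          rw [cwu, cuw, cww]
          have : 0 < (c m' - c m) * N := mul_pos (by linarith) hN
          nlinarith [mul_pos (mul_pos hN hN) this]
        · refine bet (hcl m hm).1 (hcl z hz).1 (hcl m' hm').1 (hcl m hm).2 (hcl z hz).2 (hcl m' hm').2 ?_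
          rw [cww, cww, cww]
          have e : (c z - c m) * N * ((c m' - c z) * N) * ((c m' - c m) * N) =
            ((c z - c m) * (c m' - c z)) * ((c m' - c m) * (N * N * N)) := by ring
          rw [e]
          refine mul_nonpos_of_nonpos_of_nonneg ?_ (mul_nonneg (by linarith) (by positivity))
          rcases h2 _ (hcT hz) with h | h
          · exact mul_nonpos_of_nonpos_of_nonneg (by linarith) (by linarith)
          · exact mul_nonpos_of_nonneg_of_nonpos (by linarith) (by linarith)
      · rwa [hsc m hm, hsc m' hm'] at h3
    · refine ⟨(m, m₀), (V.mem_oddArcs_iff ⟨hm, fun z => ?_⟩).mpr ?_, rfl⟩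
      · by_cases hz : z = m₀
        · subst hz
          refine bet (hcl m hm).1 one_ne_zero one_ne_zero (hcl m hm).2 hm₀ hm₀ ?_
          rw [cuu]; simp
        · refine bet (hcl m hm).1 (hcl z hz).1 one_ne_zero (hcl m hm).2 (hcl z hz).2 hm₀ ?_
          rw [cww, cwu, cwu]
          have := h1 _ (hcT hz)
          have e : (c z - c m) * N * N * N = (c z - c m) * (N * N * N) := by ring
          rw [e]
          exact mul_nonpos_of_nonpos_of_nonneg (by linarith) (by positivity)
      · rwa [hsc m hm] at h2
  have arc_first : ∀ m, m ≠ m₀ → (∀ t ∈ T, c m ≤ t) → V.signAt m₀ * V.signAt m < 0 →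
      ∃ A ∈ V.oddArcs, A.1 = m₀ := by
    intro m hm h1 h2
    refine ⟨(m₀, m), (V.mem_oddArcs_iff ⟨hm.symm, fun z => ?_⟩).mpr h2, rfl⟩
    by_cases hz : z = m₀
    · subst hz
      refine bet one_ne_zero one_ne_zero (hcl m hm).1 hm₀ hm₀ (hcl m hm).2 ?_
      rw [cuu]; simp
    · refine bet one_ne_zero (hcl z hz).1 (hcl m hm).1 hm₀ (hcl z hz).2 (hcl m hm).2 ?_
      rw [cww, cuw, cuw]
      have := h1 _ (hcT hz)
      have e : -N * ((c m - c z) * N) * -N = (c m - c z) * (N * N * N) := by ring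
      rw [e]
      exact mul_nonpos_of_nonpos_of_nonneg (by linarith) (by positivity)
  have hs₀ := V.signAt_ne_zero m₀
  have hsT : ∀ t ∈ T, s t ≠ 0 := by
    intro t ht
    obtain ⟨m, hm, rfl⟩ := Finset.mem_image.mp ht
    rw [hsc m (hMm.mp hm)]
    exact V.signAt_ne_zero m
  obtain ⟨Z, h1, h2, h3⟩ := exists_sign_interpolation T s hsT hs₀
  set W : Finset V.Marked := M.filter fun m => OddGap T s (V.signAt m₀) (c m) with hW
  have hWm₀ : m₀ ∉ W := fun h => (hMm.mp (Finset.mem_filter.mp h).1) rfl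
  have hZW : Z.card ≤ W.card := by
    refine h3.trans ?_
    have : T.filter (OddGap T s (V.signAt m₀)) ⊆ W.image c := by
      intro t ht
      obtain ⟨ht, hg⟩ := Finset.mem_filter.mp ht
      obtain ⟨m, hm, rfl⟩ := Finset.mem_image.mp ht
      exact Finset.mem_image_of_mem c (Finset.mem_filter.mpr ⟨hm, hg⟩)
    exact (Finset.card_le_card this).trans Finset.card_image_le
  have hcount : ∀ W' : Finset V.Marked, (∀ m ∈ W', ∃ A ∈ V.oddArcs, A.1 = m) → W'.card ≤ 6 := by
    intro W' hW'
    have e1 : (W' : Set V.Marked) ⊆ Prod.fst '' V.oddArcs := fun m hm => hW' m hm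
    have e2 := ((Set.encard_le_encard e1).trans (Set.encard_image_le _ _)).trans h
    rw [Set.encard_coe_eq_coe_finsetCard] at e2
    exact_mod_cast e2
  have hWarc : ∀ m ∈ W, ∃ A ∈ V.oddArcs, A.1 = m := fun m hm =>
    arc_of_gap m (hMm.mp (Finset.mem_filter.mp hm).1) (Finset.mem_filter.mp hm).2
  -- The number of zeros must be even to be filled up to degree 6 by a definite factor. If it is
  -- odd, the signs at `m₀` and at the first point are opposite, so the arc between them is odd as
  -- well and pays for one more zero, placed to the left of all points.
  obtain ⟨Z', hZ'1, hZ'2, hZ'3⟩ : ∃ Z' : Finset ℝ, (∀ t ∈ T, 0 < V.signAt m₀ * s t * ∏ z ∈ Z', (t - z)) ∧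
      Z'.card ≤ 6 ∧ Even Z'.card := by
    rcases Nat.even_or_odd Z.card with he | ho
    · exact ⟨Z, h1, hZW.trans (hcount W hWarc), he⟩
    · have hZne : Z.Nonempty := by
        rw [← Finset.card_pos]; exact ho.pos
      obtain ⟨z, hz⟩ := hZne
      obtain ⟨a, haT, -⟩ := h2 z hz
      have hTne : T.Nonempty := ⟨a, haT⟩
      have hmin := T.min'_mem hTne
      obtain ⟨m, hm, hmc⟩ := Finset.mem_image.mp hmin
      have hmle : ∀ t ∈ T, c m ≤ t := fun t ht => hmc ▸ T.min'_le t ht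
      rw [hMm] at hm
      have hneg : V.signAt m₀ * V.signAt m < 0 := by
        have h4 := h1 _ (hcT hm)
        rw [hsc m hm] at h4
        have h5 : ∏ z ∈ Z, (c m - z) < 0 := by
          have e : ∏ z ∈ Z, (c m - z) = (-1) ^ Z.card * ∏ z ∈ Z, (z - c m) := by
            rw [← Finset.prod_const, ← Finset.prod_mul_distrib]
            exact Finset.prod_congr rfl fun z _ => by ring
          rw [e, ho.neg_one_pow, neg_one_mul, neg_lt_zero]
          refine Finset.prod_pos fun z hz => ?_
          obtain ⟨a, ha, haz⟩ := h2 z hz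
          linarith [hmle a ha]
        by_contra! hle
        have := mul_nonpos_of_nonneg_of_nonpos hle h5.le
        linarith
      have hnew : c m - 1 ∉ Z := by
        intro hz
        obtain ⟨a, ha, haz⟩ := h2 _ hz
        linarith [hmle a ha]
      refine ⟨insert (c m - 1) Z, fun t ht => ?_, ?_, ?_⟩
      · rw [Finset.prod_insert hnew]
        have := mul_pos (h1 t ht) (show 0 < t - (c m - 1) by linarith [hmle t ht])
        linarith
      · rw [Finset.card_insert_of_notMem hnew]
        have := hcount (insert m₀ W) fun m' hm' => by
          rcases Finset.mem_insert.mp hm' with rfl | hm'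
          exacts [arc_first m hm hmle hneg, hWarc m' hm']
        rw [Finset.card_insert_of_notMem hWm₀] at this
        omega
      · rw [Finset.card_insert_of_notMem hnew]
        exact ho.add_one
  obtain ⟨j, hj⟩ := hZ'3
  -- With `2j` linear factors the definite factor has degree `2 (3 - j)`; up to positive factors,
  -- the values are `signAt m₀` at `m₀` and `signAt m₀ * ∏ (t - z)` at `w t`.
  set F := zeroForm Z' w (V.signAt m₀) (3 - j) with hF
  have hFhom : F.IsHomogeneous 6 := by
    have := isHomogeneous_zeroForm Z' w (V.signAt m₀) (3 - j)
    have e : Z'.card + 2 * (3 - j) = 6 := by omega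
    rwa [e] at this
  have hsq : ∀ x : Fin 2 → ℝ, x ≠ 0 → 0 < x 0 ^ 2 + x 1 ^ 2 := by
    intro x hx
    have := cross_perp_pos hx
    simp only [cross, perp, Matrix.cons_val] at this
    linarith
  have hw0 : ∀ t, w t ≠ 0 := fun t => ne_zero_of_cross_left (w := u) (by rw [cwu]; exact hN.ne')
  refine ⟨coefs 6 F, fun m => ?_⟩
  rw [bform_coefs hFhom]
  by_cases hm : m = m₀
  · subst hm
    rw [hF, eval_zeroForm, ← mul_assoc]
    refine mul_pos (mul_self_pos.mpr hs₀) (mul_pos (Finset.prod_pos fun z _ => ?_) (pow_pos (hsq _ hu0) _))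
    rw [← hu, cwu]; exact hN
  · rw [(hcl m hm).2, eval_smul hFhom, hF, eval_zeroForm]
    simp only [cww, Finset.prod_mul_distrib, Finset.prod_const]
    have h4 := hZ'1 _ (hcT hm)
    rw [hsc m hm] at h4
    have h5 : 0 < (l m) ^ 6 := by
      have := (hcl m hm).1
      positivity
    have h6 := mul_pos (mul_pos h4 h5) (mul_pos (pow_pos hN Z'.card) (pow_pos (hsq _ (hw0 (c m))) (3 - j)))
    linarith

theorem signed_nonempty_iff (V : VirtualNodalDiagram) : V.signed.Nonempty ↔ V.oddArcs.encard ≤ 6 :=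
  ⟨V.encard_oddArcs_le, V.signed_nonempty⟩

end VirtualNodalDiagram

/-! ### Rigid isotopy classes of deformations -/

/-- The coefficients of embedded sextics. -/
def embedded : Set Coef := {g | IsEmbedded 6 (bforms 6 g)}

lemma rigidlyIsotopic_of_joinedIn {g g' : Coef} (h : JoinedIn embedded g g') :
    RigidlyIsotopic 6 (curve (bforms 6 g)) (curve (bforms 6 g')) := by
  refine ⟨fun t => bforms 6 (h.somePath.extend t), fun i m => ?_, fun t ht => ?_, by simp, by simp⟩
  · exact ((continuous_coeff_bform 6 m).comp
      ((continuous_apply i).comp h.somePath.continuous_extend)).continuousOn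
  · simp only [Path.extend_apply _ ht]
    exact h.somePath_mem ⟨t, ht⟩

/-- The sextics near the lift with height form `bform 6 p.1`, moved in a direction close to
`p.2`, are rigidly isotopic to `g`. -/
def Deforms (ν : Fin 3 → Form) (q : Form) (p : (Fin 7 → ℝ) × Coef) (g : Coef) : Prop :=
  ∀ᶠ s : ((Fin 7 → ℝ) × Coef) × ℝ in 𝓝 p ×ˢ 𝓝[>] (0 : ℝ),
    JoinedIn embedded g (liftCoef ν q s.1.1 + s.2 • s.1.2)

/-- The lifts with the height forms `bform 6 p.1`, `bform 6 p'.1` and their velocities `p.2`, `p'.2`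
lead to the same sextics up to rigid isotopy. -/
def SameDeformation (ν : Fin 3 → Form) (q : Form) (p p' : (Fin 7 → ℝ) × Coef) : Prop :=
  ∃ g, Deforms ν q p g ∧ Deforms ν q p' g

lemma SameDeformation.symm {ν : Fin 3 → Form} {q : Form} {p p' : (Fin 7 → ℝ) × Coef}
    (h : SameDeformation ν q p p') : SameDeformation ν q p' p :=
  let ⟨g, h1, h2⟩ := h
  ⟨g, h2, h1⟩

/-- Both reference curves are joined to one and the same curve near the middle parameter, because
the filter is nontrivial. -/
lemma SameDeformation.trans {ν : Fin 3 → Form} {q : Form} {p p' p'' : (Fin 7 → ℝ) × Coef}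
    (h : SameDeformation ν q p p') (h' : SameDeformation ν q p' p'') :
    SameDeformation ν q p p'' := by
  obtain ⟨g, h1, h2⟩ := h
  obtain ⟨g', h3, h4⟩ := h'
  obtain ⟨s, h5, h6⟩ := (h2.and h3).exists
  exact ⟨g, h1, h4.mono fun s hs => (h5.trans h6.symm).trans hs⟩

/-- A whole box, a ball around `(a, H)` times an interval `(0, ε)`, parametrizes embedded curves. It
is convex, so all of them can be joined to the curve at its centre `((a, H), ε / 2)`. -/
lemma eventually_sameDeformation {ν : Fin 3 → Form} (hν : IsImmersed 4 ν) {q : Form}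
    (hq : q.IsHomogeneous 2)
    (hred : ∀ z : Fin 2 → ℂ, z ≠ 0 → MvPolynomial.aeval z q = 0 →
      ∃ j, MvPolynomial.aeval z (MvPolynomial.pderiv j q) ≠ 0)
    {x y : Fin 2 → ℂ} {k : ℂ} (hxy : QuadraticZeros q x y k) {a : Fin 7 → ℝ} {H : Coef}
    (h : IsGenericHeight ν q (bform 6 a)) (ht : crossingSpeed ν x y k a H ≠ 0) :
    ∀ᶠ p in 𝓝 (a, H), SameDeformation ν q (a, H) p := by
  have hev := eventually_isEmbedded_lift hν hq hred hxy h
    ((crossingSpeed_ne_zero_iff hxy a H).mp ht)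
  obtain ⟨⟨r, ε⟩, ⟨hr, hε⟩, hsub⟩ :=
    (Metric.nhds_basis_ball.prod (nhdsGT_basis (0 : ℝ))).mem_iff.mp hev
  simp only at hr hε hsub
  set B : Set (((Fin 7 → ℝ) × Coef) × ℝ) := Metric.ball (a, H) r ×ˢ Set.Ioo 0 ε with hB
  have hc : Continuous fun p : ((Fin 7 → ℝ) × Coef) × ℝ => liftCoef ν q p.1.1 + p.2 • p.1.2 := by
    have : Continuous fun p : ((Fin 7 → ℝ) × Coef) × ℝ => liftCoef ν q p.1.1 :=
      (continuous_liftCoef ν q).comp (continuous_fst.comp continuous_fst)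
    fun_prop
  have hp0 : ((a, H), ε / 2) ∈ B :=
    ⟨Metric.mem_ball_self hr, by constructor <;> linarith⟩
  have hconn : IsPathConnected B :=
    ((convex_ball (a, H) r).prod (convex_Ioo 0 ε)).isPathConnected ⟨_, hp0⟩
  have hjoin : ∀ p ∈ B, JoinedIn embedded (liftCoef ν q a + (ε / 2) • H)
      (liftCoef ν q p.1.1 + p.2 • p.1.2) := fun p hp =>
    ((hconn.image hc).joinedIn _ ⟨_, hp0, rfl⟩ _ ⟨p, hp, rfl⟩).mono (by
      rintro _ ⟨s, hs, rfl⟩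
      exact hsub hs)
  have hdef : ∀ p ∈ Metric.ball (a, H) r, Deforms ν q p (liftCoef ν q a + (ε / 2) • H) := by
    intro p hp
    filter_upwards [prod_mem_prod (Metric.isOpen_ball.mem_nhds hp) (Ioo_mem_nhdsGT hε)] with s hs
    exact hjoin s hs
  filter_upwards [Metric.ball_mem_nhds (a, H) hr] with p hp
  exact ⟨_, hdef _ (Metric.mem_ball_self hr), hdef p hp⟩

/-! ### Derivatives of crossing determinants -/

/-- For velocity zero the determinant is constant, while its quotient by `t` has a finite limit. -/
lemma crossingDet_lift_eq_zero {ν : Fin 3 → Form} (hν : ∀ i, (ν i).IsHomogeneous 4) {q : Form}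
    (hq : q.IsHomogeneous 2) {x y : Fin 2 → ℂ} {k : ℂ} (hxy : QuadraticZeros q x y k)
    {a : Fin 7 → ℝ} (hy : MvPolynomial.aeval y (bform 6 a) ≠ 0) :
    crossingDet (bforms 6 (liftCoef ν q a)) x y = 0 := by
  have h1 := tendsto_crossingDet hν hq hxy hy (tendsto_const_nhds (x := (0 : Coef)))
  simp only [smul_zero, add_zero] at h1
  have h2 : Tendsto (fun t : ℝ => (t : ℂ)) (𝓝[>] 0) (𝓝 0) := by
    have := Complex.continuous_ofReal.tendsto 0
    rw [Complex.ofReal_zero] at this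
    exact this.mono_left nhdsWithin_le_nhds
  have h3 := h2.mul h1
  rw [zero_mul] at h3
  refine tendsto_nhds_unique (tendsto_const_nhds.congr' ?_) h3
  filter_upwards [eventually_mem_nhdsWithin (a := (0 : ℝ))] with t ht
  have : (t : ℂ) ≠ 0 := by exact_mod_cast (ne_of_gt ht)
  field_simp

lemma tendsto_difference_quotient {g : ℝ → Coef} {H : Coef}
    (hg : HasDerivWithinAt g H (Set.Ici 0) 0) :
    Tendsto (fun t => t⁻¹ • (g t - g 0)) (𝓝[>] 0) (𝓝 H) := by
  have := hasDerivWithinAt_iff_tendsto_slope.mp hg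
  rw [Set.Ici_sdiff_left] at this
  refine this.congr fun t => ?_
  simp [slope]

/-- The path is `lift + t • H t` with its difference quotient as `H t`, so `tendsto_crossingDet`
applies. -/
lemma hasDerivWithinAt_crossingDet {ν : Fin 3 → Form} (hν : ∀ i, (ν i).IsHomogeneous 4) {q : Form}
    (hq : q.IsHomogeneous 2) {x y : Fin 2 → ℂ} {k : ℂ} (hxy : QuadraticZeros q x y k)
    {a : Fin 7 → ℝ} (hy : MvPolynomial.aeval y (bform 6 a) ≠ 0) {g : ℝ → Coef} {H : Coef}
    (h0 : g 0 = liftCoef ν q a) (hg : HasDerivWithinAt g H (Set.Ici 0) 0) :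
    HasDerivWithinAt (fun t => (crossingDet (bforms 6 (g t)) x y).re) (crossingSpeed ν x y k a H)
      (Set.Ici 0) 0 := by
  rw [hasDerivWithinAt_iff_tendsto_slope, Set.Ici_sdiff_left]
  have h1 := tendsto_crossingDet hν hq hxy hy (tendsto_difference_quotient hg)
  refine ((Complex.continuous_re.tendsto _).comp h1).congr' ?_
  filter_upwards [eventually_mem_nhdsWithin (a := (0 : ℝ))] with t ht
  have ht0 : t ≠ 0 := ne_of_gt ht
  have e1 : liftCoef ν q a + t • t⁻¹ • (g t - g 0) = g t := by
    rw [smul_inv_smul₀ ht0, h0]; abel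
  simp only [Function.comp, e1]
  rw [slope_def_field, h0, crossingDet_lift_eq_zero hν hq hxy hy, ← Complex.ofReal_inv,
    Complex.re_ofReal_mul]
  simp [div_eq_inv_mul]

lemma crossingDet_smul {G : Fin 4 → Form} (hG : ∀ i, (G i).IsHomogeneous 6) (b c : ℂ)
    (x y : Fin 2 → ℂ) : crossingDet G (b • x) (c • y) = b ^ 10 * c ^ 10 * crossingDet G x y := by
  simp only [crossingDet, dval_smul hG]
  simp [Matrix.det_succ_row_zero, Fin.sum_univ_succ, Fin.succAbove]
  ring

lemma QuadraticZeros.symm {q : Form} {x y : Fin 2 → ℂ} {k : ℂ} (h : QuadraticZeros q x y k) :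
    QuadraticZeros q y x k where
  ne_zero := h.ne_zero
  cross_ne_zero := by rw [cross_swap]; exact neg_ne_zero.mpr h.cross_ne_zero
  real := by
    rcases h.real with ⟨h1, h2⟩ | h1
    · exact Or.inl ⟨h2, h1⟩
    · exact Or.inr (by rw [h1, star_star])
  factor z := by rw [h.factor]; ring
  pderiv_zero z := by rw [h.pderiv_zero]; ring
  pderiv_one z := by rw [h.pderiv_one]; ring

lemma crossingSpeed_swap (ν : Fin 3 → Form) (x y : Fin 2 → ℂ) (k : ℂ) (a : Fin 7 → ℝ) (H : Coef) :
    crossingSpeed ν y x k a H = crossingSpeed ν x y k a H := by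
  rw [crossingSpeed, crossingSpeed, transversal_swap, cross_swap, neg_sq]

/-- Real representatives of a real or complex conjugate pair differ by a positive factor
in the crossing determinant. -/
lemma exists_pos_crossingDet {x y x' y' : Fin 2 → ℂ} (hxy : cross x y ≠ 0) (hxy' : cross x' y' ≠ 0)
    (hr : (star x = x ∧ star y = y) ∨ y = star x)
    (hr' : (star x' = x' ∧ star y' = y') ∨ y' = star x') (hx : cross x' x = 0)
    (hy : cross y' y = 0) : ∃ ρ : ℝ, 0 < ρ ∧ ∀ G : Fin 4 → Form, (∀ i, (G i).IsHomogeneous 6) →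
      crossingDet G x' y' = ρ * crossingDet G x y := by
  have hx0 := ne_zero_of_cross_left hxy
  have hy0 := ne_zero_of_cross_right hxy
  obtain ⟨b, hb, rfl⟩ := exists_smul_of_cross_eq_zero hx0 (ne_zero_of_cross_left hxy')
    (by rw [cross_swap, hx, neg_zero])
  obtain ⟨c, hc, rfl⟩ := exists_smul_of_cross_eq_zero hy0 (ne_zero_of_cross_right hxy')
    (by rw [cross_swap, hy, neg_zero])
  have real : ∀ {b : ℂ} {x : Fin 2 → ℂ}, x ≠ 0 → star x = x → star (b • x) = b • x →
      ((b.re : ℝ) : ℂ) = b := by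
    intro b x hx h1 h2
    rw [star_smul, h1] at h2
    exact Complex.conj_eq_iff_re.mp (smul_left_injective ℂ hx h2)
  -- The mixed cases are impossible, since a real and a conjugate pair of distinct points cannot
  -- agree. In the others the scaling factor is an even power of real numbers or a power of `|b|²`.
  rcases hr with ⟨h1, h2⟩ | rfl <;> rcases hr' with ⟨h3, h4⟩ | h3
  · have e1 := real hx0 h1 h3
    have e2 := real hy0 h2 h4
    have hb' : b.re ≠ 0 := fun h => hb (by rw [← e1, h, Complex.ofReal_zero])
    have hc' : c.re ≠ 0 := fun h => hc (by rw [← e2, h, Complex.ofReal_zero])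
    refine ⟨b.re ^ 10 * c.re ^ 10, by positivity, fun G hG => ?_⟩
    rw [crossingDet_smul hG]
    push_cast
    rw [e1, e2]
  · rw [star_smul, h1] at h3
    refine absurd ?_ hxy'
    rw [h3, cross_smul, cross_self, mul_zero]
  · rw [star_smul] at h3
    refine absurd ?_ hxy'
    rw [← h3, cross_smul, cross_self, mul_zero]
  · rw [star_smul] at h3
    have h4 : c = star b := smul_left_injective ℂ hy0 h3
    refine ⟨Complex.normSq b ^ 10, pow_pos (Complex.normSq_pos.mpr hb) _, fun G hG => ?_⟩
    rw [crossingDet_smul hG, h4, ← mul_pow, Complex.ofReal_pow, Complex.normSq_eq_conj_mul_self,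
      mul_comm b]
    rfl

/-! ### Resolutions of a virtual diagram: uniqueness up to rigid isotopy, and existence. -/

namespace VirtualNodalDiagram

lemma isGenericHeight_of_mem (V : VirtualNodalDiagram) {a : Fin 7 → ℝ} (ha : a ∈ V.realizers) :
    IsGenericHeight V.ν V.q (bform 6 a) :=
  (V.isNodalDiagram_iff _).mp (show V.IsRealizedBy (bform 6 a) from ha).diagram

/-- All deformations of sign `c` of all realizing diagrams lead to the same sextics. -/
lemma sameDeformation (V : VirtualNodalDiagram) (hV : AllRealNodesHyperbolic V.ν)
    {x y : Fin 2 → ℂ} {k : ℂ} (hxy : QuadraticZeros V.q x y k) (c : ℤˣ) {a a' : Fin 7 → ℝ}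
    (ha : a ∈ V.realizers) (ha' : a' ∈ V.realizers) {H H' : Coef}
    (hH : 0 < ((c : ℤ) : ℝ) * crossingSpeed V.ν x y k a H)
    (hH' : 0 < ((c : ℤ) : ℝ) * crossingSpeed V.ν x y k a' H') :
    SameDeformation V.ν V.q (a, H) (a', H') := by
  have hν := V.nodal.toIsImmersed
  have near : ∀ a ∈ V.realizers, ∀ H, 0 < ((c : ℤ) : ℝ) * crossingSpeed V.ν x y k a H →
      ∀ᶠ p in 𝓝 (a, H), SameDeformation V.ν V.q (a, H) p := fun a ha H hH =>
    eventually_sameDeformation hν V.q_homogeneous V.q_reduced hxy (V.isGenericHeight_of_mem ha)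
      (right_ne_zero_of_mul hH.ne')
  have hi : LinearIndependent ℂ ![val V.ν x, val V.ν y] := by
    by_contra hi
    exact V.q_avoids_nodes x y ⟨hxy.cross_ne_zero, hi⟩ hxy.left
  have hside : ∀ a ∈ V.realizers, ∃ H, 0 < ((c : ℤ) : ℝ) * crossingSpeed V.ν x y k a H :=
    fun a ha => exists_crossingSpeed_pos hxy hi
      ((V.isGenericHeight_of_mem ha).disjoint x (ne_zero_of_cross_left hxy.cross_ne_zero) hxy.left)
      ((V.isGenericHeight_of_mem ha).disjoint y (ne_zero_of_cross_right hxy.cross_ne_zero) hxy.right)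
      c
  have fibre : ∀ a ∈ V.realizers, ∀ H H', 0 < ((c : ℤ) : ℝ) * crossingSpeed V.ν x y k a H →
      0 < ((c : ℤ) : ℝ) * crossingSpeed V.ν x y k a H' →
      SameDeformation V.ν V.q (a, H) (a, H') := by
    intro a ha H H' hH hH'
    -- For a fixed height form the speed is linear in `H`, so the velocities of sign `c` form a
    -- half-space.
    have hconv : Convex ℝ {H : Coef | 0 < ((c : ℤ) : ℝ) * crossingSpeed V.ν x y k a H} := by
      intro H hH K hK r s hr hs hrs
      rw [Set.mem_ofPred_eq] at hH hK ⊢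
      rw [crossingSpeed_add_smul, mul_add, mul_left_comm, mul_left_comm _ s]
      rcases hr.eq_or_lt with rfl | hr
      · rw [zero_add] at hrs
        simpa [hrs] using hK
      · exact add_pos_of_pos_of_nonneg (mul_pos hr hH) (mul_nonneg hs hK.le)
    refine hconv.isPreconnected.induction₂ (fun H H' => SameDeformation V.ν V.q (a, H) (a, H'))
      (fun H hH => ?_) (fun _ _ _ _ _ _ h h' => h.trans h') (fun _ _ _ _ h => h.symm) hH hH'
    have hc : Continuous fun K : Coef => (a, K) := by fun_prop
    exact ((hc.tendsto H).eventually (near a ha H hH)).filter_mono nhdsWithin_le_nhds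
  -- Quantifying over all velocities of sign `c` makes the relation one between height forms alone.
  -- Transitivity needs such a velocity at the intermediate form, which `hside` supplies.
  refine (V.isPreconnected_realizers hV).induction₂ (fun a a' => ∀ H H',
    0 < ((c : ℤ) : ℝ) * crossingSpeed V.ν x y k a H →
    0 < ((c : ℤ) : ℝ) * crossingSpeed V.ν x y k a' H' → SameDeformation V.ν V.q (a, H) (a', H'))
    (fun a ha => ?_) (fun a b d _ hb _ h h' H H' hH hH' => ?_)
    (fun _ _ _ _ h H H' hH hH' => (h H' H hH' hH).symm) ha ha' H H' hH hH'
  -- Move to a fixed velocity `K` over `a`, pass to `b` with `K` unchanged, which still has sign `c`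
  -- by continuity, and move on within the half-space over `b`.
  · obtain ⟨K, hK⟩ := hside a ha
    have hc : Continuous fun b : Fin 7 → ℝ => (b, K) := by fun_prop
    have h1 := ((hc.tendsto a).eventually (near a ha K hK)).filter_mono
      (nhdsWithin_le_nhds (s := V.realizers))
    have h2 : ∀ᶠ b in 𝓝[V.realizers] a, 0 < ((c : ℤ) : ℝ) * crossingSpeed V.ν x y k b K :=
      ((continuous_const.mul ((continuous_crossingSpeed V.ν x y k).comp hc)).continuousAt.eventually
        (lt_mem_nhds hK)).filter_mono nhdsWithin_le_nhds
    filter_upwards [h1, h2, self_mem_nhdsWithin] with b hb1 hb2 hb H H' hH hH'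
    exact ((fibre a ha H K hH hK).trans hb1).trans (fibre b hb K H' hb2 hH')
  · obtain ⟨K, hK⟩ := hside b hb
    exact (h H K hH hK).trans (h' K H' hK hH')

/-- A sextic obtained from a virtual diagram is obtained by moving a lift in some direction. -/
lemma Yields.exists_deforms {V : VirtualNodalDiagram} {x y : Fin 2 → ℂ} {k : ℂ}
    (hxy : QuadraticZeros V.q x y k) {c : ℤˣ} {K : Set (Projectivization ℂ (Fin 4 → ℂ))}
    (h : V.Yields c K) : ∃ a ∈ V.realizers, ∃ H : Coef,
      0 < ((c : ℤ) : ℝ) * crossingSpeed V.ν x y k a H ∧ ∃ g' : Coef, K = curve (bforms 6 g') ∧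
        ∀ g, Deforms V.ν V.q (a, H) g → JoinedIn embedded g g' := by
  obtain ⟨F, hF, G, hcont, h0, hemb, hK, hdiff, x', y', hdp, hreal, w, hw, hder⟩ := h
  have hν := V.nodal.toIsImmersed
  have hFhom := hF.diagram.homogeneous
  set a := coefs 6 F with ha_def
  have haF : bform 6 a = F := bform_coefs hFhom
  have ha : a ∈ V.realizers := by rw [realizers, Set.mem_ofPred_eq, haF]; exact hF
  have hgen := V.isGenericHeight_of_mem ha
  set g : ℝ → Coef := fun t i => coefs 6 (G t i) with hg
  have hGhom : ∀ t ∈ Set.Icc (0 : ℝ) 1, ∀ i, (G t i).IsHomogeneous 6 := by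
    intro t ht
    rcases ht.1.eq_or_lt with rfl | ht0
    · rw [h0]; exact isHomogeneous_lift hν.homogeneous V.q_homogeneous hFhom
    · exact (hemb t ⟨ht0, ht.2⟩).homogeneous
  have hbg : ∀ t ∈ Set.Icc (0 : ℝ) 1, bforms 6 (g t) = G t := fun t ht => bforms_coefs (hGhom t ht)
  have hg0 : g 0 = liftCoef V.ν V.q a := by
    ext i : 1
    simp only [hg, h0]
    fin_cases i <;> rfl
  have hgd : DifferentiableWithinAt ℝ g (Set.Ici 0) 0 :=
    differentiableWithinAt_pi.mpr fun i => differentiableWithinAt_pi.mpr fun j => hdiff i _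
  have hgc : ContinuousOn g (Set.Icc 0 1) :=
    continuousOn_pi.mpr fun i => continuousOn_pi.mpr fun j => hcont i _
  set H := derivWithin g (Set.Ici 0) 0 with hH
  have hgH : HasDerivWithinAt g H (Set.Ici 0) 0 := hgd.hasDerivWithinAt
  have hunit : Set.Icc (0 : ℝ) 1 ∈ 𝓝[≥] 0 := Icc_mem_nhdsGE one_pos
  -- The resolution measures its sign with its own representatives `x'`, `y'`; these change the
  -- derivative by a positive factor. The zeros are quantified again because they may correspond in
  -- either order.
  have hspeed : ∀ {x y : Fin 2 → ℂ}, QuadraticZeros V.q x y k → cross x' x = 0 → cross y' y = 0 →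
      0 < ((c : ℤ) : ℝ) * crossingSpeed V.ν x y k a H := by
    intro x y hxy hx hy
    obtain ⟨ρ, hρ, hρG⟩ :=
      exists_pos_crossingDet hxy.cross_ne_zero hdp.1 hxy.real hreal hx hy
    have h1 := (hasDerivWithinAt_crossingDet hν.homogeneous V.q_homogeneous hxy
      (hgen.disjoint y (ne_zero_of_cross_right hxy.cross_ne_zero) hxy.right) hg0 hgH).const_mul ρ
    have h2 : HasDerivWithinAt (fun t => (crossingDet (G t) x' y').re)
        (ρ * crossingSpeed V.ν x y k a H) (Set.Ici 0) 0 := by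
      refine h1.congr_of_eventuallyEq ?_ ?_
      · filter_upwards [hunit] with t ht
        rw [hρG _ (hGhom t ht), Complex.re_ofReal_mul, hbg t ht]
      · rw [hρG _ (hGhom 0 (by simp)), Complex.re_ofReal_mul, hbg 0 (by simp)]
    have h3 : w = ρ * crossingSpeed V.ν x y k a H :=
      (uniqueDiffOn_Ici (0 : ℝ) 0 Set.self_mem_Ici).eq_deriv _ hder h2
    rw [h3, mul_left_comm] at hw
    exact pos_of_mul_pos_right hw hρ.le
  refine ⟨a, ha, H, ?_, g 1, ?_, fun g₀ hg₀ => ?_⟩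
  · rw [← haF] at h0
    have hdp' := hdp
    rw [← haF] at hdp'
    rcases hgen.only hν hxy hdp' with ⟨h1, h2⟩ | ⟨h1, h2⟩
    · exact hspeed hxy h1 h2
    · rw [← crossingSpeed_swap]
      exact hspeed hxy.symm h1 h2
  · rw [hbg 1 (by simp), hK]
  -- For small `t` the curve `g t` is a lift moved in a direction close to `H`, hence joined to
  -- `g₀`; from there the given path leads through embedded curves to `g 1`.
  · have hlim : Tendsto (fun t => ((a, t⁻¹ • (g t - g 0)), t)) (𝓝[>] (0 : ℝ))
        (𝓝 (a, H) ×ˢ 𝓝[>] (0 : ℝ)) :=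
      (tendsto_const_nhds.prodMk_nhds (tendsto_difference_quotient hgH)).prodMk tendsto_id
    obtain ⟨t, h1, ht⟩ := ((hlim.eventually hg₀).and (Ioo_mem_nhdsGT (one_pos (α := ℝ)))).exists
    simp only at h1
    rw [smul_inv_smul₀ ht.1.ne', hg0, add_sub_cancel] at h1
    refine h1.trans ?_
    have hconn : IsPathConnected (g '' Set.Icc t 1) :=
      ((convex_Icc t 1).isPathConnected ⟨1, ht.2.le, le_rfl⟩).image'
        (hgc.mono (Set.Icc_subset_Icc_left ht.1.le))
    refine (hconn.joinedIn _ ⟨t, ⟨le_rfl, ht.2.le⟩, rfl⟩ _ ⟨1, ⟨ht.2.le, le_rfl⟩, rfl⟩).mono ?_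
    rintro _ ⟨s, hs, rfl⟩
    have hs0 : 0 < s := ht.1.trans_le hs.1
    change IsEmbedded 6 (bforms 6 (g s))
    rw [hbg s ⟨hs0.le, hs.2⟩]
    exact hemb s ⟨hs0, hs.2⟩

/-- A realizable virtual diagram yields a sextic of each sign. -/
lemma exists_yields (V : VirtualNodalDiagram) {F : Form} (hF : V.IsRealizedBy F) (c : ℤˣ) :
    ∃ K, V.Yields c K := by
  have hν := V.nodal.toIsImmersed
  obtain ⟨x, y, k, hxy⟩ := exists_quadraticZeros V.q_homogeneous V.q_reduced
  set a := coefs 6 F with ha_def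
  have haF : bform 6 a = F := bform_coefs hF.diagram.homogeneous
  have ha : a ∈ V.realizers := by rw [realizers, Set.mem_ofPred_eq, haF]; exact hF
  have hgen := V.isGenericHeight_of_mem ha
  have hi : LinearIndependent ℂ ![val V.ν x, val V.ν y] := by
    by_contra hi
    exact V.q_avoids_nodes x y ⟨hxy.cross_ne_zero, hi⟩ hxy.left
  have hy := hgen.disjoint y (ne_zero_of_cross_right hxy.cross_ne_zero) hxy.right
  obtain ⟨H, hH⟩ := exists_crossingSpeed_pos hxy hi
    (hgen.disjoint x (ne_zero_of_cross_left hxy.cross_ne_zero) hxy.left) hy c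
  have hev := eventually_isEmbedded_lift hν V.q_homogeneous V.q_reduced hxy hgen
    ((crossingSpeed_ne_zero_iff hxy a H).mp (right_ne_zero_of_mul hH.ne'))
  have hlim : Tendsto (fun t => ((a, H), t)) (𝓝[>] (0 : ℝ)) (𝓝 (a, H) ×ˢ 𝓝[>] (0 : ℝ)) :=
    tendsto_const_nhds.prodMk tendsto_id
  obtain ⟨ε, hε, hsub⟩ := mem_nhdsGT_iff_exists_Ioc_subset.mp (hlim.eventually hev)
  rw [Set.mem_Ioi] at hε
  -- Time is rescaled so that `(0, 1]` corresponds to the interval `(0, ε]` on which the curves are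
  -- embedded; the velocity becomes `ε • H`, of the same sign.
  set g : ℝ → Coef := fun t => liftCoef V.ν V.q a + (t * ε) • H with hg
  have hg0 : g 0 = liftCoef V.ν V.q a := by simp [hg]
  have hcoeff : ∀ i m, (fun t => (bforms 6 (g t) i).coeff m) = fun t =>
      (bform 6 (liftCoef V.ν V.q a i)).coeff m + t * ε * (bform 6 (H i)).coeff m := by
    intro i m
    ext t
    simp [bforms, hg, bform_add, bform_smul]
  have hder : HasDerivWithinAt g (ε • H) (Set.Ici 0) 0 := by
    have := (((hasDerivAt_id (0 : ℝ)).mul_const ε).smul_const H).const_add (liftCoef V.ν V.q a)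
    rw [one_mul] at this
    exact this.hasDerivWithinAt
  refine ⟨_, F, hF, fun t => bforms 6 (g t), fun i m => ?_, ?_, fun t ht => ?_, rfl, fun i m => ?_,
    x, y, (isOneNodal_lift hν V.q_homogeneous V.q_reduced V.q_avoids_nodes (haF ▸ hgen) hxy).double,
    hxy.real, _, ?_,
    hasDerivWithinAt_crossingDet hν.homogeneous V.q_homogeneous hxy hy hg0 hder⟩
  · rw [hcoeff]; fun_prop
  · simp only [hg0]
    rw [bforms_liftCoef hν.homogeneous V.q_homogeneous, haF]
  · exact hsub ⟨mul_pos ht.1 hε, by nlinarith [ht.2]⟩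
  · rw [hcoeff]; fun_prop
  · have := crossingSpeed_add_smul V.ν x y k a ε 0 H H
    rw [zero_smul, add_zero, zero_mul, add_zero] at this
    rw [this, mul_left_comm]
    exact mul_pos hε hH

lemma Yields.rigidlyIsotopic {V : VirtualNodalDiagram} (hV : AllRealNodesHyperbolic V.ν) {c : ℤˣ}
    {K₁ K₂ : Set (Projectivization ℂ (Fin 4 → ℂ))} (h₁ : V.Yields c K₁) (h₂ : V.Yields c K₂) :
    RigidlyIsotopic 6 K₁ K₂ := by
  obtain ⟨x, y, k, hxy⟩ := exists_quadraticZeros V.q_homogeneous V.q_reduced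
  obtain ⟨a₁, ha₁, H₁, hH₁, g₁, rfl, hg₁⟩ := h₁.exists_deforms hxy
  obtain ⟨a₂, ha₂, H₂, hH₂, g₂, rfl, hg₂⟩ := h₂.exists_deforms hxy
  obtain ⟨g, hd₁, hd₂⟩ := V.sameDeformation hV hxy c ha₁ ha₂ hH₁ hH₂
  exact rigidlyIsotopic_of_joinedIn ((hg₁ g hd₁).symm.trans (hg₂ g hd₂))

end VirtualNodalDiagram

end RealSextic

end

theorem mainTheorem4 (V : RealSextic.VirtualNodalDiagram)
    (hV : RealSextic.AllRealNodesHyperbolic V.ν) :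
    ((∃ F : RealSextic.Form, V.IsRealizedBy F) ↔ V.oddArcs.encard ≤ 6) ∧
    (V.oddArcs.encard ≤ 6 → ∀ c : ℤˣ,
      (∃ K, V.Yields c K) ∧
      ∀ K₁ K₂, V.Yields c K₁ → V.Yields c K₂ → RealSextic.RigidlyIsotopic 6 K₁ K₂) := by
  refine ⟨?_, fun h c => ⟨?_, fun K₁ K₂ h₁ h₂ => h₁.rigidlyIsotopic hV h₂⟩⟩
  · rw [V.exists_isRealizedBy_iff hV, V.signed_nonempty_iff]
  · obtain ⟨F, hF⟩ := (V.exists_isRealizedBy_iff hV).mpr (V.signed_nonempty_iff.mpr h)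
    exact V.exists_yields hF c
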